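/- Let $N,d\ge 2$, $t\ge 0$ be integers and $\varepsilon>0$. Moment operators. For a probability distribution $\nu$ on $\mathrm U(q)$ put $M_\nu^{(t)}=\mathbb E_{U\sim\nu}[U^{\otimes t}\otimes (U^{*})^{\otimes t}]$ ($U^*$ the entrywise conjugate) and $\Delta_\nu^{(t)}=1-\|M_\nu^{(t)}-M_{\rm Haar}^{(t)}\|_\infty$, where $\|\cdot\|_\infty$ is the operator norm. Call $\nu$ an $\varepsilon$-approximate unitary $t$-design if $\|M_\nu^{(t)}-M_{\rm Haar}^{(t)}\|_\infty\le \varepsilon/q^{2t}$. Circuits. A circuit with fixed architecture on $N$ qudits of local dimension $d$ is a sequence of layers. Each layer consists of independent random two-qudit gates on predetermined, pairwise disjoint pairs of qudits, and each gate is drawn from its own arbitrary probability distribution on $\mathrm U(d^2)$; different layers are independent. Divide the layers into consecutive blocks of $l$ layers and assume that each block is connected, i.e. the pairs on which its gates act form a connected graph on all $N$ qudits. The architecture is complete if every layer has $\lfloor N/2\rfloor$ gates and incomplete otherwise. Let $\Delta^{(t)}_{{\rm loc},i}$ be the minimum of the spectral gaps (on $\mathrm U(d^2)$) of the gate distributions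 in the $i$-th block, let $$\Delta_{\rm loc}^{(t)}=\inf_{K\ge 1}\frac1K\sum_{i=1}^K\Delta^{(t)}_{{\rm loc},i},$$ and assume $\Delta_{\rm loc}^{(t)}>0$. Depth. Let $\Delta_{\rm bw}^{(t)}(m,d)$ be the spectral gap of the two-layer block of the Haar random 1D brickwork circuit (open boundary) on $m$ qudits: Haar random gates on $\{1,2\},\{3,4\},\dots$, followed by Haar random gates on $\{2,3\},\{4,5\},\dots$. Put $$f_{\rm c}=\min_{2\le m\le N}\Delta_{\rm bw}^{(t)}(m,d),\qquad f_{\rm i}=f_{\rm c}^{\,h},\quad h=8\lceil\log_2\lfloor\log_2(N+1)\rfloor\rceil+1,$$ $f=f_{\rm c}$ if the architecture is complete, $f=f_{\rm i}$ if it is incomplete, and $$L_A^{\rm H}=f^{-l+1}\cdot l\,(2Nt\log d-\log\varepsilon).$$ Theorem. Let $L\ge 0$ be an integer such that $L$ is a multiple of $l$ or $\varepsilon\le 1$. If $L\ge(\Delta_{\rm loc}^{(t)})^{-l}L_A^{\rm H}$, then the distribution on $\mathrm U(d^N)$ of the product of the first $L$ layers of the circuit is an $\varepsilon$-approximate unitary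 $t$-design. -/

import Mathlib

open MeasureTheory Matrix
open scoped Kronecker

namespace RandomCircuit

noncomputable section

section Unitary

variable {n : Type*} [Fintype n] [DecidableEq n]

/-- The unitary group carries its Borel σ-algebra. -/
instance : MeasurableSpace (unitaryGroup n ℂ) := borel _

instance : BorelSpace (unitaryGroup n ℂ) := ⟨rfl⟩

instance : CompactSpace (unitaryGroup n ℂ) := by
  have hK : IsCompact (Set.univ.pi fun _ : n => Set.univ.pi fun _ : n =>
      Metric.closedBall (0 : ℂ) 1) :=
    isCompact_univ_pi fun _ => isCompact_univ_pi fun _ => isCompact_closedBall _ _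
  have hc : IsClosed ((unitaryGroup n ℂ : Submonoid (Matrix n n ℂ)) : Set (Matrix n n ℂ)) :=
    isClosed_unitary
  refine isCompact_iff_compactSpace.mp (hK.of_isClosed_subset hc ?_)
  intro U hU i _ j _
  simpa using entry_norm_bound_of_unitary hU i j

/-- The Haar probability measure on the unitary group. -/
def haarU (n : Type*) [Fintype n] [DecidableEq n] : Measure (unitaryGroup n ℂ) :=
  Measure.haarMeasure ⊤

instance : IsProbabilityMeasure (haarU n) where
  measure_univ := by
    have h := Measure.haarMeasure_self (G := unitaryGroup n ℂ) (K₀ := ⊤)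
    simpa [haarU] using h

/-- `tensorPower t U` is the matrix of `U^{⊗t} ⊗ (U^*)^{⊗t}`, where `U^*` is the entrywise complex
conjugate of `U`. -/
def tensorPower (t : ℕ) (U : Matrix n n ℂ) :
    Matrix ((Fin t → n) × (Fin t → n)) ((Fin t → n) × (Fin t → n)) ℂ :=
  Matrix.of fun x y => (∏ a, U (x.1 a) (y.1 a)) * ∏ a, star (U (x.2 a) (y.2 a))

/-- The `t`-th moment operator `𝔼_{U ∼ ν} [U^{⊗t} ⊗ (U^*)^{⊗t}]`. -/
def momentOp (t : ℕ) (ν : Measure (unitaryGroup n ℂ)) :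
    Matrix ((Fin t → n) × (Fin t → n)) ((Fin t → n) × (Fin t → n)) ℂ :=
  Matrix.of fun x y => ∫ U, tensorPower t (U : Matrix n n ℂ) x y ∂ν

/-- The operator norm of a matrix (with respect to the Euclidean norm of vectors). -/
def opNorm {m : Type*} [Fintype m] [DecidableEq m] (A : Matrix m m ℂ) : ℝ :=
  ‖Matrix.toEuclideanCLM (𝕜 := ℂ) A‖

/-- The spectral gap `1 - ‖M_ν - M_Haar‖`. -/
def gap (t : ℕ) (ν : Measure (unitaryGroup n ℂ)) : ℝ :=
  1 - opNorm (momentOp t ν - momentOp t (haarU n))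

/-- `ν` is an `ε`-approximate unitary `t`-design on `U(q)`, `q = card n`. -/
def IsApproxDesign (t : ℕ) (ε : ℝ) (ν : Measure (unitaryGroup n ℂ)) : Prop :=
  opNorm (momentOp t ν - momentOp t (haarU n)) ≤ ε / (Fintype.card n : ℝ) ^ (2 * t)

end Unitary

/-- The unitary `U ⊗ 1` on `N` qudits, where `U` acts on the qudits in `S`. -/
def onSites {N d : ℕ} (S : Finset (Fin N)) (U : unitaryGroup (S → Fin d) ℂ) :
    unitaryGroup (Fin N → Fin d) ℂ :=
  ⟨((U : Matrix (S → Fin d) (S → Fin d) ℂ) ⊗ₖ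
      (1 : Matrix ({k // k ∉ S} → Fin d) ({k // k ∉ S} → Fin d) ℂ)).submatrix
      (Equiv.piEquivPiSubtypeProd (fun k => k ∈ S) fun _ => Fin d)
      (Equiv.piEquivPiSubtypeProd (fun k => k ∈ S) fun _ => Fin d), by
    have h := kronecker_mem_unitary U.2
      (one_mem (unitaryGroup ({k // k ∉ S} → Fin d) ℂ))
    rw [mem_unitaryGroup_iff] at h ⊢
    rw [star_eq_conjTranspose] at h ⊢
    rw [conjTranspose_submatrix, submatrix_mul_equiv, h, submatrix_one_equiv]⟩

/-- A random two-qudit gate: a pair of sites and a probability distribution on the unitary group of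
these two qudits. -/
structure Gate (N d : ℕ) where
  sites : Finset (Fin N)
  card_sites : sites.card = 2
  law : ProbabilityMeasure (unitaryGroup (sites → Fin d) ℂ)

/-- The distribution on the unitary group of all `N` qudits induced by a random gate. -/
def Gate.globalLaw {N d : ℕ} (g : Gate N d) : Measure (unitaryGroup (Fin N → Fin d) ℂ) :=
  (g.law : Measure (unitaryGroup (g.sites → Fin d) ℂ)).map (onSites g.sites)

/-- The spectral gap of the two-qudit distribution of a gate. -/
def Gate.localGap {N d : ℕ} (t : ℕ) (g : Gate N d) : ℝ :=
  gap t (g.law : Measure (unitaryGroup (g.sites → Fin d) ℂ))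

/-- The Haar random gate on the pair of sites `{i, j}`. -/
def haarGate {N d : ℕ} (i j : Fin N) (h : i ≠ j) : Gate N d where
  sites := {i, j}
  card_sites := Finset.card_pair h
  law := ⟨haarU _, inferInstance⟩

/-- A single layer: gates at predetermined, pairwise disjoint positions. (The gates commute, so
their order in the list does not matter.) -/
structure Layer (N d : ℕ) where
  gates : List (Gate N d)
  disjoint : gates.Pairwise fun g h => Disjoint g.sites h.sites

/-- The distribution of the product of independent random unitaries with the laws in the list. -/
def convList {G : Type*} [Monoid G] [MeasurableSpace G] (l : List (Measure G)) : Measure G :=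
  l.foldr Measure.mconv (Measure.dirac 1)

/-- The unitary ensemble of a layer: the tensor product of its independent gates. -/
def Layer.law {N d : ℕ} (A : Layer N d) : Measure (unitaryGroup (Fin N → Fin d) ℂ) :=
  convList (A.gates.map Gate.globalLaw)

/-- The ensemble `ν_{L-1} * ⋯ * ν_1 * ν_0` of the first `L` layers of a circuit. -/
def circuitLaw {N d : ℕ} (C : ℕ → Layer N d) : ℕ → Measure (unitaryGroup (Fin N → Fin d) ℂ)
  | 0 => Measure.dirac 1
  | L + 1 => Measure.mconv (C L).law (circuitLaw C L)

/-- First layer of the 1D brickwork circuit on `m` qudits: Haar random gates on `{0,1}, {2,3}, …`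
(open boundary). -/
def brickLayerEven (m d : ℕ) : Layer m d where
  gates := List.ofFn fun k : Fin (m / 2) =>
    haarGate ⟨2 * k, by omega⟩ ⟨2 * k + 1, by omega⟩ (by simp)
  disjoint := by
    rw [List.pairwise_ofFn]
    intro a b hab
    simp only [haarGate, Finset.disjoint_insert_left, Finset.disjoint_singleton_left,
      Finset.mem_insert, Finset.mem_singleton, Fin.ext_iff]
    have := Fin.lt_def.mp hab
    omega

/-- Second layer of the 1D brickwork circuit on `m` qudits: Haar random gates on
`{1,2}, {3,4}, …`. -/
def brickLayerOdd (m d : ℕ) : Layer m d where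
  gates := List.ofFn fun k : Fin ((m - 1) / 2) =>
    haarGate ⟨2 * k + 1, by omega⟩ ⟨2 * k + 2, by omega⟩ (by simp)
  disjoint := by
    rw [List.pairwise_ofFn]
    intro a b hab
    simp only [haarGate, Finset.disjoint_insert_left, Finset.disjoint_singleton_left,
      Finset.mem_insert, Finset.mem_singleton, Fin.ext_iff]
    have := Fin.lt_def.mp hab
    omega

/-- The spectral gap of the two-layer block of the Haar random 1D brickwork circuit on `m` qudits
of local dimension `d`. -/
def brickGap (t m d : ℕ) : ℝ :=
  gap t (Measure.mconv (brickLayerOdd m d).law (brickLayerEven m d).law)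

/-- `f_c`: the minimum of the brickwork gaps over `2 ≤ m ≤ N`. -/
def fComplete (N t d : ℕ) : ℝ :=
  sInf ((fun m => brickGap t m d) '' Set.Icc 2 N)

/-- `f_i = f_c ^ h` with `h = 8 ⌈log₂ ⌊log₂ (N + 1)⌋⌉ + 1`. -/
def fIncomplete (N t d : ℕ) : ℝ :=
  fComplete N t d ^ (8 * Nat.clog 2 (Nat.log 2 (N + 1)) + 1)

/-- The architecture of a circuit is complete if every layer consists of `⌊N/2⌋` gates. -/
def IsComplete {N d : ℕ} (C : ℕ → Layer N d) : Prop :=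
  ∀ k, (C k).gates.length = N / 2

open Classical in
/-- `f = f_c` for complete architectures, and `f = f_i` for incomplete ones. -/
def archF {N d : ℕ} (t : ℕ) (C : ℕ → Layer N d) : ℝ :=
  if IsComplete C then fComplete N t d else fIncomplete N t d

/-- The graph on the sites formed by the gates of the `i`-th block of `l` consecutive layers, i.e.
the layers `l * i, …, l * i + l - 1`. -/
def blockGraph {N d : ℕ} (C : ℕ → Layer N d) (l i : ℕ) : SimpleGraph (Fin N) :=
  SimpleGraph.fromRel fun a b => ∃ j < l, ∃ g ∈ (C (l * i + j)).gates, a ∈ g.sites ∧ b ∈ g.sites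

/-- The local spectral gap of the `i`-th block: the minimum of the spectral gaps of its gates. -/
def blockLocalGap {N d : ℕ} (t : ℕ) (C : ℕ → Layer N d) (l i : ℕ) : ℝ :=
  sInf {x | ∃ j < l, ∃ g ∈ (C (l * i + j)).gates, x = g.localGap t}

/-- The averaged local spectral gap: the infimum over `K ≥ 1` of the mean of the local spectral
gaps of the first `K` blocks. -/
def avgLocalGap {N d : ℕ} (t : ℕ) (C : ℕ → Layer N d) (l : ℕ) : ℝ :=
  ⨅ K : {K : ℕ // 1 ≤ K}, (1 / (K : ℝ)) * ∑ i ∈ Finset.range (K : ℕ), blockLocalGap t C l i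

/-- `L_A^H = f ^ (-l + 1) * l * (2 N t log d - log ε)`. -/
def haarDepth {N d : ℕ} (t : ℕ) (C : ℕ → Layer N d) (l : ℕ) (ε : ℝ) : ℝ :=
  archF t C ^ (-(l : ℤ) + 1) * (l * (2 * N * t * Real.log d - Real.log ε))

end

end RandomCircuit

/-!
The moment operators of the layers act on the space of `U^{⊗t} ⊗ (U^*)^{⊗t}`, and multiply along the
circuit (`mop_circuitLaw`). Averaging over Haar random gates on a pair of sites is the projection
onto the invariants `V i j` of this pair (`mop_map_haarU`, `pairFix`), and a gate with local gap `Δ`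
has distance `1 - Δ` from this projection. What is needed of these projections is collected in
`PairSystem`: projections of disjoint pairs commute, `V i j ⊓ V j k ≤ V i k`, and the brickwork
circuit along any list of distinct sites has a gap of at least `f = f_c`. Hence every equivalence
relation `r` on the sites has a projection `Π r`, onto the vectors invariant under all gates on
related pairs. Universality of two-qudit gates (`rep_amp_apply_eq_self`) says that this is Haar
averaging over the unitaries on the classes of `r`. It is proved algebraically: an operator that
commutes with the tensor powers of the unitary gates commutes, by analytic continuation, with those
of the transvections on pairs of sites, and commutators of these generate all matrices of
determinant one.

The combinatorial core is a lower bound on the gap of a layer `r₁` and the relation `r₂` joined by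
the preceding layers, that is, on `1 - ‖Π r₁ Π r₂ - Π (r₁ ⊔ r₂)‖`. If every class of `r₁ ⊔ r₂` can be
traversed by a list of sites along which the gates of a brickwork circuit are absorbed by `Π r₁` and
`Π r₂`, the gap is at least `f` (`le_gap₂_of_goodList`).

* If both layers leave out at most one site, such a list is an Eulerian circuit
  (`PairSystem.f_le_gap₂_matching`).
* In general, the classes of `r₂` (clusters) are the vertices of a graph, with the gates of the layer
  as edges, and a rooted spanning forest of it is merged in several rounds
  (`PairSystem.pow_le_gap₂_matching`). The level of a cluster is the logarithm of the size of its
  subtree; a cluster has at most one child of its own level, so the edges within a level form chains,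
  which are merged at the cost of a factor `f ^ 4`. The remaining edges between the levels `2i` and
  `2i + 1` form stars, which are merged at the cost of a factor `f ^ 3`. This halves the number of
  levels, which is at most `log₂ (N + 1)` at the beginning, so that `f ^ (3 ⌈log₂ log₂ (N + 1)⌉ + 4)`
  remains, which is at least `f_i`.

Gaps multiply when operators are composed (`norm_mul_sub_pr_le`), so a connected block of `l` layers
with local gap `Δ` has distance at most `1 - Δ ^ l * F ^ (l - 1)` from the Haar projection, where `F`
is `f_c` or `f_i` (`PairSystem.norm_opProd_sub_proj_le`), and these distances multiply over the
blocks. The power mean inequality replaces `Δ` by its average. If the depth is not a multiple of `l`,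
the lost incomplete block is compensated by the second-order term of `-log (1 - γ)`
(`pow_le_exp_neg`), where `ε ≤ 1` and `t ≥ 1` ensure that the exponent is at least `2`; for `t = 0`
all moment operators agree.
-/

namespace RandomCircuit

noncomputable section

/-! ### Orthogonal projections and approximate projections -/

section Operators

variable {E : Type*} [NormedAddCommGroup E] [InnerProductSpace ℂ E] [FiniteDimensional ℂ E]

/-- The orthogonal projection onto a subspace, as an endomorphism of the whole space. -/
abbrev pr (K : Submodule ℂ E) : E →L[ℂ] E := K.starProjection

lemma pr_mul_of_le {U W : Submodule ℂ E} (h : U ≤ W) : pr U * pr W = pr U :=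
  Submodule.starProjection_comp_starProjection_of_le h

lemma star_pr (K : Submodule ℂ E) : star (pr K) = pr K :=
  (isStarProjection_starProjection (U := K)).isSelfAdjoint

lemma norm_star_clm (T : E →L[ℂ] E) : ‖star T‖ = ‖T‖ := by
  rw [ContinuousLinearMap.star_eq_adjoint, LinearIsometryEquiv.norm_map]

lemma pr_mul_of_ge {U W : Submodule ℂ E} (h : U ≤ W) : pr W * pr U = pr U := by
  have := congrArg star (pr_mul_of_le h)
  rwa [star_mul, star_pr, star_pr] at this

lemma pr_mul_self (K : Submodule ℂ E) : pr K * pr K = pr K := pr_mul_of_le le_rfl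

lemma norm_pr_le (K : Submodule ℂ E) : ‖pr K‖ ≤ 1 := K.starProjection_norm_le

lemma pr_top : pr (⊤ : Submodule ℂ E) = 1 := Submodule.starProjection_top'

lemma one_sub_pr (K : Submodule ℂ E) : 1 - pr K = pr Kᗮ := by
  exact (Submodule.starProjection_orthogonal' K).symm

lemma norm_one_sub_pr_le (K : Submodule ℂ E) : ‖1 - pr K‖ ≤ 1 := by
  rw [one_sub_pr]; exact norm_pr_le _

lemma pr_apply_eq_self_iff {K : Submodule ℂ E} {v : E} : pr K v = v ↔ v ∈ K :=
  Submodule.starProjection_eq_self_iff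

/-- The norm of a block diagonal operator is at most the maximum of the norms of the blocks. -/
lemma norm_add_le_of_block {K : Submodule ℂ E} {X Y : E →L[ℂ] E} {c : ℝ} (hc : 0 ≤ c)
    (hX₁ : pr K * X = X) (hX₂ : X * pr K = X) (hY₁ : pr K * Y = 0) (hY₂ : Y * pr K = 0)
    (hX : ‖X‖ ≤ c) (hY : ‖Y‖ ≤ c) : ‖X + Y‖ ≤ c := by
  refine ContinuousLinearMap.opNorm_le_bound _ hc fun x => ?_
  have hYx : Y x = Y (pr Kᗮ x) := by
    rw [← one_sub_pr]
    have : Y (pr K x) = 0 := DFunLike.congr_fun hY₂ x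
    simp [this]
  have hXx : X x = X (pr K x) := (DFunLike.congr_fun hX₂ x).symm
  have horth : inner ℂ (X x) (Y x) = 0 := by
    have h1 : X x ∈ K := by
      rw [← pr_apply_eq_self_iff]; exact DFunLike.congr_fun hX₁ x
    have h2 : Y x ∈ Kᗮ := by
      rw [← pr_apply_eq_self_iff, ← one_sub_pr]
      have : pr K (Y x) = 0 := DFunLike.congr_fun hY₁ x
      simp [this]
    exact Submodule.inner_right_of_mem_orthogonal h1 h2
  have h1 : ‖X x‖ ≤ c * ‖pr K x‖ := by
    rw [hXx]; exact X.le_of_opNorm_le hX _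
  have h2 : ‖Y x‖ ≤ c * ‖pr Kᗮ x‖ := by
    rw [hYx]; exact Y.le_of_opNorm_le hY _
  have h3 := norm_add_sq_eq_norm_sq_add_norm_sq_of_inner_eq_zero (X x) (Y x) horth
  have h4 := Submodule.norm_sq_eq_add_norm_sq_starProjection x K
  refine le_of_sq_le_sq ?_ (by positivity)
  have h5 : ‖X x‖ ^ 2 ≤ (c * ‖pr K x‖) ^ 2 := by gcongr
  have h6 : ‖Y x‖ ^ 2 ≤ (c * ‖pr Kᗮ x‖) ^ 2 := by gcongr
  rw [_root_.add_apply, mul_pow, h4]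
  nlinarith

/-- If `A` is a contraction that is close to the projection onto `K`, and `T` times this projection
is close to the projection onto `W ≤ K`, then `T * A` is close to the projection onto `W`: the
gaps, that is, the differences of the distances from `1`, multiply. -/
lemma norm_mul_sub_pr_le {A T : E →L[ℂ] E} {K W : Submodule ℂ E} (hWK : W ≤ K)
    (hA₁ : A * pr K = pr K) (hA₂ : pr K * A = pr K) (hT : ‖T‖ ≤ 1) (hTW : T * pr W = pr W)
    {δ g : ℝ} (hδ : 0 ≤ δ) (h1 : ‖A - pr K‖ ≤ 1 - δ) (h2 : ‖T * pr K - pr W‖ ≤ 1 - g) :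
    ‖T * A - pr W‖ ≤ 1 - δ * g := by
  have hδ1 : 0 ≤ 1 - δ := (norm_nonneg _).trans h1
  have hB : ‖((1 - δ : ℝ) : ℂ) • pr K + (A - pr K)‖ ≤ 1 - δ := by
    refine norm_add_le_of_block (K := K) hδ1 ?_ ?_ ?_ ?_ ?_ h1
    · rw [mul_smul_comm, pr_mul_self]
    · rw [smul_mul_assoc, pr_mul_self]
    · rw [mul_sub, hA₂, pr_mul_self, sub_self]
    · rw [sub_mul, hA₁, pr_mul_self, sub_self]
    · rw [norm_smul, Complex.norm_real, Real.norm_of_nonneg hδ1]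
      exact mul_le_of_le_one_right hδ1 (norm_pr_le _)
  have key : T * A - pr W = (δ : ℂ) • (T * pr K - pr W)
      + T * (((1 - δ : ℝ) : ℂ) • pr K + (A - pr K)) * (1 - pr W) := by
    have e1 : A * pr W = pr W := by rw [← pr_mul_of_ge hWK, ← mul_assoc, hA₁]
    have e2 : (((1 - δ : ℝ) : ℂ) • pr K + (A - pr K)) * pr W = ((1 - δ : ℝ) : ℂ) • pr W := by
      rw [add_mul, sub_mul, e1, smul_mul_assoc, pr_mul_of_ge hWK, sub_self, add_zero]
    rw [mul_sub, mul_one, mul_assoc, e2, mul_smul_comm, hTW, mul_add, mul_sub, mul_smul_comm]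
    push_cast
    module
  rw [key]
  calc _ ≤ ‖(δ : ℂ) • (T * pr K - pr W)‖
      + ‖T * (((1 - δ : ℝ) : ℂ) • pr K + (A - pr K)) * (1 - pr W)‖ := norm_add_le _ _
    _ ≤ δ * (1 - g) + 1 * (1 - δ) * 1 := by
      gcongr
      · rw [norm_smul, Complex.norm_real, Real.norm_of_nonneg hδ]; gcongr
      · refine (norm_mul_le _ _).trans ?_
        refine mul_le_mul ((norm_mul_le _ _).trans ?_) (norm_one_sub_pr_le _) (norm_nonneg _)
          (by positivity)
        exact mul_le_mul hT hB (norm_nonneg _) zero_le_one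
    _ = 1 - δ * g := by ring

/-- The mirror image of `norm_mul_sub_pr_le`. -/
lemma norm_mul_sub_pr_le' {A T : E →L[ℂ] E} {K W : Submodule ℂ E} (hWK : W ≤ K)
    (hA₁ : A * pr K = pr K) (hA₂ : pr K * A = pr K) (hT : ‖T‖ ≤ 1) (hTW : pr W * T = pr W)
    {δ g : ℝ} (hδ : 0 ≤ δ) (h1 : ‖A - pr K‖ ≤ 1 - δ) (h2 : ‖pr K * T - pr W‖ ≤ 1 - g) :
    ‖A * T - pr W‖ ≤ 1 - δ * g := by
  have := norm_mul_sub_pr_le (A := star A) (T := star T) hWK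
    (by rw [← star_pr K, ← star_mul, hA₂]) (by rw [← star_pr K, ← star_mul, hA₁])
    (by rwa [norm_star_clm]) (by rw [← star_pr W, ← star_mul, hTW]) hδ
    (by rwa [← star_pr K, ← star_sub, norm_star_clm])
    (by rwa [← star_pr K, ← star_pr W, ← star_mul, ← star_sub, norm_star_clm])
  rwa [← star_pr W, ← star_mul, ← star_sub, norm_star_clm] at this

/-- Approximate projections on independent factors can be multiplied without loss. -/
lemma norm_mul_sub_mul_le {A₁ A₂ : E →L[ℂ] E} {K₁ K₂ : Submodule ℂ E} {c : ℝ}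
    (hA₁ : ‖A₁‖ ≤ 1) (h₁₂ : Commute A₁ (pr K₂)) (hK : Commute (pr K₁) (pr K₂))
    (hA₂ : A₂ * pr K₂ = pr K₂) (hA₂' : pr K₂ * A₂ = pr K₂)
    (h1 : ‖A₁ - pr K₁‖ ≤ c) (h2 : ‖A₂ - pr K₂‖ ≤ c) :
    ‖A₁ * A₂ - pr K₁ * pr K₂‖ ≤ c := by
  have hc : 0 ≤ c := (norm_nonneg _).trans h1
  have hcomm : Commute (A₁ - pr K₁) (pr K₂) := h₁₂.sub_left hK
  have key : A₁ * A₂ - pr K₁ * pr K₂ = (A₁ - pr K₁) * pr K₂ + A₁ * (A₂ - pr K₂) := by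
    noncomm_ring
  rw [key]
  refine norm_add_le_of_block (K := K₂) hc ?_ ?_ ?_ ?_ ?_ ?_
  · rw [← mul_assoc, ← hcomm.eq, mul_assoc, pr_mul_self]
  · rw [mul_assoc, pr_mul_self]
  · rw [← mul_assoc, ← h₁₂.eq, mul_assoc, mul_sub, hA₂', pr_mul_self, sub_self, mul_zero]
  · rw [mul_assoc, sub_mul, hA₂, pr_mul_self, sub_self, mul_zero]
  · exact (norm_mul_le _ _).trans (mul_le_of_le_one_right (norm_nonneg _) (norm_pr_le _)
      |>.trans h1)
  · exact (norm_mul_le _ _).trans (mul_le_of_le_one_left (norm_nonneg _) hA₁ |>.trans h2)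

lemma pr_mul_pr_of_commute {K L : Submodule ℂ E} (h : Commute (pr K) (pr L)) :
    pr K * pr L = pr (K ⊓ L) := by
  ext x
  refine (Submodule.eq_starProjection_of_mem_of_inner_eq_zero (K := K ⊓ L) ?_ ?_).symm
  · refine ⟨Submodule.starProjection_apply_mem _ _, ?_⟩
    rw [SetLike.mem_coe, h.eq]
    exact Submodule.starProjection_apply_mem _ _
  · intro w hw
    have e : (pr K * pr L) w = w := by
      change pr K (pr L w) = w
      rw [pr_apply_eq_self_iff.2 hw.2, pr_apply_eq_self_iff.2 hw.1]
    have hs : star (pr K * pr L) = pr K * pr L := by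
      rw [star_mul, star_pr, star_pr, h.eq]
    rw [inner_sub_left]
    rw [← hs, ContinuousLinearMap.star_eq_adjoint, ContinuousLinearMap.adjoint_inner_left, e, sub_self]

lemma commute_pr_iInf {κ : Sort*} {K : κ → Submodule ℂ E} {P : E →L[ℂ] E} (hP : star P = P)
    (h : ∀ a, Commute P (pr (K a))) : Commute P (pr (⨅ a, K a)) := by
  have h1 : pr (⨅ a, K a) * P * pr (⨅ a, K a) = P * pr (⨅ a, K a) := by
    ext x
    change pr (⨅ a, K a) (P (pr (⨅ a, K a) x)) = P (pr (⨅ a, K a) x)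
    rw [pr_apply_eq_self_iff, Submodule.mem_iInf]
    intro a
    rw [← pr_apply_eq_self_iff]
    have : P (pr (K a) (pr (⨅ a, K a) x)) = pr (K a) (P (pr (⨅ a, K a) x)) :=
      DFunLike.congr_fun (h a).eq (pr (⨅ a, K a) x)
    rw [← this, pr_apply_eq_self_iff.2]
    exact (iInf_le K a) (Submodule.starProjection_apply_mem _ _)
  have h2 := congrArg star h1
  rw [star_mul, star_mul, star_mul, star_pr, hP, ← mul_assoc] at h2
  exact h1.symm.trans h2

/-- By compactness of the unit sphere, two subspaces of a finite-dimensional space form a positive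
angle outside their intersection. -/
lemma norm_pr_mul_pr_sub_lt_one (P Q : Submodule ℂ E) : ‖pr P * pr Q - pr (P ⊓ Q)‖ < 1 := by
  have : ProperSpace E := FiniteDimensional.proper ℂ E
  set W := P ⊓ Q
  have hT : pr P * pr Q - pr W = pr P * pr Q * (1 - pr W) := by
    rw [mul_sub, mul_one, mul_assoc, pr_mul_of_ge (inf_le_right : W ≤ Q),
      pr_mul_of_ge (inf_le_left : W ≤ P)]
  have hlt : ∀ x : E, ‖x‖ = 1 → ‖(pr P * pr Q - pr W) x‖ < 1 := by
    intro x hx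
    rw [hT]
    change ‖pr P (pr Q ((1 - pr W) x))‖ < 1
    set y := (1 - pr W) x with hy
    have hyx : ‖y‖ ≤ 1 := by
      have := (1 - pr W).le_of_opNorm_le (norm_one_sub_pr_le W) x
      rwa [hx, mul_one] at this
    by_contra! hcon
    have h1 := Submodule.norm_starProjection_apply_le P (pr Q y)
    have h2 := Submodule.norm_starProjection_apply_le Q y
    have hyQ : y ∈ Q := by
      rw [Submodule.mem_iff_norm_starProjection]; exact le_antisymm h2 (by linarith)
    have hyP : y ∈ P := by
      rw [pr_apply_eq_self_iff.2 hyQ] at h1 hcon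
      rw [Submodule.mem_iff_norm_starProjection]; exact le_antisymm h1 (by linarith)
    have hyW : y ∈ Wᗮ := by
      rw [hy, one_sub_pr]; exact Submodule.starProjection_apply_mem _ _
    have h0 : y = 0 := by
      have := Submodule.inner_right_of_mem_orthogonal (show y ∈ W from ⟨hyP, hyQ⟩) hyW
      exact inner_self_eq_zero.1 this
    rw [h0] at hcon
    simp at hcon
    linarith
  rcases (Metric.sphere (0 : E) 1).eq_empty_or_nonempty with h | h
  · refine lt_of_le_of_lt (ContinuousLinearMap.opNorm_le_of_unit_norm (C := 0) le_rfl ?_) one_pos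
    intro x hx
    exact absurd (show x ∈ Metric.sphere (0 : E) 1 by simpa using hx) (by simp [h])
  · obtain ⟨x, hx, hmax⟩ := (isCompact_sphere (0 : E) 1).exists_isMaxOn h
      (f := fun x => ‖(pr P * pr Q - pr W) x‖) (by fun_prop)
    refine lt_of_le_of_lt (ContinuousLinearMap.opNorm_le_of_unit_norm (norm_nonneg _) ?_)
      (hlt x (by simpa using hx))
    intro y hy
    exact hmax (show y ∈ Metric.sphere (0 : E) 1 by simpa using hy)

end Operators

end

end RandomCircuit

namespace RandomCircuit

noncomputable section

/-! ### Alternating pairs of a list -/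

section Lists

variable {ι : Type*}

/-- The pairs `(v₀, v₁), (v₂, v₃), …` of consecutive entries of a list. -/
def evenPairs : List ι → List (ι × ι)
  | x :: y :: l => (x, y) :: evenPairs l
  | _ => []

/-- The pairs `(v₁, v₂), (v₃, v₄), …` of consecutive entries of a list. -/
def oddPairs (l : List ι) : List (ι × ι) := evenPairs l.tail

lemma mem_of_mem_evenPairs {p : ι × ι} : ∀ {l : List ι}, p ∈ evenPairs l → p.1 ∈ l ∧ p.2 ∈ l
  | [], h => by simp [evenPairs] at h
  | [_], h => by simp [evenPairs] at h
  | x :: y :: l, h => by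
    rcases List.mem_cons.1 h with rfl | h
    · simp
    · have := mem_of_mem_evenPairs h
      simp [this]

lemma mem_of_mem_oddPairs {p : ι × ι} {l : List ι} (h : p ∈ oddPairs l) : p.1 ∈ l ∧ p.2 ∈ l :=
  ⟨List.mem_of_mem_tail (mem_of_mem_evenPairs h).1, List.mem_of_mem_tail (mem_of_mem_evenPairs h).2⟩

/-- Two pairs without common entries. -/
def PairDisjoint (p q : ι × ι) : Prop := p.1 ≠ q.1 ∧ p.1 ≠ q.2 ∧ p.2 ≠ q.1 ∧ p.2 ≠ q.2

lemma pairwise_evenPairs : ∀ {l : List ι}, l.Nodup → (evenPairs l).Pairwise PairDisjoint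
  | [], _ => List.Pairwise.nil
  | [_], _ => List.Pairwise.nil
  | x :: y :: l, h => by
    simp only [List.nodup_cons, List.mem_cons, not_or] at h
    refine List.Pairwise.cons (fun p hp => ?_) (pairwise_evenPairs h.2.2)
    have := mem_of_mem_evenPairs hp
    refine ⟨?_, ?_, ?_, ?_⟩ <;> rintro rfl <;> simp_all

lemma pairwise_oddPairs {l : List ι} (h : l.Nodup) : (oddPairs l).Pairwise PairDisjoint :=
  pairwise_evenPairs (h.sublist (List.tail_sublist l))

end Lists

/-! ### Restriction of equivalence relations -/

section Restriction

variable {ι : Type*}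

/-- The restriction of an equivalence relation to a set: points outside the set are isolated. -/
def restr (r : Setoid ι) (M : Set ι) : Setoid ι where
  r x y := x = y ∨ (r x y ∧ x ∈ M ∧ y ∈ M)
  iseqv :=
    { refl := fun _ => Or.inl rfl
      symm := by
        rintro x y (rfl | ⟨h, hx, hy⟩)
        · exact Or.inl rfl
        · exact Or.inr ⟨r.symm' h, hy, hx⟩
      trans := by
        rintro x y z (rfl | ⟨h, hx, hy⟩) (rfl | ⟨h', hx', hy'⟩)
        · exact Or.inl rfl
        · exact Or.inr ⟨h', hx', hy'⟩
        · exact Or.inr ⟨h, hx, hy⟩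
        · exact Or.inr ⟨r.trans' h h', hx, hy'⟩ }

lemma restr_iff {r : Setoid ι} {M : Set ι} {x y : ι} :
    restr r M x y ↔ x = y ∨ (r x y ∧ x ∈ M ∧ y ∈ M) := Iff.rfl

lemma restr_univ (r : Setoid ι) : restr r Set.univ = r := by
  ext x y
  rw [restr_iff]
  constructor
  · rintro (rfl | h)
    · exact r.refl' _
    · exact h.1
  · exact fun h => Or.inr ⟨h, trivial, trivial⟩

lemma restr_empty (r : Setoid ι) : restr r ∅ = ⊥ := by
  ext x y
  rw [restr_iff]
  simp

lemma restr_mono {r s : Setoid ι} (h : r ≤ s) (M : Set ι) : restr r M ≤ restr s M := by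
  rintro x y (rfl | ⟨h', hx, hy⟩)
  · exact Or.inl rfl
  · exact Or.inr ⟨h h', hx, hy⟩

end Restriction

/-! ### Systems of pair projections -/

section PairSystem

variable {ι E : Type*} [NormedAddCommGroup E] [InnerProductSpace ℂ E] [FiniteDimensional ℂ E]

/-- The product of the projections belonging to a list of pairs. -/
def pairProd (V : ι → ι → Submodule ℂ E) (l : List (ι × ι)) : E →L[ℂ] E :=
  (l.map fun p => pr (V p.1 p.2)).prod

/-- The vectors lying in `V i j` for all related `i`, `j`. -/
def invSpace (V : ι → ι → Submodule ℂ E) (r : Setoid ι) : Submodule ℂ E :=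
  ⨅ p : {p : ι × ι // r p.1 p.2}, V p.1.1 p.1.2

omit [FiniteDimensional ℂ E] in
lemma mem_invSpace {V : ι → ι → Submodule ℂ E} {r : Setoid ι} {w : E} :
    w ∈ invSpace V r ↔ ∀ i j, r i j → w ∈ V i j := by
  simp [invSpace, Submodule.mem_iInf]

variable (ι E) in
/-- The abstract structure behind circuits of Haar random two-qudit gates: the subspace `V i j` of
vectors invariant under the gates on the pair `{i, j}`, and a number `f` that bounds from below the
spectral gaps of all one-dimensional brickwork arrangements of the sites. -/
structure PairSystem where
  V : ι → ι → Submodule ℂ E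
  f : ℝ
  f_nonneg : 0 ≤ f
  f_le_one : f ≤ 1
  refl : ∀ i, V i i = ⊤
  symm : ∀ i j, V i j = V j i
  trans : ∀ i j k, V i j ⊓ V j k ≤ V i k
  comm : ∀ p q : ι × ι, PairDisjoint p q → Commute (pr (V p.1 p.2)) (pr (V q.1 q.2))
  brick : ∀ l : List ι, l.Nodup →
    ‖pairProd V (oddPairs l) * pairProd V (evenPairs l)
      - pr (invSpace V (restr ⊤ {x | x ∈ l}))‖ ≤ 1 - f

namespace PairSystem

variable (P : PairSystem ι E)

/-- The projection onto the invariants of all gates on related pairs. -/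
def proj (r : Setoid ι) : E →L[ℂ] E := pr (invSpace P.V r)

/-- For a vector `w`, the relation `w ∈ V i j` is an equivalence relation. -/
def relOf (w : E) : Setoid ι where
  r i j := w ∈ P.V i j
  iseqv :=
    { refl := fun i => by rw [P.refl]; trivial
      symm := fun {i j} h => by rwa [P.symm]
      trans := fun {i j k} h h' => P.trans i j k ⟨h, h'⟩ }

lemma mem_inv_iff_le {r : Setoid ι} {w : E} : w ∈ invSpace P.V r ↔ r ≤ P.relOf w := by
  rw [mem_invSpace]
  exact ⟨fun h i j hij => h i j hij, fun h i j hij => h hij⟩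

lemma inv_sup (r s : Setoid ι) : invSpace P.V (r ⊔ s) = invSpace P.V r ⊓ invSpace P.V s := by
  ext w
  simp only [Submodule.mem_inf, mem_inv_iff_le, sup_le_iff]

lemma inv_anti {r s : Setoid ι} (h : r ≤ s) : invSpace P.V s ≤ invSpace P.V r := by
  intro w
  simp only [mem_inv_iff_le]
  exact h.trans

lemma inv_bot : invSpace P.V ⊥ = ⊤ := by
  ext w
  simp [mem_inv_iff_le]

lemma proj_bot : P.proj ⊥ = 1 := by
  rw [proj, inv_bot, pr_top]

lemma proj_mul_of_le {r s : Setoid ι} (h : r ≤ s) : P.proj s * P.proj r = P.proj s :=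
  pr_mul_of_le (P.inv_anti h)

lemma proj_mul_of_ge {r s : Setoid ι} (h : r ≤ s) : P.proj r * P.proj s = P.proj s :=
  pr_mul_of_ge (P.inv_anti h)

lemma norm_proj_le (r : Setoid ι) : ‖P.proj r‖ ≤ 1 := norm_pr_le _

lemma inv_le_V {r : Setoid ι} {i j : ι} (h : r i j) : invSpace P.V r ≤ P.V i j := by
  intro w hw
  exact mem_invSpace.1 hw i j h

lemma prV_mul_proj {r : Setoid ι} {i j : ι} (h : r i j) :
    pr (P.V i j) * P.proj r = P.proj r := pr_mul_of_ge (P.inv_le_V h)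

lemma proj_mul_prV {r : Setoid ι} {i j : ι} (h : r i j) :
    P.proj r * pr (P.V i j) = P.proj r := pr_mul_of_le (P.inv_le_V h)

lemma commute_proj {r s : Setoid ι}
    (h : ∀ p q : ι × ι, r p.1 p.2 → s q.1 q.2 → Commute (pr (P.V p.1 p.2)) (pr (P.V q.1 q.2))) :
    Commute (P.proj r) (P.proj s) := by
  refine commute_pr_iInf (star_pr _) fun q => ?_
  refine (commute_pr_iInf (star_pr _) fun p => ?_).symm
  exact (h p.1 q.1 p.2 q.2).symm

lemma commute_V_of_ne {p q : ι × ι} (h : p.1 ≠ p.2 → q.1 ≠ q.2 → PairDisjoint p q) :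
    Commute (pr (P.V p.1 p.2)) (pr (P.V q.1 q.2)) := by
  by_cases hp : p.1 = p.2
  · rw [hp, P.refl, pr_top]; exact Commute.one_left _
  by_cases hq : q.1 = q.2
  · rw [hq, P.refl, pr_top]; exact Commute.one_right _
  exact P.comm p q (h hp hq)

lemma commute_restr {r s : Setoid ι} {M K : Set ι} (h : Disjoint M K) :
    Commute (P.proj (restr r M)) (P.proj (restr s K)) := by
  refine P.commute_proj fun p q hp hq => P.commute_V_of_ne fun hp' hq' => ?_
  obtain ⟨-, h1, h2⟩ := hp.resolve_left hp'
  obtain ⟨-, h3, h4⟩ := hq.resolve_left hq'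
  exact ⟨h.ne_of_mem h1 h3, h.ne_of_mem h1 h4, h.ne_of_mem h2 h3, h.ne_of_mem h2 h4⟩

lemma pairProd_mul_proj {r : Setoid ι} : ∀ {l : List (ι × ι)}, (∀ p ∈ l, r p.1 p.2) →
    pairProd P.V l * P.proj r = P.proj r
  | [], _ => one_mul _
  | p :: l, h => by
    have ih := pairProd_mul_proj (l := l) fun q hq => h q (by simp [hq])
    unfold pairProd at ih ⊢
    rw [List.map_cons, List.prod_cons, mul_assoc, ih, P.prV_mul_proj (h p (by simp))]

lemma commute_pairProd {p : ι × ι} {l : List (ι × ι)} (h : ∀ q ∈ l, PairDisjoint p q) :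
    Commute (pr (P.V p.1 p.2)) (pairProd P.V l) := by
  refine Commute.list_prod_right _ _ fun x hx => ?_
  obtain ⟨q, hq, rfl⟩ := List.mem_map.1 hx
  exact P.comm p q (h q hq)

lemma star_pairProd : ∀ {l : List (ι × ι)}, l.Pairwise PairDisjoint →
    star (pairProd P.V l) = pairProd P.V l
  | [], _ => star_one _
  | p :: l, h => by
    have ih := star_pairProd (List.pairwise_cons.1 h).2
    have hc := P.commute_pairProd (List.pairwise_cons.1 h).1
    unfold pairProd at ih hc ⊢
    rw [List.map_cons, List.prod_cons, star_mul, ih, star_pr, hc.eq]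

/-- Gates that are absorbed by the projection on the left or by that on the right can be inserted
between them. -/
lemma proj_mul_pairProd_mul_proj {r s : Setoid ι} : ∀ {l : List (ι × ι)},
    l.Pairwise PairDisjoint → (∀ p ∈ l, r p.1 p.2 ∨ s p.1 p.2) →
    P.proj r * pairProd P.V l * P.proj s = P.proj r * P.proj s
  | [], _, _ => by simp [pairProd]
  | p :: l, hl, h => by
    have ih := proj_mul_pairProd_mul_proj (List.pairwise_cons.1 hl).2
      fun q hq => h q (by simp [hq])
    have hc := P.commute_pairProd (List.pairwise_cons.1 hl).1
    have e : pairProd P.V (p :: l) = pr (P.V p.1 p.2) * pairProd P.V l := rfl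
    rcases h p (by simp) with hp | hp
    · rw [e, ← mul_assoc, P.proj_mul_prV hp, ih]
    · rw [e, hc.eq, ← mul_assoc, mul_assoc _ _ (P.proj s), P.prV_mul_proj hp, ih]

lemma brick' {l : List ι} (hl : l.Nodup) :
    ‖pairProd P.V (evenPairs l) * pairProd P.V (oddPairs l)
      - P.proj (restr ⊤ {x | x ∈ l})‖ ≤ 1 - P.f := by
  have := P.brick l hl
  rw [← norm_star_clm, star_sub, star_mul, star_pr, P.star_pairProd (pairwise_evenPairs hl),
    P.star_pairProd (pairwise_oddPairs hl)] at this
  exact this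

end PairSystem

/-- A list of sites is *good* for two equivalence relations `r₁`, `r₂` if, in one of the two ways of
reading it as a brickwork circuit, all gates of the first layer act within classes of `r₂`, and all
gates of the second layer within classes of `r₁` or of `r₂`. -/
def GoodList (r₁ r₂ : Setoid ι) (l : List ι) : Prop :=
  ((∀ p ∈ evenPairs l, r₂ p.1 p.2) ∧ ∀ p ∈ oddPairs l, r₁ p.1 p.2 ∨ r₂ p.1 p.2) ∨
  ((∀ p ∈ oddPairs l, r₂ p.1 p.2) ∧ ∀ p ∈ evenPairs l, r₁ p.1 p.2 ∨ r₂ p.1 p.2)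

namespace PairSystem

variable (P : PairSystem ι E)

lemma norm_le_of_layers {r₁ r₂ t : Setoid ι} (h₁ : r₁ ≤ t) (h₂ : r₂ ≤ t)
    {F S : List (ι × ι)} (hS : S.Pairwise PairDisjoint) (hF₂ : ∀ p ∈ F, r₂ p.1 p.2)
    (hS₂ : ∀ p ∈ S, r₁ p.1 p.2 ∨ r₂ p.1 p.2) {c : ℝ}
    (h : ‖pairProd P.V S * pairProd P.V F - P.proj t‖ ≤ c) :
    ‖P.proj r₁ * P.proj r₂ - P.proj t‖ ≤ c := by
  have key : P.proj r₁ * P.proj r₂ - P.proj t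
      = P.proj r₁ * (pairProd P.V S * pairProd P.V F - P.proj t) * P.proj r₂ := by
    rw [mul_sub, sub_mul, P.proj_mul_of_ge h₁, P.proj_mul_of_le h₂, ← mul_assoc, mul_assoc _ _
      (P.proj r₂), P.pairProd_mul_proj hF₂, P.proj_mul_pairProd_mul_proj hS hS₂]
  rw [key]
  calc _ ≤ ‖P.proj r₁‖ * ‖pairProd P.V S * pairProd P.V F - P.proj t‖ * ‖P.proj r₂‖ :=
        (norm_mul_le _ _).trans (by gcongr; exact norm_mul_le _ _)
    _ ≤ 1 * c * 1 := by
        have hc : 0 ≤ c := (norm_nonneg _).trans h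
        gcongr <;> exact P.norm_proj_le _
    _ = c := by ring

/-- The two projections of one component, when the component is traversed by a good list. -/
lemma norm_restr_le_of_goodList {r₁ r₂ : Setoid ι} {l : List ι} (hl : l.Nodup)
    (hg : GoodList r₁ r₂ l) {K : Set ι} (hK : ∀ x, x ∈ l ↔ x ∈ K) :
    ‖P.proj (restr r₁ K) * P.proj (restr r₂ K) - P.proj (restr ⊤ K)‖ ≤ 1 - P.f := by
  have e : {x | x ∈ l} = K := Set.ext hK
  rcases hg with ⟨hF, hS⟩ | ⟨hF, hS⟩
  · refine P.norm_le_of_layers (restr_mono le_top _) (restr_mono le_top _) (pairwise_oddPairs hl)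
      (F := evenPairs l) (fun p hp => ?_) (fun p hp => ?_) (by rw [← e]; exact P.brick l hl)
    · have := mem_of_mem_evenPairs hp
      exact Or.inr ⟨hF p hp, (hK _).1 this.1, (hK _).1 this.2⟩
    · have := mem_of_mem_oddPairs hp
      exact (hS p hp).imp (fun h => Or.inr ⟨h, (hK _).1 this.1, (hK _).1 this.2⟩)
        (fun h => Or.inr ⟨h, (hK _).1 this.1, (hK _).1 this.2⟩)
  · refine P.norm_le_of_layers (restr_mono le_top _) (restr_mono le_top _) (pairwise_evenPairs hl)
      (F := oddPairs l) (fun p hp => ?_) (fun p hp => ?_) (by rw [← e]; exact P.brick' hl)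
    · have := mem_of_mem_oddPairs hp
      exact Or.inr ⟨hF p hp, (hK _).1 this.1, (hK _).1 this.2⟩
    · have := mem_of_mem_evenPairs hp
      exact (hS p hp).imp (fun h => Or.inr ⟨h, (hK _).1 this.1, (hK _).1 this.2⟩)
        (fun h => Or.inr ⟨h, (hK _).1 this.1, (hK _).1 this.2⟩)

lemma proj_restr_union {r s : Setoid ι} (hrs : r ≤ s) {M K : Set ι}
    (hM : ∀ x y, s x y → x ∈ M → y ∈ M) (hK : ∀ x y, s x y → x ∈ K → y ∈ K) (hd : Disjoint M K) :
    P.proj (restr r (M ∪ K)) = P.proj (restr r M) * P.proj (restr r K) := by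
  rw [proj, proj, proj, pr_mul_pr_of_commute (P.commute_restr hd), ← P.inv_sup]
  congr 2
  apply le_antisymm
  · rintro x y (rfl | ⟨h, hx | hx, -⟩)
    · exact Setoid.refl' _ _
    · exact (le_sup_left : restr r M ≤ _) (Or.inr ⟨h, hx, hM x y (hrs h) hx⟩)
    · exact (le_sup_right : restr r K ≤ _) (Or.inr ⟨h, hx, hK x y (hrs h) hx⟩)
  · refine sup_le ?_ ?_
    · rintro x y (rfl | ⟨h, hx, hy⟩)
      · exact Setoid.refl' _ _
      · exact Or.inr ⟨h, Or.inl hx, Or.inl hy⟩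
    · rintro x y (rfl | ⟨h, hx, hy⟩)
      · exact Setoid.refl' _ _
      · exact Or.inr ⟨h, Or.inr hx, Or.inr hy⟩

/-- The spectral gap of the product of the projections belonging to two equivalence relations. -/
def gap₂ (r₁ r₂ : Setoid ι) : ℝ := 1 - ‖P.proj r₁ * P.proj r₂ - P.proj (r₁ ⊔ r₂)‖

/-- If every component of `r₁ ⊔ r₂` is traversed by a good list, then the gap of the pair is at
least the brickwork bound `f`: the components are independent, and on each of them the two
projections absorb a brickwork circuit along the list. -/
theorem le_gap₂_of_goodList [Finite ι] {r₁ r₂ : Setoid ι}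
    (h : ∀ x, ∃ l : List ι, l.Nodup ∧ GoodList r₁ r₂ l ∧ ∀ y, y ∈ l ↔ (r₁ ⊔ r₂) x y) :
    P.f ≤ P.gap₂ r₁ r₂ := by
  classical
  have := Fintype.ofFinite ι
  set s := r₁ ⊔ r₂ with hs
  have h1 : r₁ ≤ s := le_sup_left
  have h2 : r₂ ≤ s := le_sup_right
  -- The components are treated one after the other: `T` contains representatives of the
  -- components treated so far, and their union is `M`.
  have key : ∀ T : Finset ι, ‖P.proj (restr r₁ {x | ∃ t ∈ T, s t x})
      * P.proj (restr r₂ {x | ∃ t ∈ T, s t x}) - P.proj (restr s {x | ∃ t ∈ T, s t x})‖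
      ≤ 1 - P.f := by
    intro T
    induction T using Finset.induction_on with
    | empty =>
      have e : {x : ι | ∃ t ∈ (∅ : Finset ι), s t x} = ∅ := by simp
      rw [e, restr_empty, restr_empty, restr_empty, P.proj_bot]
      simpa using P.f_le_one
    | insert a T ha ih =>
      set M := {x | ∃ t ∈ T, s t x} with hM
      by_cases haM : a ∈ M
      · have e : {x | ∃ t ∈ insert a T, s t x} = M := by
          ext x
          simp only [Set.mem_ofPred_eq, Finset.mem_insert, hM]
          constructor
          · rintro ⟨t, rfl | ht, hx⟩
            · obtain ⟨t', ht', h'⟩ := haM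
              exact ⟨t', ht', s.trans' h' hx⟩
            · exact ⟨t, ht, hx⟩
          · rintro ⟨t, ht, hx⟩
            exact ⟨t, Or.inr ht, hx⟩
        rw [e]; exact ih
      -- The component `K` of `a` is disjoint from `M`, so the projections on `K` commute with those
      -- on `M`, and the error is the maximum of the two errors.
      set K := {x | s a x} with hK
      have e : {x | ∃ t ∈ insert a T, s t x} = M ∪ K := by
        ext x
        simp only [Set.mem_ofPred_eq, Finset.mem_insert, hM, hK, Set.mem_union]
        constructor
        · rintro ⟨t, rfl | ht, hx⟩
          · exact Or.inr hx
          · exact Or.inl ⟨t, ht, hx⟩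
        · rintro (⟨t, ht, hx⟩ | hx)
          · exact ⟨t, Or.inr ht, hx⟩
          · exact ⟨a, Or.inl rfl, hx⟩
      have hMs : ∀ x y, s x y → x ∈ M → y ∈ M := by
        rintro x y hxy ⟨t, ht, hx⟩
        exact ⟨t, ht, s.trans' hx hxy⟩
      have hKs : ∀ x y, s x y → x ∈ K → y ∈ K := fun x y hxy hx => s.trans' hx hxy
      have hd : Disjoint M K := by
        rw [Set.disjoint_left]
        rintro x ⟨t, ht, hx⟩ hx'
        exact haM ⟨t, ht, s.trans' hx (s.symm' hx')⟩
      obtain ⟨l, hl, hg, hlK⟩ := h a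
      have hone := P.norm_restr_le_of_goodList hl hg (K := K) hlK
      have eK : restr s K = restr ⊤ K := by
        apply le_antisymm (restr_mono le_top _)
        rintro x y (rfl | ⟨-, hx, hy⟩)
        · exact Or.inl rfl
        · exact Or.inr ⟨s.trans' (s.symm' hx) hy, hx, hy⟩
      rw [← eK] at hone
      rw [e, P.proj_restr_union h1 hMs hKs hd, P.proj_restr_union h2 hMs hKs hd,
        P.proj_restr_union le_rfl hMs hKs hd]
      have hswap : P.proj (restr r₁ M) * P.proj (restr r₁ K)
          * (P.proj (restr r₂ M) * P.proj (restr r₂ K))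
          = (P.proj (restr r₁ M) * P.proj (restr r₂ M))
          * (P.proj (restr r₁ K) * P.proj (restr r₂ K)) := by
        have := (P.commute_restr (r := r₂) (s := r₁) hd).eq
        simp only [mul_assoc]
        congr 1
        rw [← mul_assoc, ← this, mul_assoc]
      rw [hswap]
      refine norm_mul_sub_mul_le ?_ ?_ (P.commute_restr hd) ?_ ?_ ih hone
      · exact (norm_mul_le _ _).trans (mul_le_one₀ (P.norm_proj_le _) (norm_nonneg _)
          (P.norm_proj_le _))
      · exact Commute.mul_left (P.commute_restr hd) (P.commute_restr hd)
      · exact (mul_assoc _ _ _).trans (by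
          rw [show pr (invSpace P.V (restr s K)) = P.proj (restr s K) from rfl,
            P.proj_mul_of_ge (restr_mono h2 K), P.proj_mul_of_ge (restr_mono h1 K)])
      · rw [← mul_assoc, show pr (invSpace P.V (restr s K)) = P.proj (restr s K) from rfl,
            P.proj_mul_of_le (restr_mono h1 K), P.proj_mul_of_le (restr_mono h2 K)]
  have huniv := key Finset.univ
  have e : {x | ∃ t ∈ (Finset.univ : Finset ι), s t x} = Set.univ := by
    ext x
    simpa using ⟨x, s.refl' x⟩
  rw [e, restr_univ, restr_univ, restr_univ] at huniv
  rw [gap₂]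
  linarith

lemma gap₂_symm (r₁ r₂ : Setoid ι) : P.gap₂ r₁ r₂ = P.gap₂ r₂ r₁ := by
  rw [gap₂, gap₂, ← norm_star_clm, star_sub, star_mul, sup_comm]
  simp only [proj, star_pr]

lemma gap₂_nonneg (r₁ r₂ : Setoid ι) : 0 ≤ P.gap₂ r₁ r₂ := by
  have h : P.proj r₁ * P.proj r₂ - P.proj (r₁ ⊔ r₂)
      = P.proj r₁ * P.proj r₂ * (1 - P.proj (r₁ ⊔ r₂)) := by
    rw [mul_sub, mul_one, mul_assoc, P.proj_mul_of_ge le_sup_right, P.proj_mul_of_ge le_sup_left]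
  rw [gap₂, h, sub_nonneg]
  refine (norm_mul_le _ _).trans (mul_le_one₀ ((norm_mul_le _ _).trans (mul_le_one₀
    (P.norm_proj_le _) (norm_nonneg _) (P.norm_proj_le _))) (norm_nonneg _)
    (norm_one_sub_pr_le _))

lemma gap₂_of_le {r₁ r₂ : Setoid ι} (h : r₁ ≤ r₂) : P.gap₂ r₁ r₂ = 1 := by
  rw [gap₂, P.proj_mul_of_ge h, sup_eq_right.2 h, sub_self, norm_zero, sub_zero]

/-- Refining both relations without changing their join decreases the gap. -/
lemma gap₂_mono {r₁ r₂ s₁ s₂ : Setoid ι} (h₁ : s₁ ≤ r₁) (h₂ : s₂ ≤ r₂)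
    (h : r₁ ⊔ r₂ ≤ s₁ ⊔ s₂) : P.gap₂ s₁ s₂ ≤ P.gap₂ r₁ r₂ := by
  have e : s₁ ⊔ s₂ = r₁ ⊔ r₂ := le_antisymm (sup_le_sup h₁ h₂) h
  have key : P.proj r₁ * P.proj r₂ - P.proj (r₁ ⊔ r₂)
      = P.proj r₁ * (P.proj s₁ * P.proj s₂ - P.proj (s₁ ⊔ s₂)) * P.proj r₂ := by
    rw [e, mul_sub, sub_mul, P.proj_mul_of_ge le_sup_left, P.proj_mul_of_le le_sup_right,
      ← mul_assoc, P.proj_mul_of_le h₁, mul_assoc, P.proj_mul_of_ge h₂]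
  rw [gap₂, gap₂, key]
  have := (norm_mul_le (P.proj r₁ * (P.proj s₁ * P.proj s₂ - P.proj (s₁ ⊔ s₂))) (P.proj r₂)).trans
    (mul_le_mul (norm_mul_le _ _) (P.norm_proj_le r₂) (norm_nonneg _) (by positivity))
  have h3 := mul_le_of_le_one_left (norm_nonneg (P.proj s₁ * P.proj s₂ - P.proj (s₁ ⊔ s₂)))
    (P.norm_proj_le r₁)
  linarith

/-- A relation can be merged into `r` in two steps, at the cost of multiplying the gaps. -/
lemma mul_gap₂_le (s t r : Setoid ι) :
    P.gap₂ s r * P.gap₂ t (r ⊔ s) ≤ P.gap₂ (s ⊔ t) r := by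
  have h := norm_mul_sub_pr_le (A := P.proj s * P.proj r) (T := P.proj t)
    (K := invSpace P.V (r ⊔ s)) (W := invSpace P.V (t ⊔ (r ⊔ s))) (P.inv_anti le_sup_right)
    (by
      change P.proj s * P.proj r * P.proj (r ⊔ s) = P.proj (r ⊔ s)
      rw [mul_assoc, P.proj_mul_of_ge le_sup_left, P.proj_mul_of_ge le_sup_right])
    (by
      change P.proj (r ⊔ s) * (P.proj s * P.proj r) = P.proj (r ⊔ s)
      rw [← mul_assoc, P.proj_mul_of_le le_sup_right, P.proj_mul_of_le le_sup_left])
    (P.norm_proj_le t)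
    (by
      change P.proj t * P.proj (t ⊔ (r ⊔ s)) = P.proj (t ⊔ (r ⊔ s))
      exact P.proj_mul_of_ge le_sup_left)
    (P.gap₂_nonneg s r) (g := P.gap₂ t (r ⊔ s))
    (by rw [gap₂, sub_sub_cancel, sup_comm r s]; exact le_rfl)
    (by rw [gap₂, sub_sub_cancel]; exact le_rfl)
  have key : P.proj (s ⊔ t) * P.proj r - P.proj (s ⊔ t ⊔ r)
      = P.proj (s ⊔ t) * (P.proj t * (P.proj s * P.proj r) - P.proj (t ⊔ (r ⊔ s))) := by
    have e : t ⊔ (r ⊔ s) = s ⊔ t ⊔ r := by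
      rw [← sup_assoc, sup_comm (t ⊔ r) s, sup_assoc]
    rw [e, mul_sub, P.proj_mul_of_ge (le_sup_left : s ⊔ t ≤ s ⊔ t ⊔ r), ← mul_assoc, ← mul_assoc,
      P.proj_mul_of_le le_sup_right, P.proj_mul_of_le le_sup_left]
  have h2 : ‖P.proj (s ⊔ t) * P.proj r - P.proj (s ⊔ t ⊔ r)‖
      ≤ ‖P.proj t * (P.proj s * P.proj r) - P.proj (t ⊔ (r ⊔ s))‖ := by
    rw [key]
    exact (norm_mul_le _ _).trans (mul_le_of_le_one_left (norm_nonneg _) (P.norm_proj_le _))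
  rw [show P.gap₂ (s ⊔ t) r = 1 - ‖P.proj (s ⊔ t) * P.proj r - P.proj (s ⊔ t ⊔ r)‖ from rfl]
  have h3 : ‖P.proj t * (P.proj s * P.proj r) - P.proj (t ⊔ (r ⊔ s))‖
    ≤ 1 - P.gap₂ s r * P.gap₂ t (r ⊔ s) := h
  linarith

end PairSystem

end PairSystem

end

end RandomCircuit

namespace RandomCircuit

noncomputable section

/-! ### Building good lists from segments -/

section Segments

variable {ι : Type*} {r₁ r₂ : Setoid ι}

/-- A good list whose first gate belongs to the first layer. -/
def FGood (r₁ r₂ : Setoid ι) (l : List ι) : Prop :=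
  (∀ p ∈ evenPairs l, r₂ p.1 p.2) ∧ ∀ p ∈ oddPairs l, r₁ p.1 p.2 ∨ r₂ p.1 p.2

/-- A good list whose first gate belongs to the second layer. -/
def SGood (r₁ r₂ : Setoid ι) (l : List ι) : Prop :=
  (∀ p ∈ oddPairs l, r₂ p.1 p.2) ∧ ∀ p ∈ evenPairs l, r₁ p.1 p.2 ∨ r₂ p.1 p.2

lemma FGood.goodList {l : List ι} (h : FGood r₁ r₂ l) : GoodList r₁ r₂ l := Or.inl h

lemma SGood.goodList {l : List ι} (h : SGood r₁ r₂ l) : GoodList r₁ r₂ l := Or.inr h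

lemma fGood_cons {x y : ι} {l : List ι} (hxy : r₂ x y) (h : SGood r₁ r₂ (y :: l)) :
    FGood r₁ r₂ (x :: y :: l) := by
  refine ⟨fun p hp => ?_, fun p hp => h.2 p hp⟩
  rcases List.mem_cons.1 hp with rfl | hp
  · exact hxy
  · exact h.1 p hp

lemma sGood_cons {x y : ι} {l : List ι} (hxy : r₁ x y ∨ r₂ x y) (h : FGood r₁ r₂ (y :: l)) :
    SGood r₁ r₂ (x :: y :: l) := by
  refine ⟨fun p hp => h.1 p hp, fun p hp => ?_⟩
  rcases List.mem_cons.1 hp with rfl | hp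
  · exact hxy
  · exact h.2 p hp

lemma fGood_of_forall {l : List ι} (h : ∀ x ∈ l, ∀ y ∈ l, r₂ x y) : FGood r₁ r₂ l :=
  ⟨fun _ hp => h _ (mem_of_mem_evenPairs hp).1 _ (mem_of_mem_evenPairs hp).2,
    fun _ hp => Or.inr (h _ (mem_of_mem_oddPairs hp).1 _ (mem_of_mem_oddPairs hp).2)⟩

/-- Prepending a segment that stays within one class of `r₂` and is linked to the rest of the list
by a gate of `r₁`. -/
lemma append_good {T : List ι} (hT : FGood r₁ r₂ T) : ∀ {A : List ι},
    (∀ x ∈ A, ∀ y ∈ A, r₂ x y) →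
    (∀ u ∈ A.getLast?, ∀ v ∈ T.head?, r₁ u v) →
    (Even A.length → FGood r₁ r₂ (A ++ T)) ∧ (¬ Even A.length → SGood r₁ r₂ (A ++ T))
  | [], _, _ => ⟨fun _ => hT, fun h => absurd Even.zero h⟩
  | [x], _, hl => by
    refine ⟨fun h => by simp at h, fun _ => ?_⟩
    cases T with
    | nil => exact ⟨by simp [oddPairs, evenPairs], by simp [evenPairs]⟩
    | cons v T => exact sGood_cons (Or.inl (hl x (by simp) v (by simp))) hT
  | x :: y :: A, hA, hl => by
    obtain ⟨h1, h2⟩ := append_good hT (A := y :: A) (fun a ha b hb => hA a (by simp [ha]) b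
      (by simp [hb])) (fun u hu => hl u (by simpa using hu))
    have hxy : r₂ x y := hA x (by simp) y (by simp)
    have e : Even (x :: y :: A).length ↔ ¬ Even (y :: A).length := by
      rw [List.length_cons, Nat.even_add_one]
    rw [e, not_not]
    exact ⟨fun h => fGood_cons hxy (h2 h), fun h => sGood_cons (Or.inr hxy) (h1 h)⟩

variable [Finite ι]

lemma exists_list_start {K : Set ι} {v : ι} (hv : v ∈ K) :
    ∃ l : List ι, l.Nodup ∧ (∀ y, y ∈ l ↔ y ∈ K) ∧ l.head? = some v ∧ l.length = K.ncard := by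
  classical
  have := Fintype.ofFinite ι
  refine ⟨v :: (K.toFinset.erase v).toList, ?_, fun y => ?_, rfl, ?_⟩
  · simp [Finset.nodup_toList]
  · simp only [List.mem_cons, Finset.mem_toList, Finset.mem_erase, Set.mem_toFinset]
    constructor
    · rintro (rfl | h)
      · exact hv
      · exact h.2
    · intro h
      by_cases e : y = v
      · exact Or.inl e
      · exact Or.inr ⟨e, h⟩
  · rw [List.length_cons, Finset.length_toList, Finset.card_erase_add_one (by simpa using hv),
      Set.ncard_eq_toFinset_card']

lemma exists_list_end {K : Set ι} {u : ι} (hu : u ∈ K) :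
    ∃ l : List ι, l.Nodup ∧ (∀ y, y ∈ l ↔ y ∈ K) ∧ l.getLast? = some u := by
  obtain ⟨l, h1, h2, h3, -⟩ := exists_list_start hu
  exact ⟨l.reverse, by simpa using h1, by simpa using h2, by simpa using h3⟩

lemma exists_list_ends {K : Set ι} {v u : ι} (hv : v ∈ K) (hu : u ∈ K) (huv : v ≠ u) :
    ∃ l : List ι, l.Nodup ∧ (∀ y, y ∈ l ↔ y ∈ K) ∧ l.head? = some v ∧ l.getLast? = some u ∧
      l.length = K.ncard := by
  obtain ⟨l, h1, h2, h3, h4⟩ := exists_list_start (K := K \ {u}) (v := v) ⟨hv, huv⟩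
  refine ⟨l ++ [u], ?_, fun y => ?_, ?_, by simp, ?_⟩
  · rw [List.nodup_append]
    refine ⟨h1, by simp, ?_⟩
    intro a ha b hb
    rw [List.mem_singleton.1 hb]
    exact ((h2 a).1 ha).2
  · rw [List.mem_append, h2, List.mem_singleton]
    constructor
    · rintro (h | rfl)
      · exact h.1
      · exact hu
    · intro h
      by_cases e : y = u
      · exact Or.inr e
      · exact Or.inl ⟨h, e⟩
  · rw [List.head?_append, h3]; rfl
  · rw [List.length_append, h4, List.length_singleton]
    exact Set.ncard_sdiff_singleton_add_one hu

end Segments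

/-! ### Relations generated by links -/

section Links

variable {ι : Type*}

/-- The equivalence relation generated by the links `b ∼ a b` for `b ∈ U`. -/
def link (a : ι → ι) (U : Set ι) : Setoid ι :=
  Relation.EqvGen.setoid fun x y => x ∈ U ∧ y = a x

lemma link_le_iff {a : ι → ι} {U : Set ι} {s : Setoid ι} :
    link a U ≤ s ↔ ∀ b ∈ U, s b (a b) := by
  constructor
  · intro h b hb
    exact h (Relation.EqvGen.rel _ _ ⟨hb, rfl⟩)
  · intro h x y hxy
    induction hxy with
    | rel x y h' => obtain ⟨hx, rfl⟩ := h'; exact h x hx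
    | refl x => exact s.refl' x
    | symm x y _ ih => exact s.symm' ih
    | trans x y z _ _ ih₁ ih₂ => exact s.trans' ih₁ ih₂

lemma link_rel {a : ι → ι} {U : Set ι} {b : ι} (hb : b ∈ U) : link a U b (a b) :=
  link_le_iff.1 le_rfl b hb

lemma link_union (a : ι → ι) (U W : Set ι) : link a (U ∪ W) = link a U ⊔ link a W := by
  apply le_antisymm
  · rw [link_le_iff]
    rintro b (hb | hb)
    · exact (le_sup_left : link a U ≤ _) (link_rel hb)
    · exact (le_sup_right : link a W ≤ _) (link_rel hb)
  · refine sup_le ?_ ?_ <;> rw [link_le_iff] <;> intro b hb <;> exact link_rel (by simp [hb])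

lemma link_mono (a : ι → ι) {U W : Set ι} (h : U ⊆ W) : link a U ≤ link a W := by
  rw [link_le_iff]; exact fun b hb => link_rel (h hb)

/-- The equivalence relation with the classes `M` and its complement: `s ≤ memSetoid M` says that `M`
is a union of classes of `s`. -/
def memSetoid (M : Set ι) : Setoid ι := Setoid.comap (fun x => x ∈ M) ⊥

lemma memSetoid_iff {M : Set ι} {x y : ι} : memSetoid M x y ↔ (x ∈ M ↔ y ∈ M) := by
  change ((x ∈ M) = (y ∈ M)) ↔ _
  exact eq_iff_iff

/-- If every class contains at most one source of a link, then two points whose classes contain no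
source of a link are related by the links only if they are related already: following the links
upwards from two related points leads to the same class. -/
lemma rel_of_link_sup_rel {r : Setoid ι} {a : ι → ι} {U : Set ι}
    (hup : ∀ b ∈ U, ∀ b' ∈ U, r b b' → b = b') {x y : ι} (hx : ∀ b ∈ U, ¬ r b x)
    (hy : ∀ b ∈ U, ¬ r b y) (h : (r ⊔ link a U) x y) : r x y := by
  classical
  -- `h'` maps a class to the class at the end of the link that starts there, if there is one.
  let h' : Quotient r → Quotient r := fun q =>
    if hq : ∃ b ∈ U, (⟦b⟧ : Quotient r) = q then ⟦a hq.choose⟧ else q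
  have hlink : ∀ b ∈ U, h' ⟦b⟧ = ⟦a b⟧ := by
    intro b hb
    have hq : ∃ b' ∈ U, (⟦b'⟧ : Quotient r) = ⟦b⟧ := ⟨b, hb, rfl⟩
    have e : hq.choose = b := hup _ hq.choose_spec.1 _ hb (Quotient.exact hq.choose_spec.2)
    simp only [h']
    rw [dif_pos hq, e]
  have hfix : ∀ z, (∀ b ∈ U, ¬ r b z) → h' ⟦z⟧ = ⟦z⟧ := by
    intro z hz
    simp only [h']
    rw [dif_neg]
    rintro ⟨b, hb, e⟩
    exact hz b hb (Quotient.exact e)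
  -- Related by `t`: the upward paths of the two classes meet.
  let t : Setoid ι :=
    { r := fun x y => ∃ m n : ℕ, h'^[m] ⟦x⟧ = h'^[n] ⟦y⟧
      iseqv :=
        { refl := fun x => ⟨0, 0, rfl⟩
          symm := fun ⟨m, n, e⟩ => ⟨n, m, e.symm⟩
          trans := by
            rintro x y z ⟨m, n, e⟩ ⟨m', n', e'⟩
            refine ⟨m' + m, n + n', ?_⟩
            rw [Function.iterate_add_apply, e, ← Function.iterate_add_apply, add_comm m' n,
              Function.iterate_add_apply, e', ← Function.iterate_add_apply] } }
  have hle : r ⊔ link a U ≤ t := by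
    refine sup_le ?_ ?_
    · intro x y hxy
      refine ⟨0, 0, ?_⟩
      exact Quotient.sound hxy
    · rw [link_le_iff]
      exact fun b hb => ⟨1, 0, hlink b hb⟩
  obtain ⟨m, n, e⟩ := hle h
  rw [Function.iterate_fixed (hfix x hx), Function.iterate_fixed (hfix y hy)] at e
  exact Quotient.exact e

end Links

/-! ### Chains of clusters -/

section Chains

variable {ι : Type*} [Finite ι] {r : Setoid ι} {a : ι → ι} {U : Set ι} {dep : ι → ℕ}

/-- The data of a family of disjoint chains of clusters (classes of `r`): every cluster contains at
most one source `b` and at most one target `a b` of a link, links lead to smaller depth, and the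
clusters in the interior of a chain have an even number of sites. -/
structure IsChainSystem (r : Setoid ι) (a : ι → ι) (U : Set ι) (dep : ι → ℕ) : Prop where
  dep_eq : ∀ {x y}, r x y → dep x = dep y
  dep_lt : ∀ b ∈ U, dep (a b) < dep b
  up : ∀ b ∈ U, ∀ b' ∈ U, r b b' → b = b'
  down : ∀ b ∈ U, ∀ b' ∈ U, r (a b) (a b') → b = b'
  ne : ∀ b ∈ U, ∀ b' ∈ U, r b (a b') → b ≠ a b'
  even : ∀ b ∈ U, ∀ b' ∈ U, r b (a b') → Even {x | r b x}.ncard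

/-- The part of a chain that begins at the source of a link. -/
lemma IsChainSystem.exists_tail (h : IsChainSystem r a U dep) : ∀ (n : ℕ) (v : ι), v ∈ U →
    (∀ x, dep x < dep v + n) →
    ∃ T : List ι, T.Nodup ∧ T.head? = some v ∧ FGood (link a U) r T ∧ (∀ y ∈ T, dep v ≤ dep y) ∧
      (∀ y ∈ T, ∀ z, r y z → z ∈ T) ∧ (∀ b ∈ U, a b ∈ T → b ∈ T) ∧
      (∀ b ∈ U, b ∈ T → b = v ∨ a b ∈ T) ∧ ∀ y ∈ T, (link a U ⊔ r) v y := by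
  intro n
  induction n with
  | zero => intro v _ hn; exact absurd (hn v) (by simp)
  | succ n ih =>
    intro v hv hn
    -- If a link `b → a b` ends in the cluster of `v`, this cluster is listed from `v` to `a b`, and
    -- followed by the part of the chain that begins at `b`.
    by_cases hb : ∃ b ∈ U, r v (a b)
    · obtain ⟨b, hbU, hvb⟩ := hb
      have hdep := h.dep_lt b hbU
      have hdv := h.dep_eq hvb
      obtain ⟨T, hT1, hT2, hT3, hT4, hT5, hT6, hT7, hT8⟩ := ih b hbU fun x => by
        have := hn x; omega
      obtain ⟨A, hA1, hA2, hA3, hA4, hA5⟩ := exists_list_ends (K := {x | r v x})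
        (r.refl' v) hvb (h.ne v hv b hbU hvb)
      have hgood := (append_good hT3 (A := A)
        (fun x hx y hy => r.trans' (r.symm' ((hA2 x).1 hx)) ((hA2 y).1 hy))
        (fun u hu w hw => by
          rw [hA4, Option.mem_some_iff] at hu
          rw [hT2, Option.mem_some_iff] at hw
          subst hu hw
          exact Setoid.symm' _ (link_rel hbU))).1 (by rw [hA5]; exact h.even v hv b hbU hvb)
      have hAT : ∀ x ∈ A, x ∉ T := by
        intro x hx hx'
        have := hT4 x hx'
        have := h.dep_eq ((hA2 x).1 hx)
        omega
      have hvs : (link a U ⊔ r) v b :=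
        Setoid.trans' _ ((le_sup_right : r ≤ _) hvb)
          (Setoid.symm' _ ((le_sup_left : link a U ≤ _) (link_rel hbU)))
      refine ⟨A ++ T, ?_, ?_, hgood, ?_, ?_, ?_, ?_, ?_⟩
      · rw [List.nodup_append]
        exact ⟨hA1, hT1, fun x hx y hy e => hAT x hx (e ▸ hy)⟩
      · rw [List.head?_append, hA3]; rfl
      · intro y hy
        rcases List.mem_append.1 hy with hy | hy
        · exact (h.dep_eq ((hA2 y).1 hy)).le
        · have := hT4 y hy; omega
      · intro y hy z hz
        rcases List.mem_append.1 hy with hy | hy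
        · exact List.mem_append_left _ ((hA2 z).2 (r.trans' ((hA2 y).1 hy) hz))
        · exact List.mem_append_right _ (hT5 y hy z hz)
      · intro b' hb' hab'
        rcases List.mem_append.1 hab' with hy | hy
        · rw [← h.down b hbU b' hb' (r.trans' (r.symm' hvb) ((hA2 _).1 hy))]
          exact List.mem_append_right _ (List.mem_of_mem_head? hT2)
        · exact List.mem_append_right _ (hT6 b' hb' hy)
      · intro b' hb' hb'T
        rcases List.mem_append.1 hb'T with hy | hy
        · exact Or.inl (h.up v hv b' hb' ((hA2 _).1 hy)).symm
        · rcases hT7 b' hb' hy with rfl | h'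
          · exact Or.inr (List.mem_append_left _ ((hA2 _).2 hvb))
          · exact Or.inr (List.mem_append_right _ h')
      · intro y hy
        rcases List.mem_append.1 hy with hy | hy
        · exact (le_sup_right : r ≤ _) ((hA2 y).1 hy)
        · exact Setoid.trans' _ hvs (hT8 y hy)
    · push Not at hb
      obtain ⟨A, hA1, hA2, hA3, -⟩ := exists_list_start (K := {x | r v x}) (r.refl' v)
      refine ⟨A, hA1, hA3, fGood_of_forall fun x hx y hy =>
        r.trans' (r.symm' ((hA2 x).1 hx)) ((hA2 y).1 hy), ?_, ?_, ?_, ?_, ?_⟩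
      · exact fun y hy => (h.dep_eq ((hA2 y).1 hy)).le
      · exact fun y hy z hz => (hA2 z).2 (r.trans' ((hA2 y).1 hy) hz)
      · exact fun b hb' hab => absurd ((hA2 _).1 hab) (hb b hb')
      · exact fun b hb' hbA => Or.inl (h.up v hv b hb' ((hA2 _).1 hbA)).symm
      · exact fun y hy => (le_sup_right : r ≤ _) ((hA2 y).1 hy)

omit [Finite ι] in
lemma mem_iff_of_saturated {s t : Setoid ι} {l : List ι} {z x : ι} (hz : z ∈ l)
    (hs : s ≤ memSetoid {y | y ∈ l}) (ht : t ≤ memSetoid {y | y ∈ l})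
    (hl : ∀ y ∈ l, (s ⊔ t) z y) (hxz : (s ⊔ t) x z) (y : ι) : y ∈ l ↔ (s ⊔ t) x y := by
  constructor
  · exact fun hy => Setoid.trans' _ hxz (hl y hy)
  · intro hy
    exact (memSetoid_iff.1 ((sup_le hs ht) (Setoid.trans' _ (Setoid.symm' _ hxz) hy))).1 hz

lemma IsChainSystem.exists_goodList (h : IsChainSystem r a U dep) (x : ι) :
    ∃ l : List ι, l.Nodup ∧ GoodList (link a U) r l ∧ ∀ y, y ∈ l ↔ (link a U ⊔ r) x y := by
  classical
  obtain ⟨N, hN⟩ : ∃ N, ∀ x, dep x < N := by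
    obtain ⟨N, hN⟩ := (Set.finite_range dep).bddAbove
    exact ⟨N + 1, fun x => Nat.lt_succ_of_le (hN ⟨x, rfl⟩)⟩
  -- A site of minimal depth lies in the cluster at the end of the chain through `x`.
  obtain ⟨z, hz, hzmin⟩ := Set.exists_min_image {y | (link a U ⊔ r) x y} dep (Set.toFinite _)
    ⟨x, show (link a U ⊔ r) x x from Setoid.refl' _ x⟩
  change (link a U ⊔ r) x z at hz
  have hzU : ∀ b ∈ U, ¬ r z b := by
    intro b hb hzb
    have h1 := h.dep_lt b hb
    have h2 := h.dep_eq hzb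
    have h3 := hzmin (a b) (show (link a U ⊔ r) x (a b) from Setoid.trans' _ hz
      (Setoid.trans' _ ((le_sup_right : r ≤ _) hzb)
        ((le_sup_left : link a U ≤ _) (link_rel hb))))
    omega
  by_cases hb : ∃ b ∈ U, r z (a b)
  · obtain ⟨b, hbU, hzb⟩ := hb
    have hdep := h.dep_lt b hbU
    have hdz := h.dep_eq hzb
    obtain ⟨T, hT1, hT2, hT3, hT4, hT5, hT6, hT7, hT8⟩ := h.exists_tail N b hbU fun x => by
      have := hN x; omega
    obtain ⟨A, hA1, hA2, hA4⟩ := exists_list_end (K := {x | r z x}) hzb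
    have hgood := append_good hT3 (A := A)
      (fun x hx y hy => r.trans' (r.symm' ((hA2 x).1 hx)) ((hA2 y).1 hy))
      (fun u hu w hw => by
        rw [hA4, Option.mem_some_iff] at hu
        rw [hT2, Option.mem_some_iff] at hw
        subst hu hw
        exact Setoid.symm' _ (link_rel hbU))
    have hAT : ∀ x ∈ A, x ∉ T := by
      intro x hx hx'
      have := hT4 x hx'
      have := h.dep_eq ((hA2 x).1 hx)
      omega
    have hbT : b ∈ T := List.mem_of_mem_head? hT2
    have hzs : (link a U ⊔ r) z b :=
      Setoid.trans' _ ((le_sup_right : r ≤ _) hzb)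
        (Setoid.symm' _ ((le_sup_left : link a U ≤ _) (link_rel hbU)))
    refine ⟨A ++ T, ?_, ?_, mem_iff_of_saturated (z := z) (List.mem_append_left _
      ((hA2 z).2 (r.refl' z))) ?_ ?_ ?_ hz⟩
    · rw [List.nodup_append]
      exact ⟨hA1, hT1, fun x hx y hy e => hAT x hx (e ▸ hy)⟩
    · by_cases he : Even A.length
      · exact (hgood.1 he).goodList
      · exact (hgood.2 he).goodList
    · rw [link_le_iff]
      intro b' hb'
      rw [memSetoid_iff]
      simp only [Set.mem_ofPred_eq, List.mem_append]
      constructor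
      · rintro (hA | hT)
        · exact absurd ((hA2 _).1 hA) (hzU b' hb')
        · rcases hT7 b' hb' hT with rfl | h'
          · exact Or.inl ((hA2 _).2 hzb)
          · exact Or.inr h'
      · rintro (hA | hT)
        · rw [← h.down b hbU b' hb' (r.trans' (r.symm' hzb) ((hA2 _).1 hA))]
          exact Or.inr hbT
        · exact Or.inr (hT6 b' hb' hT)
    · intro y y' hyy'
      rw [memSetoid_iff]
      have : ∀ y y', r y y' → y ∈ A ++ T → y' ∈ A ++ T := by
        intro y y' hyy' hy
        rcases List.mem_append.1 hy with hy | hy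
        · exact List.mem_append_left _ ((hA2 _).2 (r.trans' ((hA2 _).1 hy) hyy'))
        · exact List.mem_append_right _ (hT5 y hy y' hyy')
      exact ⟨this y y' hyy', this y' y (r.symm' hyy')⟩
    · intro y hy
      rcases List.mem_append.1 hy with hy | hy
      · exact (le_sup_right : r ≤ _) ((hA2 y).1 hy)
      · exact Setoid.trans' _ hzs (hT8 y hy)
  · push Not at hb
    obtain ⟨A, hA1, hA2, -⟩ := exists_list_end (K := {x | r z x}) (r.refl' z)
    refine ⟨A, hA1, (fGood_of_forall fun x hx y hy =>
        r.trans' (r.symm' ((hA2 x).1 hx)) ((hA2 y).1 hy)).goodList,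
        mem_iff_of_saturated (z := z) ((hA2 z).2 (r.refl' z)) ?_ ?_ ?_ hz⟩
    · rw [link_le_iff]
      intro b' hb'
      rw [memSetoid_iff]
      simp only [Set.mem_ofPred_eq]
      exact ⟨fun h' => absurd ((hA2 _).1 h') (hzU b' hb'),
        fun h' => absurd ((hA2 _).1 h') (hb b' hb')⟩
    · intro y y' hyy'
      rw [memSetoid_iff]
      exact ⟨fun hy => (hA2 _).2 (r.trans' ((hA2 _).1 hy) hyy'),
        fun hy => (hA2 _).2 (r.trans' ((hA2 _).1 hy) (r.symm' hyy'))⟩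
    · exact fun y hy => (le_sup_right : r ≤ _) ((hA2 y).1 hy)

/-- A *hub*: a class of `r₁` that meets every class of `r₂` in its component, all of which, up to
one exception, have an even number of sites and share at least two sites with the hub. Such a
component is traversed by a good list, which visits the classes of `r₂` one after the other. -/
lemma exists_goodList_of_hub {r₁ r₂ : Setoid ι} {z e : ι} (he : r₁ z e)
    (h : ∀ v, r₁ z v → r₂ v e ∨
      (Even {x | r₂ v x}.ncard ∧ ∃ v', r₁ z v' ∧ v ≠ v' ∧ r₂ v v')) :
    ∃ l : List ι, l.Nodup ∧ GoodList r₁ r₂ l ∧ ∀ y, y ∈ l ↔ ∃ v, r₁ z v ∧ r₂ v y := by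
  classical
  have := Fintype.ofFinite ι
  -- The list begins with the exceptional class at its right end, and is extended to the left by the
  -- classes of the sites `v ∈ T` of the hub, each of them traversed between two sites of the hub.
  have key : ∀ T : Finset ι, (∀ v ∈ T, r₁ z v) → ∃ l : List ι, l.Nodup ∧ FGood r₁ r₂ l ∧
      (∀ v ∈ l.head?, r₁ z v) ∧ ∀ y, y ∈ l ↔ r₂ e y ∨ ∃ v ∈ T, r₂ v y := by
    intro T
    induction T using Finset.induction_on with
    | empty =>
      intro _
      obtain ⟨A, hA1, hA2, hA3, -⟩ := exists_list_start (K := {x | r₂ e x}) (r₂.refl' e)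
      refine ⟨A, hA1, fGood_of_forall fun x hx y hy =>
        r₂.trans' (r₂.symm' ((hA2 x).1 hx)) ((hA2 y).1 hy), ?_, by simpa using hA2⟩
      intro v hv
      rw [hA3, Option.mem_some_iff] at hv
      rwa [← hv]
    | insert v T _ ih =>
      intro hT
      obtain ⟨l, hl1, hl2, hl3, hl4⟩ := ih fun w hw => hT w (by simp [hw])
      have hv : r₁ z v := hT v (by simp)
      by_cases hvl : v ∈ l
      · refine ⟨l, hl1, hl2, hl3, fun y => ?_⟩
        rw [hl4]
        constructor
        · rintro (h' | ⟨w, hw, h'⟩)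
          · exact Or.inl h'
          · exact Or.inr ⟨w, by simp [hw], h'⟩
        · rintro (h' | ⟨w, hw, h'⟩)
          · exact Or.inl h'
          · rcases Finset.mem_insert.1 hw with rfl | hw
            · rcases (hl4 w).1 hvl with h'' | ⟨w', hw', h''⟩
              · exact Or.inl (r₂.trans' h'' h')
              · exact Or.inr ⟨w', hw', r₂.trans' h'' h'⟩
            · exact Or.inr ⟨w, hw, h'⟩
      · have hve : ¬ r₂ v e := fun h' => hvl ((hl4 v).2 (Or.inl (r₂.symm' h')))
        obtain ⟨heven, v', hv', hvv', hr⟩ := (h v hv).resolve_left hve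
        obtain ⟨A, hA1, hA2, hA3, hA4, hA5⟩ := exists_list_ends (K := {x | r₂ v x})
          (r₂.refl' v) hr hvv'
        have hgood := (append_good hl2 (A := A)
          (fun x hx y hy => r₂.trans' (r₂.symm' ((hA2 x).1 hx)) ((hA2 y).1 hy))
          (fun u hu w hw => by
            rw [hA4, Option.mem_some_iff] at hu
            subst hu
            exact r₁.trans' (r₁.symm' hv') (hl3 w hw))).1 (by rw [hA5]; exact heven)
        refine ⟨A ++ l, ?_, hgood, ?_, fun y => ?_⟩
        · rw [List.nodup_append]
          refine ⟨hA1, hl1, fun x hx y hy e' => hvl ?_⟩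
          subst e'
          rw [hl4] at hy ⊢
          have hx' := r₂.symm' ((hA2 x).1 hx)
          rcases hy with h'' | ⟨w', hw', h''⟩
          · exact Or.inl (r₂.trans' h'' hx')
          · exact Or.inr ⟨w', hw', r₂.trans' h'' hx'⟩
        · intro w hw
          rw [List.head?_append, hA3, Option.some_or, Option.mem_some_iff] at hw
          rwa [← hw]
        · rw [List.mem_append, hA2, hl4]
          simp only [Set.mem_ofPred_eq, Finset.mem_insert, exists_eq_or_imp]
          tauto
  obtain ⟨l, hl1, hl2, -, hl4⟩ := key (Finset.univ.filter fun v => r₁ z v) (by simp)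
  refine ⟨l, hl1, hl2.goodList, fun y => ?_⟩
  rw [hl4]
  simp only [Finset.mem_filter, Finset.mem_univ, true_and]
  constructor
  · rintro (h' | h')
    · exact ⟨e, he, h'⟩
    · exact h'
  · exact Or.inr

end Chains

end

end RandomCircuit

namespace RandomCircuit

noncomputable section

/-! ### Stars of clusters -/

section Pairing

variable {ι : Type*} [Finite ι]

/-- The points of a set can be paired off within the classes of an equivalence relation, leaving at
most one point of every class unpaired. -/
lemma exists_pairing (τ : Setoid ι) (U : Set ι) : ∃ β : ι → ι,
    (∀ b ∈ U, β b ∈ U ∧ τ b (β b) ∧ β (β b) = b) ∧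
    ∀ b ∈ U, ∀ b' ∈ U, τ b b' → β b = b → β b' = b' → b = b' := by
  classical
  -- A pairing with the largest number of paired points.
  let S : Set (ι → ι) := {β | ∀ b ∈ U, β b ∈ U ∧ τ b (β b) ∧ β (β b) = b}
  obtain ⟨β, hβ, hmax⟩ := Set.exists_max_image S (fun β => {b | b ∈ U ∧ β b ≠ b}.ncard)
    (Set.toFinite _) ⟨id, fun b hb => ⟨hb, τ.refl' b, rfl⟩⟩
  refine ⟨β, hβ, fun b hb b' hb' hτ hfix hfix' => ?_⟩
  by_contra hne
  let γ : ι → ι := fun x => if x = b then b' else if x = b' then b else β x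
  have hγb : γ b = b' := by simp [γ]
  have hγb' : γ b' = b := by simp [γ, Ne.symm hne]
  have hγ : ∀ x, x ≠ b → x ≠ b' → γ x = β x := fun x h1 h2 => by simp [γ, h1, h2]
  have hγS : γ ∈ S := by
    intro x hx
    by_cases h1 : x = b
    · subst h1; rw [hγb]; exact ⟨hb', hτ, hγb'⟩
    by_cases h2 : x = b'
    · subst h2; rw [hγb']; exact ⟨hb, τ.symm' hτ, hγb⟩
    obtain ⟨hx1, hx2, hx3⟩ := hβ x hx
    rw [hγ x h1 h2]
    refine ⟨hx1, hx2, ?_⟩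
    rw [hγ, hx3]
    · intro e; rw [e, hfix] at hx3; exact h1 hx3.symm
    · intro e; rw [e, hfix'] at hx3; exact h2 hx3.symm
  have hlt : {b | b ∈ U ∧ β b ≠ b}.ncard < {b | b ∈ U ∧ γ b ≠ b}.ncard := by
    apply Set.ncard_lt_ncard _ (Set.toFinite _)
    refine ⟨?_, fun hsub => ?_⟩
    · rintro x ⟨hx, hx'⟩
      refine ⟨hx, ?_⟩
      rw [hγ x]
      · exact hx'
      · rintro rfl; exact hx' hfix
      · rintro rfl; exact hx' hfix'
    · exact (hsub (show b ∈ U ∧ γ b ≠ b from ⟨hb, by rw [hγb]; exact Ne.symm hne⟩)).2 hfix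
  exact absurd (hmax γ hγS) (not_le.2 hlt)

end Pairing

section Star

variable {ι E : Type*} [Finite ι] [NormedAddCommGroup E] [InnerProductSpace ℂ E]
  [FiniteDimensional ℂ E] (P : PairSystem ι E)

lemma PairSystem.f_le_gap₂_of_isChainSystem {r : Setoid ι} {a : ι → ι} {U : Set ι} {dep : ι → ℕ}
    (h : IsChainSystem r a U dep) : P.f ≤ P.gap₂ (link a U) r :=
  P.le_gap₂_of_goodList h.exists_goodList

/-- Merging stars of clusters. Every source `b ∈ U` lies in its own cluster (a *leg*), and is linked
to a site `a b` of a cluster that is not a leg (a *centre*); the sites `a b` are distinct.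

The sites `a b` of one centre are paired such that the two legs of a pair have the same parity. The
relation is first refined so that every pair is a cluster of its own. Merging the at most two legs
of each of these clusters costs two factors `f`, and turns all pairs into clusters with an even
number of sites, two of which belong to the centre. The centre is then a hub of its component. -/
theorem PairSystem.pow_three_le_gap₂_of_star {r : Setoid ι} {a : ι → ι} {U : Set ι}
    (hup : ∀ b ∈ U, ∀ b' ∈ U, r b b' → b = b') (hinj : Set.InjOn a U)
    (hleg : ∀ b ∈ U, ∀ b' ∈ U, ¬ r b' (a b)) : P.f ^ 3 ≤ P.gap₂ (link a U) r := by
  classical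
  -- `τ b b'`: the legs of `b` and `b'` belong to the same centre and have the same parity.
  let τ : Setoid ι := Setoid.comap a r ⊓ memSetoid {b | Even {x | r b x}.ncard}
  have hτ : ∀ b b', τ b b' ↔
      r (a b) (a b') ∧ (Even {x | r b x}.ncard ↔ Even {x | r b' x}.ncard) := by
    intro b b'
    change (r (a b) (a b') ∧ memSetoid _ b b') ↔ _
    rw [memSetoid_iff]; rfl
  obtain ⟨β, hβ, hβfix⟩ := exists_pairing τ U
  obtain ⟨e, he⟩ := exists_injective_nat ι
  -- The label of a site: the pair that it belongs to, if any
  let lab : ι → Set ι := fun v => {c | ∃ b ∈ U, a b = v ∧ β b ≠ b ∧ (c = b ∨ c = β b)}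
  have hlab_pair : ∀ b ∈ U, β b ≠ b → lab (a b) = {b, β b} := by
    intro b hb hne
    ext c
    constructor
    · rintro ⟨b', hb', hab, -, hc⟩
      rw [hinj hb' hb hab] at hc
      exact hc
    · intro hc
      exact ⟨b, hb, rfl, hne, hc⟩
  have hlab_fix : ∀ b ∈ U, β b = b → lab (a b) = ∅ := by
    intro b hb heq
    ext c
    simp only [Set.mem_empty_iff_false, iff_false]
    rintro ⟨b', hb', hab, hne, -⟩
    rw [hinj hb' hb hab] at hne
    exact hne heq
  have hlab_leg : ∀ b ∈ U, ∀ v, r b v → lab v = ∅ := by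
    intro b hb v hv
    ext c
    simp only [Set.mem_empty_iff_false, iff_false]
    rintro ⟨b', hb', rfl, -⟩
    exact hleg b' hb' b hb hv
  -- The refinement of `r` in which the two sites of every pair form a cluster.
  let r' : Setoid ι := r ⊓ Setoid.ker lab
  have hr' : ∀ x y, r' x y ↔ r x y ∧ lab x = lab y := fun _ _ => Iff.rfl
  have hr'r : r' ≤ r := inf_le_left
  have hr'leg : ∀ b ∈ U, ∀ v, r b v → r' b v := fun b hb v hv =>
    (hr' _ _).2 ⟨hv, by rw [hlab_leg b hb v hv, hlab_leg b hb b (r.refl' b)]⟩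
  -- `U₁` and `U₂` contain one leg of every pair each. The at most two unpaired legs of a centre have
  -- different parities and are distributed by parity, so no refined cluster is the target of two
  -- links from `U₁`, or of two links from `U₂`.
  let U₁ : Set ι := {b | b ∈ U ∧ (e b < e (β b) ∨ (β b = b ∧ Even {x | r b x}.ncard))}
  let U₂ : Set ι := {b | b ∈ U ∧ (e (β b) < e b ∨ (β b = b ∧ ¬ Even {x | r b x}.ncard))}
  have hU : U = U₁ ∪ U₂ := by
    ext b
    constructor
    · intro hb
      rcases lt_trichotomy (e b) (e (β b)) with h | h | h
      · exact Or.inl ⟨hb, Or.inl h⟩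
      · have h' := (he h).symm
        by_cases hev : Even {x | r b x}.ncard
        · exact Or.inl ⟨hb, Or.inr ⟨h', hev⟩⟩
        · exact Or.inr ⟨hb, Or.inr ⟨h', hev⟩⟩
      · exact Or.inr ⟨hb, Or.inl h⟩
    · rintro (h | h) <;> exact h.1
  have hdisj : ∀ b, b ∈ U₁ → b ∈ U₂ → False := by
    rintro b ⟨-, h | ⟨h, h'⟩⟩ ⟨-, k | ⟨k, k'⟩⟩
    · omega
    · rw [k] at h; omega
    · rw [h] at k; omega
    · exact k' h'
  -- Two targets in the same refined cluster: either they form a pair or both are unpaired.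
  have hports : ∀ b ∈ U, ∀ b' ∈ U, r' (a b) (a b') →
      b' = b ∨ (b' = β b ∧ β b ≠ b) ∨ (β b = b ∧ β b' = b' ∧ r (a b) (a b')) := by
    intro b hb b' hb' h
    obtain ⟨h1, h2⟩ := (hr' _ _).1 h
    by_cases h3 : β b = b <;> by_cases h4 : β b' = b'
    · exact Or.inr (Or.inr ⟨h3, h4, h1⟩)
    · rw [hlab_fix b hb h3, hlab_pair b' hb' h4] at h2
      exact absurd (h2 ▸ Set.mem_insert b' {β b'} : b' ∈ (∅ : Set ι)) (Set.notMem_empty _)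
    · rw [hlab_fix b' hb' h4, hlab_pair b hb h3] at h2
      exact absurd (h2 ▸ Set.mem_insert b {β b} : b ∈ (∅ : Set ι)) (Set.notMem_empty _)
    · rw [hlab_pair b hb h3, hlab_pair b' hb' h4] at h2
      have : b' ∈ ({b, β b} : Set ι) := h2 ▸ Set.mem_insert b' _
      rcases this with h5 | h5
      · exact Or.inl h5
      · exact Or.inr (Or.inl ⟨h5, h3⟩)
  have hdown₁ : ∀ b ∈ U₁, ∀ b' ∈ U₁, r' (a b) (a b') → b = b' := by
    rintro b ⟨hb, hb₁⟩ b' ⟨hb', hb₁'⟩ h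
    rcases hports b hb b' hb' h with h1 | ⟨rfl, h1⟩ | ⟨h1, h2, h3⟩
    · exact h1.symm
    · rw [(hβ b hb).2.2] at hb₁'
      rcases hb₁ with hb₁ | hb₁ <;> rcases hb₁' with hb₁' | hb₁'
      · omega
      · exact hb₁'.1
      · exact absurd hb₁.1 h1
      · exact absurd hb₁.1 h1
    · have e1 := (hb₁.resolve_left (by rw [h1]; omega)).2
      have e2 := (hb₁'.resolve_left (by rw [h2]; omega)).2
      exact hβfix b hb b' hb' ((hτ _ _).2 ⟨h3, by tauto⟩) h1 h2
  have hdown₂ : ∀ b ∈ U₂, ∀ b' ∈ U₂, r' (a b) (a b') → b = b' := by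
    rintro b ⟨hb, hb₁⟩ b' ⟨hb', hb₁'⟩ h
    rcases hports b hb b' hb' h with h1 | ⟨rfl, h1⟩ | ⟨h1, h2, h3⟩
    · exact h1.symm
    · rw [(hβ b hb).2.2] at hb₁'
      rcases hb₁ with hb₁ | hb₁ <;> rcases hb₁' with hb₁' | hb₁'
      · omega
      · exact hb₁'.1
      · exact absurd hb₁.1 h1
      · exact absurd hb₁.1 h1
    · have e1 := (hb₁.resolve_left (by rw [h1]; omega)).2
      have e2 := (hb₁'.resolve_left (by rw [h2]; omega)).2
      exact hβfix b hb b' hb' ((hτ _ _).2 ⟨h3, by tauto⟩) h1 h2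
  have hU₁ : ∀ b ∈ U₁, b ∈ U := fun b hb => hb.1
  have hU₂ : ∀ b ∈ U₂, b ∈ U := fun b hb => hb.1
  -- Chains of two clusters without interior.
  have hstep₁ : P.f ≤ P.gap₂ (link a U₁) r' := by
    refine P.f_le_gap₂_of_isChainSystem (dep := fun v => if ∃ b ∈ U, r b v then 1 else 0)
      { dep_eq := ?_, dep_lt := ?_, up := ?_, down := hdown₁, ne := ?_, even := ?_ }
    · intro x y hxy
      have : (∃ b ∈ U, r b x) ↔ ∃ b ∈ U, r b y :=
        ⟨fun ⟨b, hb, h⟩ => ⟨b, hb, r.trans' h (hr'r hxy)⟩,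
          fun ⟨b, hb, h⟩ => ⟨b, hb, r.trans' h (r.symm' (hr'r hxy))⟩⟩
      simp only [this]
    · intro b hb
      rw [if_neg (by rintro ⟨b', hb', h⟩; exact hleg b hb.1 b' hb' h),
        if_pos ⟨b, hb.1, r.refl' b⟩]
      exact one_pos
    · exact fun b hb b' hb' h => hup b hb.1 b' hb'.1 (hr'r h)
    · exact fun b hb b' hb' h => absurd (hr'r h) (hleg b' hb'.1 b hb.1)
    · exact fun b hb b' hb' h => absurd (hr'r h) (hleg b' hb'.1 b hb.1)
  have hleg₁ : ∀ b ∈ U, ∀ b' ∈ U₁, ¬ r' b' (a b) := fun b hb b' hb' h =>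
    hleg b hb b' hb'.1 (hr'r h)
  have hsrc₁ : ∀ b ∈ U₂, ∀ b' ∈ U₁, ¬ r' b' b := fun b hb b' hb' h =>
    hdisj b (hup b' hb'.1 b hb.1 (hr'r h) ▸ hb') hb
  have hup₁ : ∀ b ∈ U₁, ∀ b' ∈ U₁, r' b b' → b = b' := fun b hb b' hb' h =>
    hup b hb.1 b' hb'.1 (hr'r h)
  -- Merging `U₁` does not affect the sources and the targets of the links of `U₂`.
  have hstep₂ : P.f ≤ P.gap₂ (link a U₂) (r' ⊔ link a U₁) := by
    refine P.f_le_gap₂_of_isChainSystem (dep := fun v => if ∃ b ∈ U₂, r b v then 1 else 0)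
      { dep_eq := ?_, dep_lt := ?_, up := ?_, down := ?_, ne := ?_, even := ?_ }
    · intro x y hxy
      have hle : r' ⊔ link a U₁ ≤ memSetoid {v | ∃ b ∈ U₂, r b v} := by
        refine sup_le ?_ ?_
        · intro x y hxy
          rw [memSetoid_iff]
          exact ⟨fun ⟨b, hb, h⟩ => ⟨b, hb, r.trans' h (hr'r hxy)⟩,
            fun ⟨b, hb, h⟩ => ⟨b, hb, r.trans' h (r.symm' (hr'r hxy))⟩⟩
        · rw [link_le_iff]
          intro b hb
          rw [memSetoid_iff]
          refine ⟨fun ⟨b', hb', h⟩ => ?_, fun ⟨b', hb', h⟩ => ?_⟩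
          · exact absurd hb' (fun h' => hdisj b hb (hup b' hb'.1 b hb.1 h ▸ h'))
          · exact absurd h (hleg b hb.1 b' hb'.1)
      have := memSetoid_iff.1 (hle hxy)
      simp only [Set.mem_ofPred_eq] at this
      simp only [this]
    · intro b hb
      rw [if_neg (by rintro ⟨b', hb', h⟩; exact hleg b hb.1 b' hb'.1 h),
        if_pos ⟨b, hb, r.refl' b⟩]
      exact one_pos
    · intro b hb b' hb' h
      exact hup b hb.1 b' hb'.1 (hr'r (rel_of_link_sup_rel hup₁ (hsrc₁ b hb) (hsrc₁ b' hb') h))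
    · intro b hb b' hb' h
      exact hdown₂ b hb b' hb'
        (rel_of_link_sup_rel hup₁ (hleg₁ b hb.1) (hleg₁ b' hb'.1) h)
    · intro b hb b' hb' h
      exact absurd (hr'r (rel_of_link_sup_rel hup₁ (hsrc₁ b hb) (hleg₁ b' hb'.1) h))
        (hleg b' hb'.1 b hb.1)
    · intro b hb b' hb' h
      exact absurd (hr'r (rel_of_link_sup_rel hup₁ (hsrc₁ b hb) (hleg₁ b' hb'.1) h))
        (hleg b' hb'.1 b hb.1)
  have hmerge : P.f * P.f ≤ P.gap₂ (link a U) r' := by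
    refine le_trans ?_ ((P.mul_gap₂_le (link a U₁) (link a U₂) r').trans_eq ?_)
    · exact mul_le_mul hstep₁ hstep₂ P.f_nonneg (P.gap₂_nonneg _ _)
    · rw [← link_union, ← hU]
  have hup' : ∀ b ∈ U, ∀ b' ∈ U, r' b b' → b = b' := fun b hb b' hb' h =>
    hup b hb b' hb' (hr'r h)
  -- Restoring the relation `r`: the centres are hubs, whose exceptional class is that of the sites
  -- without a label.
  have hub : P.f ≤ P.gap₂ r (link a U ⊔ r') := by
    refine P.le_gap₂_of_goodList fun x => ?_
    set R := link a U ⊔ r' with hR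
    have hlinkR : ∀ b ∈ U, R b (a b) := fun b hb =>
      (le_sup_left : link a U ≤ R) (link_rel hb)
    have hr'R : r' ≤ R := le_sup_right
    -- points outside the legs that are related by `R` belong to the same refined cluster
    have hRr' : ∀ x y, (∀ b ∈ U, ¬ r b x) → (∀ b ∈ U, ¬ r b y) → R x y → r' x y := by
      intro x y hx hy h
      rw [hR, sup_comm] at h
      exact rel_of_link_sup_rel hup' (fun b hb h' => hx b hb (hr'r h'))
        (fun b hb h' => hy b hb (hr'r h')) h
    have hport : ∀ b ∈ U, ∀ b' ∈ U, ¬ r b' (a b) := hleg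
    -- A site `z` in the centre of the star of `x`.
    obtain ⟨z, hxz, hz⟩ : ∃ z, (r ⊔ R) x z ∧ ∀ b ∈ U, ¬ r b z := by
      by_cases h : ∃ b ∈ U, r b x
      · obtain ⟨b, hb, hbx⟩ := h
        exact ⟨a b, Setoid.trans' _ ((le_sup_left : r ≤ _) (r.symm' hbx))
          ((le_sup_right : R ≤ _) (hlinkR b hb)), hleg b hb⟩
      · push Not at h
        exact ⟨x, Setoid.refl' _ x, h⟩
    have hzv : ∀ v, r z v → ∀ b ∈ U, ¬ r b v := fun v hv b hb h =>
      hz b hb (r.trans' h (r.symm' hv))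
    obtain ⟨e₀, he₀, he₀'⟩ : ∃ e₀, r z e₀ ∧ ∀ v, r z v → lab v = ∅ → R v e₀ := by
      by_cases h : ∃ v₀, r z v₀ ∧ lab v₀ = ∅
      · obtain ⟨v₀, h1, h2⟩ := h
        exact ⟨v₀, h1, fun v hv hlv => hr'R ((hr' _ _).2 ⟨r.trans' (r.symm' hv) h1,
          by rw [hlv, h2]⟩)⟩
      · push Not at h
        exact ⟨z, r.refl' z, fun v hv hlv => absurd (hlv ▸ h v hv) Set.not_nonempty_empty⟩
    have hhub : ∀ v, r z v → R v e₀ ∨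
        (Even {x | R v x}.ncard ∧ ∃ v', r z v' ∧ v ≠ v' ∧ R v v') := by
      intro v hv
      by_cases hlv : lab v = ∅
      · exact Or.inl (he₀' v hv hlv)
      right
      obtain ⟨c, b, hb, rfl, hne, -⟩ := Set.nonempty_iff_ne_empty.2 hlv
      obtain ⟨hβU, hbτ, hββ⟩ := hβ b hb
      obtain ⟨hrab, hpar⟩ := (hτ _ _).1 hbτ
      have hne' : β (β b) ≠ β b := by rw [hββ]; exact hne.symm
      have hlab' : lab (a (β b)) = lab (a b) := by
        rw [hlab_pair b hb hne, hlab_pair _ hβU hne', hββ, Set.pair_comm]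
      have hr'ab : r' (a b) (a (β b)) := (hr' _ _).2 ⟨hrab, hlab'.symm⟩
      have hane : a b ≠ a (β b) := fun h => hne (hinj hb hβU h).symm
      refine ⟨?_, a (β b), r.trans' hv hrab, hane, hr'R hr'ab⟩
      -- The class of a paired target consists of the two legs and the two targets of the pair.
      have hset : {x | R (a b) x} = ({x | r b x} ∪ {x | r (β b) x}) ∪ {a b, a (β b)} := by
        ext y
        constructor
        · intro (hy : R (a b) y)
          by_cases h : ∃ b₁ ∈ U, r b₁ y
          · obtain ⟨b₁, hb₁, hb₁y⟩ := h
            have h1 : r' (a b) (a b₁) := hRr' _ _ (hleg b hb) (hleg b₁ hb₁)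
              (R.trans' hy (R.trans' (R.symm' (hr'R (hr'leg b₁ hb₁ y hb₁y))) (hlinkR b₁ hb₁)))
            rcases hports b hb b₁ hb₁ h1 with rfl | ⟨rfl, -⟩ | ⟨h2, -⟩
            · exact Or.inl (Or.inl hb₁y)
            · exact Or.inl (Or.inr hb₁y)
            · exact absurd h2 hne
          · push Not at h
            have h1 := hRr' _ _ (hleg b hb) h hy
            have h2 := ((hr' _ _).1 h1).2
            have h3 : b ∈ lab y := by
              rw [← h2, hlab_pair b hb hne]; exact Set.mem_insert _ _
            obtain ⟨b₂, hb₂, rfl, hb₂ne, -⟩ := h3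
            rcases hports b hb b₂ hb₂ h1 with rfl | ⟨rfl, -⟩ | ⟨h2, -⟩
            · exact Or.inr (Or.inl rfl)
            · exact Or.inr (Or.inr rfl)
            · exact absurd h2 hne
        · rintro ((hy | hy) | rfl | rfl)
          · exact R.trans' (R.symm' (hlinkR b hb)) (hr'R (hr'leg b hb y hy))
          · exact R.trans' (hr'R hr'ab) (R.trans' (R.symm' (hlinkR _ hβU))
              (hr'R (hr'leg _ hβU y hy)))
          · exact R.refl' _
          · exact hr'R hr'ab
      have hd1 : Disjoint {x | r b x} {x | r (β b) x} := by
        rw [Set.disjoint_left]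
        intro y (h1 : r b y) (h2 : r (β b) y)
        exact hne (hup b hb _ hβU (r.trans' h1 (r.symm' h2))).symm
      have hd2 : Disjoint ({x | r b x} ∪ {x | r (β b) x}) {a b, a (β b)} := by
        rw [Set.disjoint_left]
        rintro y (h1 | h1) (rfl | rfl)
        · exact hleg b hb b hb h1
        · exact hleg _ hβU b hb h1
        · exact hleg b hb _ hβU h1
        · exact hleg _ hβU _ hβU h1
      rw [hset, Set.ncard_union_eq hd2 (Set.toFinite _) (Set.toFinite _),
        Set.ncard_union_eq hd1 (Set.toFinite _) (Set.toFinite _), Set.ncard_pair hane]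
      exact (Nat.even_add.2 hpar).add even_two
    obtain ⟨l, hl1, hl2, hl3⟩ := exists_goodList_of_hub he₀ hhub
    refine ⟨l, hl1, hl2, mem_iff_of_saturated (z := z) ((hl3 z).2 ⟨z, r.refl' z, R.refl' z⟩)
      ?_ ?_ ?_ hxz⟩
    · have : ∀ y y', r y y' → y ∈ l → y' ∈ l := by
        intro y y' hyy' hy
        obtain ⟨v, hv, hvy⟩ := (hl3 y).1 hy
        rw [hl3]
        by_cases h : ∃ b ∈ U, r b y
        · obtain ⟨b, hb, hby⟩ := h
          exact ⟨v, hv, R.trans' hvy (R.trans' (R.symm' (hr'R (hr'leg b hb y hby)))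
            (hr'R (hr'leg b hb y' (r.trans' hby hyy'))))⟩
        · push Not at h
          exact ⟨y', r.trans' (r.trans' hv (hr'r (hRr' v y (hzv v hv) h hvy))) hyy', R.refl' _⟩
      exact fun y y' hyy' => memSetoid_iff.2 ⟨this y y' hyy', this y' y (r.symm' hyy')⟩
    · intro y y' hyy'
      rw [memSetoid_iff]
      simp only [Set.mem_ofPred_eq, hl3]
      exact ⟨fun ⟨v, hv, h⟩ => ⟨v, hv, R.trans' h hyy'⟩,
        fun ⟨v, hv, h⟩ => ⟨v, hv, R.trans' h (R.symm' hyy')⟩⟩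
    · intro y hy
      obtain ⟨v, hv, hvy⟩ := (hl3 y).1 hy
      exact Setoid.trans' _ ((le_sup_left : r ≤ _) hv) ((le_sup_right : R ≤ _) hvy)
  have hfin := P.mul_gap₂_le r' r (link a U)
  rw [sup_eq_right.2 hr'r, P.gap₂_symm r' (link a U), P.gap₂_symm r (link a U)] at hfin
  refine le_trans ?_ hfin
  rw [pow_succ, pow_two]
  exact mul_le_mul hmerge hub P.f_nonneg (P.gap₂_nonneg _ _)

/-- Merging chains of clusters with arbitrary numbers of sites. One site is removed from every
interior cluster with an odd number of sites; the chains of the remaining sites are merged at the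
cost of a factor `f`, and the removed sites are the legs of stars around them. -/
theorem PairSystem.pow_four_le_gap₂_of_chains {r : Setoid ι} {a : ι → ι} {U : Set ι} {dep : ι → ℕ}
    (hdep : ∀ {x y}, r x y → dep x = dep y) (hlt : ∀ b ∈ U, dep (a b) < dep b)
    (hup : ∀ b ∈ U, ∀ b' ∈ U, r b b' → b = b')
    (hdown : ∀ b ∈ U, ∀ b' ∈ U, r (a b) (a b') → b = b')
    (hne : ∀ b ∈ U, ∀ b' ∈ U, r b (a b') → b ≠ a b') : P.f ^ 4 ≤ P.gap₂ (link a U) r := by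
  classical
  -- The sources in interior clusters with an odd number of sites. Such a cluster has a site `c b`
  -- besides the source and the target in it.
  let I : Set ι := {b | b ∈ U ∧ (∃ b' ∈ U, r b (a b')) ∧ ¬ Even {x | r b x}.ncard}
  have hc : ∀ b ∈ I, ∃ c, r b c ∧ c ≠ b ∧ ∀ b' ∈ U, r b (a b') → c ≠ a b' := by
    rintro b ⟨hb, ⟨b', hb', hbb'⟩, hodd⟩
    by_contra! hcon
    apply hodd
    have : {x | r b x} = {b, a b'} := by
      ext y
      constructor
      · intro hy
        by_cases e : y = b
        · exact Or.inl e
        · obtain ⟨b'', hb'', h1, h2⟩ := hcon y hy e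
          right
          rw [h2, hdown b'' hb'' b' hb' (r.trans' (r.symm' h1) hbb')]
          rfl
      · rintro (rfl | rfl)
        · exact r.refl' _
        · exact hbb'
    rw [this, Set.ncard_pair (hne b hb b' hb' hbb')]
    exact even_two
  choose! c hc1 hc2 hc3 using hc
  have hIU : ∀ b ∈ I, b ∈ U := fun b hb => hb.1
  set C : Set ι := c '' I with hC
  have hbC : ∀ b ∈ U, b ∉ C := by
    rintro b hb ⟨b₀, hb₀, rfl⟩
    exact hc2 b₀ hb₀ (hup b₀ (hIU _ hb₀) _ hb (hc1 b₀ hb₀)).symm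
  have habC : ∀ b ∈ U, a b ∉ C := by
    rintro b hb ⟨b₀, hb₀, h⟩
    exact hc3 b₀ hb₀ b hb (h ▸ hc1 b₀ hb₀) h
  have hCr : ∀ x ∈ C, ∀ y ∈ C, r x y → x = y := by
    rintro _ ⟨b, hb, rfl⟩ _ ⟨b', hb', rfl⟩ h
    rw [hup b (hIU b hb) b' (hIU b' hb')
      (r.trans' (hc1 b hb) (r.trans' h (r.symm' (hc1 b' hb'))))]
  -- The relation `r` with the sites in `C` isolated.
  let r' : Setoid ι := r ⊓ memSetoid C
  have hr' : ∀ x y, r' x y ↔ r x y ∧ (x ∈ C ↔ y ∈ C) := fun x y => by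
    rw [← memSetoid_iff]; rfl
  have hr'r : r' ≤ r := inf_le_left
  have hstep₁ : P.f ≤ P.gap₂ (link a U) r' := by
    refine P.f_le_gap₂_of_isChainSystem (dep := dep)
      { dep_eq := fun h => hdep (hr'r h), dep_lt := hlt,
        up := fun b hb b' hb' h => hup b hb b' hb' (hr'r h),
        down := fun b hb b' hb' h => hdown b hb b' hb' (hr'r h),
        ne := fun b hb b' hb' h => hne b hb b' hb' (hr'r h), even := ?_ }
    intro b hb b' hb' h
    by_cases hev : Even {x | r b x}.ncard
    · have : {x | r' b x} = {x | r b x} := by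
        ext y
        simp only [Set.mem_ofPred_eq, hr']
        refine ⟨fun h => h.1, fun h' => ⟨h', ?_⟩⟩
        refine iff_of_false (hbC b hb) ?_
        rintro ⟨b₀, hb₀, rfl⟩
        have := hup b₀ (hIU _ hb₀) b hb (r.trans' (hc1 b₀ hb₀) (r.symm' h'))
        subst this
        exact hb₀.2.2 hev
      rwa [this]
    · have hbI : b ∈ I := ⟨hb, ⟨b', hb', hr'r h⟩, hev⟩
      have : {x | r' b x} = {x | r b x} \ {c b} := by
        ext y
        simp only [Set.mem_ofPred_eq, hr', Set.mem_sdiff, Set.mem_singleton_iff]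
        refine and_congr_right fun hy => ?_
        rw [iff_false_left (hbC b hb), not_iff_not]
        constructor
        · intro hyC
          exact hCr y hyC (c b) ⟨b, hbI, rfl⟩ (r.trans' (r.symm' hy) (hc1 b hbI))
        · rintro rfl
          exact ⟨b, hbI, rfl⟩
      have hcard := Set.ncard_sdiff_singleton_add_one (show c b ∈ {x | r b x} from hc1 b hbI)
        (Set.toFinite _)
      rw [this]
      rw [← hcard, Nat.even_add_one, not_not] at hev
      exact hev
  set ρ : Setoid ι := link a U ⊔ r' with hρ
  -- The sites in `C` remain isolated when the chains are merged, and are then legs attached to the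
  -- sources `a'` of their clusters.
  have hisol : ρ ≤ restr ⊤ Cᶜ := by
    refine sup_le ?_ ?_
    · rw [link_le_iff]
      exact fun b hb => Or.inr ⟨trivial, hbC b hb, habC b hb⟩
    · intro x y hxy
      obtain ⟨h1, h2⟩ := (hr' x y).1 hxy
      by_cases hx : x ∈ C
      · exact Or.inl (hCr x hx y (h2.1 hx) h1)
      · exact Or.inr ⟨trivial, hx, fun hy => hx (h2.2 hy)⟩
  have ha' : ∀ x ∈ C, ∃ b, b ∈ I ∧ c b = x := fun x hx => hx
  choose! a' ha' using ha'
  have hstar : P.f ^ 3 ≤ P.gap₂ (link a' C) ρ := by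
    refine P.pow_three_le_gap₂_of_star ?_ ?_ ?_
    · intro x hx y _ h
      rcases hisol h with h | ⟨-, h, -⟩
      · exact h
      · exact absurd hx h
    · intro x hx y hy h
      rw [← (ha' x hx).2, ← (ha' y hy).2, h]
    · intro x hx y hy h
      rcases hisol h with h | ⟨-, h, -⟩
      · exact hbC _ (hIU _ (ha' x hx).1) (h ▸ hy)
      · exact h hy
  have ha'r : ∀ x ∈ C, r x (a' x) := by
    intro x hx
    have := hc1 _ (ha' x hx).1
    rw [(ha' x hx).2] at this
    exact r.symm' this
  have hmono : P.gap₂ (link a' C) ρ ≤ P.gap₂ r ρ := by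
    refine P.gap₂_mono (link_le_iff.2 ha'r) le_rfl (sup_le ?_ le_sup_right)
    have hrep : ∀ x, ∃ x', x' ∉ C ∧ r x x' ∧ (link a' C ⊔ ρ) x x' := by
      intro x
      by_cases hx : x ∈ C
      · exact ⟨a' x, hbC _ (hIU _ (ha' x hx).1), ha'r x hx,
          (le_sup_left : link a' C ≤ _) (link_rel hx)⟩
      · exact ⟨x, hx, r.refl' x, Setoid.refl' _ x⟩
    intro x y hxy
    obtain ⟨x', hx1, hx2, hx3⟩ := hrep x
    obtain ⟨y', hy1, hy2, hy3⟩ := hrep y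
    have h1 : r' x' y' := (hr' _ _).2 ⟨r.trans' (r.symm' hx2) (r.trans' hxy hy2),
      iff_of_false hx1 hy1⟩
    exact Setoid.trans' _ hx3 (Setoid.trans' _ ((le_sup_right.trans le_sup_right :
      r' ≤ link a' C ⊔ ρ) h1) (Setoid.symm' _ hy3))
  have hfin := P.mul_gap₂_le r' r (link a U)
  rw [sup_eq_right.2 hr'r, P.gap₂_symm r' (link a U), P.gap₂_symm r (link a U)] at hfin
  refine le_trans ?_ hfin
  rw [pow_succ']
  exact mul_le_mul hstep₁ (hstar.trans hmono) (pow_nonneg P.f_nonneg _) (P.gap₂_nonneg _ _)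

/-- Merging forests of clusters with few levels: every round merges the levels `2i` and `2i + 1`,
which consists of merging stars, and halves the number of levels. -/
theorem PairSystem.pow_le_gap₂_of_levels {a : ι → ι} : ∀ (c : ℕ) {r : Setoid ι} {U : Set ι}
    {lev : ι → ℕ}, (∀ {x y}, r x y → lev x = lev y) → (∀ x, lev x < 2 ^ c) →
    (∀ b ∈ U, lev b < lev (a b)) → (∀ b ∈ U, ∀ b' ∈ U, r b b' → b = b') → Set.InjOn a U →
    P.f ^ (3 * c) ≤ P.gap₂ (link a U) r := by
  classical
  intro c
  induction c with
  | zero =>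
    intro r U lev _ hlt hU _ _
    have : link a U ≤ r := by
      rw [link_le_iff]
      intro b hb
      have h1 := hU b hb
      have h2 := hlt (a b)
      simp at h2
      omega
    rw [P.gap₂_of_le this]
    simp
  | succ c ih =>
    intro r U lev hlev hlt hU hup hinj
    -- Links from the level `2i` to the level `2i + 1` form stars: a target is never a source.
    let U₁ : Set ι := {b | b ∈ U ∧ lev b / 2 = lev (a b) / 2}
    let U₂ : Set ι := {b | b ∈ U ∧ lev b / 2 ≠ lev (a b) / 2}
    have hUU : U = U₁ ∪ U₂ := by
      ext b
      by_cases h : lev b / 2 = lev (a b) / 2 <;> simp [U₁, U₂, h]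
    have hup₁ : ∀ b ∈ U₁, ∀ b' ∈ U₁, r b b' → b = b' := fun b hb b' hb' h =>
      hup b hb.1 b' hb'.1 h
    have hstep₁ : P.f ^ 3 ≤ P.gap₂ (link a U₁) r := by
      refine P.pow_three_le_gap₂_of_star hup₁ (hinj.mono fun b hb => hb.1) ?_
      intro b hb b' hb' h
      have h1 := hlev h
      have h2 := hU b hb.1
      have h3 := hU b' hb'.1
      have h4 := hb.2
      have h5 := hb'.2
      omega
    have hsrc : ∀ b ∈ U₂, ∀ b' ∈ U₁, ¬ r b' b := by
      intro b hb b' hb' h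
      have := hup b' hb'.1 b hb.1 h
      subst this
      exact hb.2 hb'.2
    have hstep₂ : P.f ^ (3 * c) ≤ P.gap₂ (link a U₂) (r ⊔ link a U₁) := by
      refine ih (lev := fun x => lev x / 2) ?_ ?_ ?_ ?_ (hinj.mono fun b hb => hb.1)
      · have hle : r ⊔ link a U₁ ≤ Setoid.ker fun x => lev x / 2 := by
          refine sup_le ?_ ?_
          · intro x y hxy
            change lev x / 2 = lev y / 2
            rw [hlev hxy]
          · rw [link_le_iff]
            exact fun b hb => hb.2
        exact fun {x y} h => hle h
      · intro x
        have := hlt x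
        rw [pow_succ] at this
        omega
      · intro b hb
        have h1 := hU b hb.1
        have h2 := hb.2
        change lev b / 2 < lev (a b) / 2
        omega
      · intro b hb b' hb' h
        exact hup b hb.1 b' hb'.1 (rel_of_link_sup_rel hup₁ (hsrc b hb) (hsrc b' hb') h)
    rw [hUU, link_union]
    refine le_trans ?_ (P.mul_gap₂_le _ _ _)
    rw [mul_add, mul_one, pow_add, mul_comm]
    exact mul_le_mul hstep₁ hstep₂ (pow_nonneg P.f_nonneg _) (P.gap₂_nonneg _ _)

end Star

end

end RandomCircuit

namespace RandomCircuit

noncomputable section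

/-! ### Matchings of arbitrary size -/

section Forest

variable {ι E : Type*} [NormedAddCommGroup E] [InnerProductSpace ℂ E]
  [FiniteDimensional ℂ E] (P : PairSystem ι E)

/-- A rooted spanning forest of the clusters (classes of `r`), whose edges are links of the matching
`α`: every cluster that is not a root contains exactly one source `b ∈ U`, and is linked to its
parent, the cluster of `α b`, which has smaller depth. The level of a cluster is the integral part
of `log₂ (n + 1) - 1`, where `n` is the number of sites in the subtree below it; a cluster has at
most one child of the same level. -/
lemma exists_leveled_forest [Finite ι] (r : Setoid ι) {α : ι → ι} (hα : Function.Involutive α) :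
    ∃ (U : Set ι) (dep lev : ι → ℕ), (∀ {x y}, r x y → dep x = dep y) ∧
      (∀ {x y}, r x y → lev x = lev y) ∧ (∀ b ∈ U, dep (α b) < dep b) ∧
      (∀ b ∈ U, ∀ b' ∈ U, r b b' → b = b') ∧ (∀ b ∈ U, lev b ≤ lev (α b)) ∧
      (∀ b ∈ U, ∀ b' ∈ U, r (α b) (α b') → lev b = lev (α b) → lev b' = lev (α b') → b = b') ∧
      (∀ x, lev x + 1 ≤ Nat.log 2 (Nat.card ι + 1)) ∧ link α Set.univ ≤ link α U ⊔ r := by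
  classical
  set s : Setoid ι := r ⊔ link α Set.univ with hs
  have hrs : r ≤ s := le_sup_left
  have hαs : ∀ x, s x (α x) := fun x =>
    (le_sup_right : link α Set.univ ≤ s) (link_rel (Set.mem_univ x))
  -- A root for every component, and the depth `dep`: the distance to the root.
  let root : ι → ι := fun x => (⟦x⟧ : Quotient s).out
  have hroot : ∀ x, s (root x) x := fun x => Quotient.exact (Quotient.out_eq _)
  have hroot_eq : ∀ x y, s x y → root x = root y := fun x y h =>
    congrArg Quotient.out (Quotient.sound h : (⟦x⟧ : Quotient s) = ⟦y⟧)
  -- the clusters that are reached from a root by at most `n` links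
  let D : ℕ → ι → Prop := fun n => Nat.rec (motive := fun _ => ι → Prop)
    (fun v => r (root v) v) (fun _ Dn v => ∃ x, r v x ∧ Dn (α x)) n
  have hD0 : ∀ v, D 0 v ↔ r (root v) v := fun _ => Iff.rfl
  have hDs : ∀ n v, D (n + 1) v ↔ ∃ x, r v x ∧ D n (α x) := fun _ _ => Iff.rfl
  have hDr : ∀ n v v', r v v' → D n v → D n v' := by
    intro n v v' h hv
    cases n with
    | zero =>
      rw [hD0] at hv ⊢
      rw [← hroot_eq v v' (hrs h)]
      exact r.trans' hv h
    | succ n =>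
      rw [hDs] at hv ⊢
      obtain ⟨x, hx, hx'⟩ := hv
      exact ⟨x, r.trans' (r.symm' h) hx, hx'⟩
  have hex : ∀ v, ∃ n, D n v := by
    intro v
    have hle : s ≤ memSetoid {v | ∃ n, D n v} := by
      refine sup_le ?_ ?_
      · intro x y h
        rw [memSetoid_iff]
        exact ⟨fun ⟨n, hn⟩ => ⟨n, hDr n _ _ h hn⟩, fun ⟨n, hn⟩ => ⟨n, hDr n _ _ (r.symm' h) hn⟩⟩
      · rw [link_le_iff]
        intro b _
        rw [memSetoid_iff]
        refine ⟨fun ⟨n, hn⟩ => ⟨n + 1, ?_⟩, fun ⟨n, hn⟩ => ⟨n + 1, ?_⟩⟩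
        · exact (hDs _ _).2 ⟨α b, r.refl' _, by rwa [hα b]⟩
        · exact (hDs _ _).2 ⟨b, r.refl' _, hn⟩
    refine (memSetoid_iff.1 (hle (hroot v))).1 ⟨0, ?_⟩
    rw [hD0, hroot_eq (root v) v (hroot v)]
  let dep : ι → ℕ := fun v => Nat.find (hex v)
  have hdep_spec : ∀ v, D (dep v) v := fun v => Nat.find_spec (hex v)
  have hdep_le : ∀ v n, D n v → dep v ≤ n := fun v n h => Nat.find_min' (hex v) h
  have hdep_eq : ∀ {x y}, r x y → dep x = dep y := fun {x y} h =>
    le_antisymm (hdep_le _ _ (hDr _ _ _ (r.symm' h) (hdep_spec y)))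
      (hdep_le _ _ (hDr _ _ _ h (hdep_spec x)))
  have hup0 : ∀ v, dep v ≠ 0 → ∃ x, r v x ∧ dep (α x) < dep v := by
    intro v hv
    obtain ⟨n, hn⟩ := Nat.exists_eq_succ_of_ne_zero hv
    have := hdep_spec v
    rw [hn, Nat.succ_eq_add_one, hDs] at this
    obtain ⟨x, hx, hx'⟩ := this
    exact ⟨x, hx, by have := hdep_le _ _ hx'; omega⟩
  -- `up v` is the site at which the cluster of `v` is linked to its parent; it depends on the cluster
  -- only.
  choose! up₀ hup₁ hup₂ using hup0
  let up : ι → ι := fun v => up₀ (⟦v⟧ : Quotient r).out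
  have hrep : ∀ v, r v (⟦v⟧ : Quotient r).out := fun v =>
    r.symm' (Quotient.exact (Quotient.out_eq _))
  have hup_r : ∀ v, dep v ≠ 0 → r v (up v) := fun v hv =>
    r.trans' (hrep v) (hup₁ _ (by rwa [← hdep_eq (hrep v)]))
  have hup_dep : ∀ v, dep v ≠ 0 → dep (α (up v)) < dep v := fun v hv => by
    have := hup₂ _ (by rwa [← hdep_eq (hrep v)])
    rwa [← hdep_eq (hrep v)] at this
  have hup_eq : ∀ v v', r v v' → up v = up v' := fun v v' h => by
    have e : (⟦v⟧ : Quotient r) = ⟦v'⟧ := Quotient.sound h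
    simp only [up, e]
  let U : Set ι := {b | dep b ≠ 0 ∧ up b = b}
  have hU_up : ∀ v, dep v ≠ 0 → up v ∈ U := fun v hv =>
    ⟨by rwa [← hdep_eq (hup_r v hv)], (hup_eq _ _ (hup_r v hv)).symm⟩
  have hU_dep : ∀ b ∈ U, dep (α b) < dep b := fun b hb => by
    have := hup_dep b hb.1
    rwa [hb.2] at this
  have hU_inj : ∀ b ∈ U, ∀ b' ∈ U, r b b' → b = b' := fun b hb b' hb' h => by
    rw [← hb.2, ← hb'.2, hup_eq b b' h]
  -- `par` maps a cluster to its parent, and `sub v` is the subtree below the cluster of `v`.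
  let par : ι → ι := fun v => if dep v = 0 then v else α (up v)
  have hpar_U : ∀ b ∈ U, par b = α b := fun b hb => by
    simp only [par, if_neg hb.1, hb.2]
  have hpar_r : ∀ v v', r v v' → r (par v) (par v') := by
    intro v v' h
    by_cases h0 : dep v = 0
    · simp only [par, if_pos h0, if_pos ((hdep_eq h).symm.trans h0)]
      exact h
    · have h0' : dep v' ≠ 0 := by rwa [← hdep_eq h]
      simp only [par, if_neg h0, if_neg h0', hup_eq v v' h]
      exact r.refl' _
  have hpar_iter : ∀ k v v', r v v' → r (par^[k] v) (par^[k] v') := by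
    intro k
    induction k with
    | zero => exact fun v v' h => h
    | succ k ih =>
      intro v v' h
      rw [Function.iterate_succ_apply, Function.iterate_succ_apply]
      exact ih _ _ (hpar_r v v' h)
  have hpar_dep : ∀ v, dep (par v) ≤ dep v := by
    intro v
    by_cases h0 : dep v = 0
    · simp only [par, if_pos h0]; exact le_rfl
    · simp only [par, if_neg h0]; exact (hup_dep v h0).le
  have hiter_dep : ∀ k v, dep (par^[k] v) ≤ dep v := by
    intro k
    induction k with
    | zero => exact fun v => le_rfl
    | succ k ih =>
      intro v
      rw [Function.iterate_succ_apply]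
      exact (ih _).trans (hpar_dep v)
  let sub : ι → Set ι := fun v => {w | ∃ k, r (par^[k] w) v}
  have hsub_r : ∀ v v', r v v' → sub v = sub v' := by
    intro v v' h
    ext w
    exact ⟨fun ⟨k, hk⟩ => ⟨k, r.trans' hk h⟩, fun ⟨k, hk⟩ => ⟨k, r.trans' hk (r.symm' h)⟩⟩
  have hsub_self : ∀ v, v ∈ sub v := fun v => ⟨0, r.refl' v⟩
  have hsub_par : ∀ b ∈ U, sub b ⊆ sub (α b) := by
    rintro b hb w ⟨k, hk⟩
    refine ⟨k + 1, ?_⟩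
    rw [Function.iterate_succ_apply', ← hpar_U b hb]
    exact hpar_r _ _ hk
  have hnot : ∀ b ∈ U, ∀ w, r w (α b) → w ∉ sub b := by
    rintro b hb w hw ⟨k, hk⟩
    have h1 := hiter_dep k w
    rw [hdep_eq hk, hdep_eq hw] at h1
    exact absurd (hU_dep b hb) (not_lt.2 h1)
  -- The subtrees of two siblings are disjoint: otherwise one of them would be an ancestor of the
  -- other.
  have hkey : ∀ b ∈ U, ∀ b' ∈ U, r (α b) (α b') → ∀ w k j, r (par^[k] w) b →
      r (par^[j + k] w) b' → b = b' := by
    intro b hb b' hb' h w k j hk hj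
    rw [Function.iterate_add_apply] at hj
    have h1 : r (par^[j] b) b' := r.trans' (r.symm' (hpar_iter j _ _ hk)) hj
    cases j with
    | zero => exact hU_inj b hb b' hb' h1
    | succ j =>
      rw [Function.iterate_succ_apply, hpar_U b hb] at h1
      have h2 := hiter_dep j (α b)
      rw [hdep_eq h1, hdep_eq h] at h2
      exact absurd (hU_dep b' hb') (not_lt.2 h2)
  have hdisj : ∀ b ∈ U, ∀ b' ∈ U, r (α b) (α b') → b ≠ b' → Disjoint (sub b) (sub b') := by
    intro b hb b' hb' h hne
    rw [Set.disjoint_left]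
    rintro w ⟨k, hk⟩ ⟨j, hj⟩
    apply hne
    rcases le_total k j with hkj | hkj
    · obtain ⟨i, rfl⟩ := Nat.exists_eq_add_of_le' hkj
      exact hkey b hb b' hb' h w k i hk hj
    · obtain ⟨i, rfl⟩ := Nat.exists_eq_add_of_le' hkj
      exact (hkey b' hb' b hb (r.symm' h) w j i hj hk).symm
  let lev : ι → ℕ := fun v => Nat.log 2 ((sub v).ncard + 1) - 1
  have hpos : ∀ v, 1 ≤ (sub v).ncard := fun v =>
    (Set.ncard_pos (Set.toFinite _)).2 ⟨v, hsub_self v⟩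
  have hlog : ∀ v, 1 ≤ Nat.log 2 ((sub v).ncard + 1) := fun v => by
    have := hpos v
    exact Nat.log_pos one_lt_two (by omega)
  refine ⟨U, dep, lev, hdep_eq, ?_, hU_dep, hU_inj, ?_, ?_, ?_, ?_⟩
  · intro x y h
    simp only [lev, hsub_r x y h]
  · intro b hb
    have h1 : (sub b).ncard ≤ (sub (α b)).ncard :=
      Set.ncard_le_ncard (hsub_par b hb) (Set.toFinite _)
    exact Nat.sub_le_sub_right (Nat.log_mono_right (by omega)) 1
  · intro b hb b' hb' h hl hl'
    by_contra hne
    -- Two children of the same level as their parent: with `2 ^ k ≤ n + 1` and `2 ^ k ≤ n' + 1`, the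
    -- parent would satisfy `2 ^ (k + 1) ≤ n + n' + 2`, which makes its level larger.
    have h1 : (sub b).ncard + (sub b').ncard + 1 ≤ (sub (α b)).ncard := by
      rw [← Set.ncard_union_eq (hdisj b hb b' hb' h hne) (Set.toFinite _) (Set.toFinite _)]
      have hmem : α b ∉ sub b ∪ sub b' := by
        rintro (h' | h')
        · exact hnot b hb _ (r.refl' _) h'
        · exact hnot b' hb' _ h h'
      rw [← Set.ncard_insert_of_notMem hmem (Set.toFinite _)]
      refine Set.ncard_le_ncard ?_ (Set.toFinite _)
      refine Set.insert_subset (hsub_self _) (Set.union_subset (hsub_par b hb) ?_)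
      rw [hsub_r _ _ h]
      exact hsub_par b' hb'
    have e1 : Nat.log 2 ((sub b).ncard + 1) = Nat.log 2 ((sub (α b)).ncard + 1) := by
      have h2 := hlog b
      have h3 := hlog (α b)
      simp only [lev] at hl
      omega
    have e2 : Nat.log 2 ((sub b').ncard + 1) = Nat.log 2 ((sub (α b)).ncard + 1) := by
      have h2 := hlog b'
      have h3 := hlog (α b')
      rw [hsub_r _ _ h]
      simp only [lev] at hl'
      omega
    set k := Nat.log 2 ((sub (α b)).ncard + 1) with hk
    have p1 : 2 ^ k ≤ (sub b).ncard + 1 := by rw [← e1]; exact Nat.pow_log_le_self 2 (by omega)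
    have p2 : 2 ^ k ≤ (sub b').ncard + 1 := by rw [← e2]; exact Nat.pow_log_le_self 2 (by omega)
    have p3 : (sub (α b)).ncard + 1 < 2 ^ (k + 1) := Nat.lt_pow_succ_log_self one_lt_two _
    rw [pow_succ] at p3
    omega
  · intro x
    have h1 := hlog x
    have h2 : (sub x).ncard ≤ Nat.card ι := by
      rw [← Set.ncard_univ]
      exact Set.ncard_le_ncard (Set.subset_univ _) (Set.toFinite _)
    have h3 : Nat.log 2 ((sub x).ncard + 1) ≤ Nat.log 2 (Nat.card ι + 1) :=
      Nat.log_mono_right (by omega)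
    simp only [lev]
    omega
  -- The forest spans the components.
  · have hxroot : ∀ n x, dep x ≤ n → (link α U ⊔ r) (root x) x := by
      intro n
      induction n with
      | zero =>
        intro x hx
        have := hdep_spec x
        rw [Nat.le_zero.1 hx, hD0] at this
        exact (le_sup_right : r ≤ _) this
      | succ n ih =>
        intro x hx
        by_cases h0 : dep x = 0
        · exact ih x (by omega)
        · have h1 := hup_dep x h0
          have h2 := ih (α (up x)) (by omega)
          have e : root (α (up x)) = root x :=
            (hroot_eq _ _ (s.trans' (hrs (hup_r x h0)) (hαs _))).symm
          rw [e] at h2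
          exact Setoid.trans' _ h2 (Setoid.trans' _ (Setoid.symm' _
            ((le_sup_left : link α U ≤ _) (link_rel (hU_up x h0))))
            ((le_sup_right : r ≤ _) (r.symm' (hup_r x h0))))
    rw [link_le_iff]
    intro x _
    have h1 := hxroot _ x le_rfl
    have h2 := hxroot _ (α x) le_rfl
    rw [← hroot_eq _ _ (hαs x)] at h2
    exact Setoid.trans' _ (Setoid.symm' _ h1) h2

/-- The gap of an arbitrary matching and an arbitrary relation. In the leveled spanning forest the
links between clusters of the same level form chains, which are merged at the cost of a factor
`f ^ 4`; the remaining links are merged in rounds, each of which halves the number of levels and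
costs a factor `f ^ 3`. -/
theorem PairSystem.pow_le_gap₂_matching [Finite ι] (hN : 2 ≤ Nat.card ι) (r : Setoid ι)
    {α : ι → ι} (hα : Function.Involutive α) :
    P.f ^ (8 * Nat.clog 2 (Nat.log 2 (Nat.card ι + 1)) + 1) ≤ P.gap₂ (link α Set.univ) r := by
  set D := Nat.log 2 (Nat.card ι + 1) with hD
  rcases Nat.eq_zero_or_pos (Nat.clog 2 D) with hc | hc
  -- two sites: every relation is trivial
  · have hD1 : D ≤ 1 := by
      have := Nat.le_pow_clog one_lt_two D
      rwa [hc, pow_zero] at this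
    have hlt : Nat.card ι + 1 < 2 ^ (1 + 1) :=
      lt_of_lt_of_le (Nat.lt_pow_succ_log_self one_lt_two _) (Nat.pow_le_pow_right two_pos
        (by omega))
    have hN2 : Nat.card ι = 2 := by omega
    have hone : P.gap₂ (link α Set.univ) r = 1 := by
      by_cases hr : ∃ x y, x ≠ y ∧ r x y
      · obtain ⟨x, y, hxy, hr⟩ := hr
        have huniv : ({x, y} : Set ι) = Set.univ := by
          refine Set.eq_of_subset_of_ncard_le (Set.subset_univ _) ?_ (Set.toFinite _)
          rw [Set.ncard_univ, Set.ncard_pair hxy, hN2]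
        have htop : ∀ z, r x z := by
          intro z
          have : z ∈ ({x, y} : Set ι) := huniv ▸ Set.mem_univ z
          rcases this with rfl | rfl
          · exact r.refl' _
          · exact hr
        exact P.gap₂_of_le fun z w _ => r.trans' (r.symm' (htop z)) (htop w)
      · push Not at hr
        rw [P.gap₂_symm]
        refine P.gap₂_of_le fun x y h => ?_
        by_cases e : x = y
        · rw [e]
        · exact absurd h (hr x y e)
    rw [hone]
    exact pow_le_one₀ P.f_nonneg P.f_le_one
  · obtain ⟨U, dep, lev, h1, h2, h3, h4, h5, h6, h7, h8⟩ := exists_leveled_forest r hα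
    let U₀ : Set ι := {b | b ∈ U ∧ lev b = lev (α b)}
    let U₁ : Set ι := {b | b ∈ U ∧ lev b ≠ lev (α b)}
    have hUU : U = U₀ ∪ U₁ := by
      ext b
      by_cases h : lev b = lev (α b) <;> simp [U₀, U₁, h]
    have hup₀ : ∀ b ∈ U₀, ∀ b' ∈ U₀, r b b' → b = b' := fun b hb b' hb' h =>
      h4 b hb.1 b' hb'.1 h
    have hstep₀ : P.f ^ 4 ≤ P.gap₂ (link α U₀) r := by
      refine P.pow_four_le_gap₂_of_chains (dep := dep) h1 (fun b hb => h3 b hb.1) hup₀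
        (fun b hb b' hb' h => h6 b hb.1 b' hb'.1 h hb.2 hb'.2) ?_
      rintro b hb b' hb' - rfl
      have e1 := h3 _ hb.1
      have e2 := h3 _ hb'.1
      rw [hα b'] at e1
      omega
    have hsrc : ∀ b ∈ U₁, ∀ b' ∈ U₀, ¬ r b' b := by
      intro b hb b' hb' h
      have := h4 b' hb'.1 b hb.1 h
      subst this
      exact hb.2 hb'.2
    have hstep₁ : P.f ^ (3 * Nat.clog 2 D) ≤ P.gap₂ (link α U₁) (r ⊔ link α U₀) := by
      refine P.pow_le_gap₂_of_levels (Nat.clog 2 D) (lev := lev) ?_ ?_ ?_ ?_ hα.injective.injOn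
      · have hle : r ⊔ link α U₀ ≤ Setoid.ker lev :=
          sup_le (fun x y h => h2 h) (link_le_iff.2 fun b hb => hb.2)
        exact fun {x y} h => hle h
      · intro x
        have := Nat.le_pow_clog one_lt_two D
        have := h7 x
        omega
      · exact fun b hb => lt_of_le_of_ne (h5 b hb.1) hb.2
      · exact fun b hb b' hb' h => h4 b hb.1 b' hb'.1
          (rel_of_link_sup_rel hup₀ (hsrc b hb) (hsrc b' hb') h)
    have hU : P.f ^ (3 * Nat.clog 2 D + 4) ≤ P.gap₂ (link α U) r := by
      rw [hUU, link_union]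
      refine le_trans ?_ (P.mul_gap₂_le _ _ _)
      rw [pow_add, mul_comm]
      exact mul_le_mul hstep₀ hstep₁ (pow_nonneg P.f_nonneg _) (P.gap₂_nonneg _ _)
    calc P.f ^ (8 * Nat.clog 2 D + 1) ≤ P.f ^ (3 * Nat.clog 2 D + 4) :=
          pow_le_pow_of_le_one P.f_nonneg P.f_le_one (by omega)
      _ ≤ P.gap₂ (link α U) r := hU
      _ ≤ P.gap₂ (link α Set.univ) r :=
          P.gap₂_mono (link_mono α (Set.subset_univ _)) le_rfl (sup_le h8 le_sup_right)

end Forest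

end

end RandomCircuit

namespace RandomCircuit

noncomputable section

/-! ### Two perfect matchings -/

section Matchings

variable {ι : Type*}

lemma even_ncard_of_involutive [Finite ι] {γ : ι → ι} (hγ : Function.Involutive γ) {K : Set ι}
    (hK : ∀ x ∈ K, γ x ∈ K) (hne : ∀ x ∈ K, γ x ≠ x) : Even K.ncard := by
  classical
  have := Fintype.ofFinite ι
  have h : ∑ _x ∈ K.toFinset, (1 : ZMod 2) = 0 :=
    Finset.sum_involution (fun x _ => γ x) (fun _ _ => by decide)
      (fun x hx _ => hne x (by simpa using hx)) (fun x hx => by simpa using hK x (by simpa using hx))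
      (fun x _ => hγ x)
  rw [Finset.sum_const, nsmul_eq_mul, mul_one, ZMod.natCast_eq_zero_iff_even] at h
  rwa [Set.ncard_eq_toFinset_card']

/-- Removing some edges of the second matching does not disconnect the end points of `{x, β x}`, if
no other edge of the component of `x` is removed: by parity, the component of `x` cannot be a path
that ends at `x` only. -/
lemma rel_of_removed_edge [Finite ι] {α β : ι → ι} (hα : Function.Involutive α)
    (hβ : Function.Involutive β) (hα' : ∀ x, α x ≠ x) (hβ' : ∀ x, β x ≠ x) {W : Set ι} {x : ι}
    (hW : ∀ z, z ∉ W → z = x ∨ z = β x ∨ ¬ (link α Set.univ ⊔ link β Set.univ) x z) :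
    (link α Set.univ ⊔ link β W) x (β x) := by
  set s := link α Set.univ ⊔ link β W with hs
  have hle : s ≤ link α Set.univ ⊔ link β Set.univ :=
    sup_le_sup le_rfl (link_mono β (Set.subset_univ _))
  by_contra hx
  have h1 : Even {z | s x z}.ncard := by
    refine even_ncard_of_involutive hα (fun z (hz : s x z) => ?_) fun z _ => hα' z
    exact s.trans' hz ((le_sup_left : link α Set.univ ≤ s) (link_rel trivial))
  have h2 : Even ({z | s x z} \ {x}).ncard := by
    refine even_ncard_of_involutive hβ ?_ fun z _ => hβ' z
    rintro z ⟨hz, hzx⟩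
    change s x z at hz
    have hzx' : z ≠ x := hzx
    have hzβ : z ≠ β x := by rintro rfl; exact hx hz
    have hzW : z ∈ W := by
      by_contra h
      rcases hW z h with h | h | h
      · exact hzx' h
      · exact hzβ h
      · exact h (hle hz)
    refine ⟨s.trans' hz ((le_sup_right : link β W ≤ s) (link_rel hzW)), ?_⟩
    intro (e : β z = x)
    exact hzβ (by rw [← e, hβ])
  have h3 := Set.ncard_sdiff_singleton_add_one (s := {z | s x z}) (a := x) (s.refl' x)
  rw [← h3, Nat.even_add_one] at h1
  exact h1 h2

/-- A perfect matching within the classes of `r` can be rewired such that the components of its union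
with `α` are as large as possible: joining two components by exchanging partners of two related
sites. -/
lemma exists_matching_spanning [Finite ι] {α β : ι → ι} {r : Setoid ι}
    (hα : Function.Involutive α) (hβ : Function.Involutive β) (hα' : ∀ x, α x ≠ x)
    (hβ' : ∀ x, β x ≠ x) (hβr : ∀ x, r x (β x)) :
    ∃ γ : ι → ι, Function.Involutive γ ∧ (∀ x, γ x ≠ x) ∧ (∀ x, r x (γ x)) ∧
      r ≤ link α Set.univ ⊔ link γ Set.univ := by
  classical
  obtain ⟨γ, ⟨h1, h2, h3⟩, hmax⟩ := Set.Finite.exists_maximalFor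
    (fun γ : ι → ι => link α Set.univ ⊔ link γ Set.univ)
    {γ : ι → ι | Function.Involutive γ ∧ (∀ x, γ x ≠ x) ∧ ∀ x, r x (γ x)} (Set.toFinite _)
    ⟨β, hβ, hβ', hβr⟩
  refine ⟨γ, h1, h2, h3, ?_⟩
  intro x y hxy
  by_contra hs
  set s := link α Set.univ ⊔ link γ Set.univ with hs_def
  have hγs : ∀ z, s z (γ z) := fun z => (le_sup_right : link γ Set.univ ≤ s) (link_rel trivial)
  have hyx : γ x ≠ y := fun e => hs (e ▸ hγs x)
  have hne : x ≠ y := fun e => hs (e ▸ s.refl' x)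
  -- `δ` is `γ` with the partners of `x` and `γ y` exchanged: it pairs `x` with `y`, and `γ x` with
  -- `γ y`.
  let σ := Equiv.swap (γ x) y
  let δ : ι → ι := fun z => σ (γ (σ z))
  have hσσ : ∀ z, σ (σ z) = z := fun z => Equiv.swap_apply_self _ _ z
  have hσr : ∀ z, r z (σ z) := by
    intro z
    have hr : r (γ x) y := r.trans' (r.symm' (h3 x)) hxy
    by_cases e1 : z = γ x
    · rw [e1]; simpa [σ] using hr
    · by_cases e2 : z = y
      · rw [e2]; simpa [σ] using r.symm' hr
      · simp only [σ, Equiv.swap_apply_of_ne_of_ne e1 e2]; exact r.refl' z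
  have hδ : δ ∈ {γ : ι → ι | Function.Involutive γ ∧ (∀ x, γ x ≠ x) ∧ ∀ x, r x (γ x)} := by
    refine ⟨fun z => ?_, fun z e => ?_, fun z => ?_⟩
    · simp only [δ, hσσ]; rw [h1, hσσ]
    · have e' := congrArg σ e
      simp only [δ, hσσ] at e'
      exact h2 _ e'
    · exact r.trans' (hσr z) (r.trans' (h3 _) (hσr _))
  have hδx : δ x = y := by
    have : σ x = x := Equiv.swap_apply_of_ne_of_ne (h2 x).symm hne
    simp only [δ, this]; simp [σ]
  let W : Set ι := {z | z ≠ x ∧ z ≠ γ x ∧ z ≠ y ∧ z ≠ γ y}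
  have hδW : ∀ z ∈ W, δ z = γ z := by
    rintro z ⟨e1, e2, e3, e4⟩
    have e5 : σ z = z := Equiv.swap_apply_of_ne_of_ne e2 e3
    simp only [δ, e5]
    refine Equiv.swap_apply_of_ne_of_ne (fun e => e1 (h1.injective e)) fun e => e4 ?_
    rw [← e, h1]
  set s' := link α Set.univ ⊔ link δ Set.univ with hs'
  have hs0 : link α Set.univ ⊔ link γ W ≤ s' := by
    refine sup_le le_sup_left (link_le_iff.2 fun z hz => ?_)
    rw [← hδW z hz]
    exact (le_sup_right : link δ Set.univ ≤ s') (link_rel trivial)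
  -- Neither of the removed edges disconnects its component, so `δ` merges two components of `s`.
  have hxx : s' x (γ x) := by
    refine hs0 (rel_of_removed_edge hα h1 hα' h2 fun z hz => ?_)
    simp only [W, Set.mem_ofPred_eq, not_and_or, not_not] at hz
    rcases hz with e | e | e | e
    · exact Or.inl e
    · exact Or.inr (Or.inl e)
    · exact Or.inr (Or.inr (e ▸ hs))
    · exact Or.inr (Or.inr fun h => hs (s.trans' h (e ▸ s.symm' (hγs y))))
  have hyy : s' y (γ y) := by
    refine hs0 (rel_of_removed_edge hα h1 hα' h2 fun z hz => ?_)
    simp only [W, Set.mem_ofPred_eq, not_and_or, not_not] at hz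
    rcases hz with e | e | e | e
    · exact Or.inr (Or.inr fun h => hs (s.symm' (e ▸ h)))
    · exact Or.inr (Or.inr fun h => hs (s.symm' (s.trans' h (e ▸ s.symm' (hγs x)))))
    · exact Or.inl e
    · exact Or.inr (Or.inl e)
  have hle : s ≤ s' := by
    refine sup_le le_sup_left (link_le_iff.2 fun z _ => ?_)
    by_cases hz : z ∈ W
    · exact hs0 ((le_sup_right : link γ W ≤ _) (link_rel hz))
    · simp only [W, Set.mem_ofPred_eq, not_and_or, not_not] at hz
      rcases hz with rfl | rfl | rfl | rfl
      · exact hxx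
      · rw [h1]; exact s'.symm' hxx
      · exact hyy
      · rw [h1]; exact s'.symm' hyy
  have hxy' : s' x y := by
    have : s' x (δ x) := (le_sup_right : link δ Set.univ ≤ s') (link_rel trivial)
    rwa [hδx] at this
  exact hs (hmax hδ hle hxy')

/-- The sites `x, α x, β (α x), …` met by following `α` and `β` in turns. -/
def altList (α β : ι → ι) : ℕ → ι → List ι
  | 0, _ => []
  | n + 1, x => x :: α x :: altList α β n (β (α x))

lemma evenPairs_altList {α β : ι → ι} : ∀ (n : ℕ) (x : ι), ∀ p ∈ evenPairs (altList α β n x),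
    p.2 = α p.1
  | 0, _, p, hp => by simp [altList, evenPairs] at hp
  | n + 1, x, p, hp => by
    rcases List.mem_cons.1 hp with rfl | hp
    · rfl
    · exact evenPairs_altList n _ p hp

lemma oddPairs_altList {α β : ι → ι} : ∀ (n : ℕ) (x : ι), ∀ p ∈ oddPairs (altList α β n x),
    p.2 = β p.1
  | 0, _, p, hp => by simp [altList, evenPairs, oddPairs] at hp
  | 1, x, p, hp => by simp [altList, evenPairs, oddPairs] at hp
  | n + 2, x, p, hp => by
    rcases List.mem_cons.1 hp with rfl | hp
    · rfl
    · exact oddPairs_altList (n + 1) _ p hp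

lemma mem_altList {α β : ι → ι} {y : ι} : ∀ (n : ℕ) (x : ι), y ∈ altList α β n x ↔
    ∃ k < n, y = (fun z => β (α z))^[k] x ∨ y = α ((fun z => β (α z))^[k] x)
  | 0, _ => by simp [altList]
  | n + 1, x => by
    rw [altList, List.mem_cons, List.mem_cons, mem_altList n]
    constructor
    · rintro (h | h | ⟨k, hk, h⟩)
      · exact ⟨0, by omega, Or.inl h⟩
      · exact ⟨0, by omega, Or.inr h⟩
      · exact ⟨k + 1, by omega, by simpa only [Function.iterate_succ_apply] using h⟩
    · rintro ⟨k, hk, h⟩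
      cases k with
      | zero => exact h.imp_right Or.inl
      | succ k =>
        exact Or.inr (Or.inr ⟨k, by omega, by simpa only [Function.iterate_succ_apply] using h⟩)

/-- Following `β ∘ α` from `z` never leads to `α z`. -/
lemma iterate_ne_of_involutive {α β : ι → ι} (hα : Function.Involutive α)
    (hβ : Function.Involutive β) (hα' : ∀ x, α x ≠ x) (hβ' : ∀ x, β x ≠ x) :
    ∀ (m : ℕ) (z : ι), (fun z => β (α z))^[m] z ≠ α z
  | 0, z => (hα' z).symm
  | 1, z => hβ' (α z)
  | m + 2, z => by
    intro h
    refine iterate_ne_of_involutive hα hβ hα' hβ' m (β (α z)) ?_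
    rw [Function.iterate_succ_apply', Function.iterate_succ_apply] at h
    change β (α ((fun z => β (α z))^[m] (β (α z)))) = α z at h
    have h2 := congrArg (fun z => α (β z)) h
    simp only [hβ _, hα _] at h2
    exact h2

lemma altList_nodup {α β : ι → ι} (hα : Function.Involutive α)
    (hβ : Function.Involutive β) (hα' : ∀ x, α x ≠ x) (hβ' : ∀ x, β x ≠ x) :
    ∀ (n : ℕ) (x : ι), (∀ k < n, 0 < k → (fun z => β (α z))^[k] x ≠ x) →
      (altList α β n x).Nodup
  | 0, _, _ => List.nodup_nil
  | n + 1, x, h => by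
    have hπ : Function.Injective fun z => β (α z) := hβ.injective.comp hα.injective
    have hne := iterate_ne_of_involutive hα hβ hα' hβ'
    have hx : ∀ k < n, (fun z => β (α z))^[k] (β (α x)) ≠ x := fun k hk e =>
      h (k + 1) (by omega) (by omega) (by rwa [Function.iterate_succ_apply])
    have hax : ∀ k, (fun z => β (α z))^[k] (β (α x)) ≠ α x := fun k e =>
      hne (k + 1) x (by rwa [Function.iterate_succ_apply])
    rw [altList, List.nodup_cons, List.nodup_cons, List.mem_cons, mem_altList, mem_altList]
    refine ⟨?_, ?_, altList_nodup hα hβ hα' hβ' n _ fun k hk hk0 e => ?_⟩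
    · rintro (e | ⟨k, hk, e | e⟩)
      · exact hα' x e.symm
      · exact hx k hk e.symm
      · exact hax k (hα.injective (by rw [hα]; exact e.symm))
    · rintro ⟨k, hk, e | e⟩
      · exact hax k e.symm
      · exact hx k hk (hα.injective e).symm
    · exact h k (by omega) hk0 (hπ ((Function.iterate_succ_apply' _ k x).symm.trans
        ((Function.iterate_succ_apply _ k x).trans e)))

/-- A component of the union of two perfect matchings is an alternating cycle. -/
lemma exists_altList [Finite ι] {α β : ι → ι} (hα : Function.Involutive α)
    (hβ : Function.Involutive β) (hα' : ∀ x, α x ≠ x) (hβ' : ∀ x, β x ≠ x) (x : ι) :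
    ∃ n, 0 < n ∧ (altList α β n x).Nodup ∧
      ∀ y, y ∈ altList α β n x ↔ (link α Set.univ ⊔ link β Set.univ) x y := by
  have hπ : Function.Injective fun z => β (α z) := hβ.injective.comp hα.injective
  set π := fun z => β (α z) with hπ_def
  have hper : x ∈ Function.periodicPts π := hπ.mem_periodicPts x
  have hn : 0 < Function.minimalPeriod π x := Function.minimalPeriod_pos_of_mem_periodicPts hper
  have hmod : ∀ k, ∃ j < Function.minimalPeriod π x, π^[k] x = π^[j] x := fun k =>
    ⟨k % Function.minimalPeriod π x, Nat.mod_lt _ hn, Function.iterate_mod_minimalPeriod_eq.symm⟩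
  have hmem : ∀ y, y ∈ altList α β (Function.minimalPeriod π x) x ↔
      ∃ k, y = π^[k] x ∨ y = α (π^[k] x) := by
    intro y
    rw [mem_altList]
    constructor
    · rintro ⟨k, -, h⟩; exact ⟨k, h⟩
    · rintro ⟨k, h⟩
      obtain ⟨j, hj, e⟩ := hmod k
      exact ⟨j, hj, by rwa [e] at h⟩
  refine ⟨Function.minimalPeriod π x, hn, ?_, mem_iff_of_saturated (z := x)
    ((hmem x).2 ⟨0, Or.inl rfl⟩) ?_ ?_ ?_ (Setoid.refl' _ x)⟩
  · refine altList_nodup hα hβ hα' hβ' _ x fun k hk hk0 e => ?_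
    exact Function.not_isPeriodicPt_of_pos_of_lt_minimalPeriod hk0.ne' hk e
  · rw [link_le_iff]
    intro y _
    rw [memSetoid_iff]
    have h : ∀ y, y ∈ altList α β (Function.minimalPeriod π x) x →
        α y ∈ altList α β (Function.minimalPeriod π x) x := by
      intro y hy
      rw [hmem] at hy ⊢
      obtain ⟨k, rfl | rfl⟩ := hy
      · exact ⟨k, Or.inr rfl⟩
      · exact ⟨k, Or.inl (hα _)⟩
    exact ⟨h y, fun hy => by simpa [hα y] using h _ hy⟩
  · rw [link_le_iff]
    intro y _
    rw [memSetoid_iff]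
    have h : ∀ y, y ∈ altList α β (Function.minimalPeriod π x) x →
        β y ∈ altList α β (Function.minimalPeriod π x) x := by
      intro y hy
      rw [hmem] at hy ⊢
      obtain ⟨k, rfl | rfl⟩ := hy
      · refine ⟨k + Function.minimalPeriod π x - 1, Or.inr ?_⟩
        have e : π^[k] x = π (π^[k + Function.minimalPeriod π x - 1] x) := by
          rw [← Function.iterate_succ_apply' (f := π), Nat.succ_eq_add_one,
            Nat.sub_add_cancel (by omega), Function.iterate_add_minimalPeriod_eq]
        rw [e]
        exact hβ _
      · exact ⟨k + 1, Or.inl (by rw [Function.iterate_succ_apply'])⟩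
    exact ⟨h y, fun hy => by simpa [hβ y] using h _ hy⟩
  · intro y hy
    set s := link α Set.univ ⊔ link β Set.univ with hs
    have hαs : ∀ z, s z (α z) := fun z => (le_sup_left : link α Set.univ ≤ s) (link_rel trivial)
    have hβs : ∀ z, s z (β z) := fun z => (le_sup_right : link β Set.univ ≤ s) (link_rel trivial)
    have hk : ∀ k, s x (π^[k] x) := by
      intro k
      induction k with
      | zero => exact s.refl' x
      | succ k ih =>
        rw [Function.iterate_succ_apply']
        exact s.trans' ih (s.trans' (hαs _) (hβs _))
    rw [hmem] at hy
    obtain ⟨k, rfl | rfl⟩ := hy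
    · exact hk k
    · exact s.trans' (hk k) (hαs _)

/-- Every component of a perfect matching `α` and a relation containing a perfect matching has an
Eulerian circuit: a list of its sites which alternates between pairs of `α` and related pairs. -/
lemma exists_euler_circuit [Finite ι] {α β : ι → ι} {r : Setoid ι} (hα : Function.Involutive α)
    (hβ : Function.Involutive β) (hα' : ∀ x, α x ≠ x) (hβ' : ∀ x, β x ≠ x) (hβr : ∀ x, r x (β x))
    (x : ι) : ∃ l : List ι, (x :: l).Nodup ∧ (∀ p ∈ evenPairs (x :: l), p.2 = α p.1) ∧
      (∀ p ∈ oddPairs (x :: l), r p.1 p.2) ∧ ∀ y, y ∈ x :: l ↔ (link α Set.univ ⊔ r) x y := by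
  obtain ⟨γ, h1, h2, h3, h4⟩ := exists_matching_spanning hα hβ hα' hβ' hβr
  obtain ⟨n, hn, h5, h6⟩ := exists_altList hα h1 hα' h2 x
  have e : link α Set.univ ⊔ link γ Set.univ = link α Set.univ ⊔ r :=
    le_antisymm (sup_le_sup le_rfl (link_le_iff.2 fun z _ => h3 z)) (sup_le le_sup_left h4)
  rw [e] at h6
  have h7 := evenPairs_altList (α := α) (β := γ) n x
  have h8 := oddPairs_altList (α := α) (β := γ) n x
  obtain ⟨n, rfl⟩ := Nat.exists_eq_succ_of_ne_zero hn.ne'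
  exact ⟨_, h5, h7, fun p hp => by rw [h8 p hp]; exact h3 _, h6⟩

lemma evenPairs_map {κ : Type*} (f : ι → κ) : ∀ l : List ι,
    evenPairs (l.map f) = (evenPairs l).map (Prod.map f f)
  | [] => rfl
  | [_] => rfl
  | _ :: _ :: l => congrArg _ (evenPairs_map f l)

end Matchings

section MatchingGap

variable {ι E : Type*} [NormedAddCommGroup E] [InnerProductSpace ℂ E] [FiniteDimensional ℂ E]
  (P : PairSystem ι E)

/-- The gap of two layers both of which leave out at most one site. For an odd number of sites, a
phantom site is paired with the unpaired sites of both layers; the Eulerian circuit through the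
phantom site is then cut open there. -/
theorem PairSystem.f_le_gap₂_matching [Finite ι] {α β : ι → ι} {r : Setoid ι}
    (hα : Function.Involutive α) (hβ : Function.Involutive β)
    (hα' : ∀ x y, α x = x → α y = y → x = y) (hβ' : ∀ x y, β x = x → β y = y → x = y)
    (hβr : ∀ x, r x (β x)) : P.f ≤ P.gap₂ (link α Set.univ) r := by
  classical
  -- A saturated set that contains the unpaired site of a matching has odd cardinality.
  have hodd : ∀ {γ : ι → ι}, Function.Involutive γ → (∀ x y, γ x = x → γ y = y → x = y) →
      ∀ v, γ v = v → ∀ K : Set ι, v ∈ K → (∀ z ∈ K, γ z ∈ K) → ¬ Even K.ncard := by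
    intro γ hγ hγ' v hv K hvK hK h
    have h2 : Even (K \ {v}).ncard := by
      refine even_ncard_of_involutive hγ ?_ ?_
      · rintro z ⟨hz, hzv⟩
        exact ⟨hK z hz, fun e : γ z = v => hzv (by rw [← hγ z, e, hv]; rfl)⟩
      · rintro z ⟨hz, hzv⟩ e
        exact hzv (hγ' z v e hv)
    rw [← Set.ncard_sdiff_singleton_add_one hvK, Nat.even_add_one] at h
    exact h h2
  have heven : ∀ {γ : ι → ι}, Function.Involutive γ → (∀ x, γ x ≠ x) →
      Even (Set.univ : Set ι).ncard := fun hγ h =>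
    even_ncard_of_involutive hγ (fun _ _ => trivial) fun x _ => h x
  by_cases hα0 : ∃ v, α v = v
  · obtain ⟨v₀, hv₀⟩ := hα0
    obtain ⟨v₁, hv₁⟩ : ∃ v, β v = v := by
      by_contra h
      push Not at h
      exact hodd hα hα' v₀ hv₀ Set.univ trivial (fun _ _ => trivial) (heven hβ h)
    set s := link α Set.univ ⊔ r with hs
    have hαs : ∀ z, s z (α z) := fun z => (le_sup_left : link α Set.univ ≤ s) (link_rel trivial)
    have hβs : ∀ z, s z (β z) := fun z => (le_sup_right : r ≤ s) (hβr z)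
    -- the unpaired sites belong to the same component
    have hv : s v₁ v₀ := by
      by_contra h
      refine hodd hβ hβ' v₁ hv₁ {z | s v₁ z} (s.refl' _) (fun z hz => s.trans' hz (hβs z)) ?_
      refine even_ncard_of_involutive hα (fun z hz => s.trans' hz (hαs z)) fun z hz e => h ?_
      rwa [hα' v₀ z hv₀ e]
    -- The extension of a matching to the sites and a phantom site `none`, which becomes the partner of
    -- the unpaired site.
    let ext : (ι → ι) → ι → Option ι → Option ι := fun γ v z =>
      z.elim (some v) fun y => if γ y = y then none else some (γ y)
    have hext : ∀ γ v, Function.Involutive γ → (∀ x y, γ x = x → γ y = y → x = y) → γ v = v →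
        Function.Involutive (ext γ v) ∧ ∀ z, ext γ v z ≠ z := by
      intro γ v hγ hγ' hv
      refine ⟨fun z => ?_, fun z => ?_⟩
      · cases z with
        | none => simp [ext, hv]
        | some y =>
          by_cases h : γ y = y
          · simp [ext, h, hγ' v y hv h]
          · have h' : γ (γ y) ≠ γ y := fun e => h (hγ.injective e)
            simp only [ext, Option.elim_some, if_neg h, if_neg h']
            rw [hγ]
      · cases z with
        | none => simp [ext]
        | some y =>
          by_cases h : γ y = y
          · simp [ext, h]
          · simp only [ext, Option.elim_some, if_neg h]
            exact fun e => h (Option.some_injective _ e)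
    obtain ⟨hα1, hα2⟩ := hext α v₀ hα hα' hv₀
    obtain ⟨hβ1, hβ2⟩ := hext β v₁ hβ hβ' hv₁
    -- The phantom site is related to the site `v₁` that is unpaired in the second matching.
    let r' : Setoid (Option ι) := Setoid.comap (fun z => z.getD v₁) r
    have hr' : ∀ z, r' z (ext β v₁ z) := by
      intro z
      change r (z.getD v₁) ((ext β v₁ z).getD v₁)
      cases z with
      | none => exact r.refl' v₁
      | some y =>
        by_cases h : β y = y
        · simp only [ext, Option.elim_some, if_pos h]
          rw [hβ' v₁ y hv₁ h]; exact r.refl' _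
        · simp only [ext, Option.elim_some, if_neg h]
          exact hβr y
    set s' := link (ext α v₀) Set.univ ⊔ r' with hs'
    have hle1 : s' ≤ Setoid.comap (fun z => z.getD v₁) s := by
      refine sup_le (link_le_iff.2 fun z _ => ?_) fun z w h => (le_sup_right : r ≤ s) h
      change s (z.getD v₁) ((ext α v₀ z).getD v₁)
      cases z with
      | none => exact hv
      | some y =>
        by_cases h : α y = y
        · simp only [ext, Option.elim_some, if_pos h]
          rw [← hα' v₀ y hv₀ h]; exact s.symm' hv
        · simp only [ext, Option.elim_some, if_neg h]
          exact hαs y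
    have hle2 : s ≤ Setoid.comap some s' := by
      refine sup_le (link_le_iff.2 fun y _ => ?_) fun z w h => (le_sup_right : r' ≤ s') h
      change s' (some y) (some (α y))
      by_cases h : α y = y
      · rw [h]
      · have := (le_sup_left : link (ext α v₀) Set.univ ≤ s')
          (link_rel (a := ext α v₀) (b := some y) trivial)
        simpa only [ext, Option.elim_some, if_neg h] using this
    have hss : ∀ x y, s' (some x) (some y) ↔ s x y := fun x y =>
      ⟨fun h => hle1 h, fun h => hle2 h⟩
    refine P.le_gap₂_of_goodList fun x => ?_
    have hsome : ∀ L : List (Option ι), none ∉ L → ∃ l : List ι, l.map some = L := by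
      intro L hL
      refine ⟨L.map fun z => z.getD v₁, ?_⟩
      rw [List.map_map]
      refine (List.map_congr_left fun z hz => ?_).trans (List.map_id L)
      cases z with
      | none => exact absurd hz hL
      | some y => rfl
    have hpair : ∀ {l : List ι} {p : ι × ι}, p ∈ evenPairs l →
        (some p.1, some p.2) ∈ evenPairs (l.map some) := by
      intro l p hp
      rw [evenPairs_map]
      exact List.mem_map.2 ⟨p, hp, rfl⟩
    have hpair' : ∀ {l : List ι} {p : ι × ι}, p ∈ oddPairs l →
        (some p.1, some p.2) ∈ oddPairs (l.map some) := by
      intro l p hp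
      rw [oddPairs, ← List.map_tail]
      exact hpair hp
    have hlink : ∀ y z, some z = ext α v₀ (some y) → link α Set.univ y z := by
      intro y z h
      by_cases hy : α y = y
      · simp [ext, hy] at h
      · simp only [ext, Option.elim_some, if_neg hy, Option.some.injEq] at h
        rw [h]; exact link_rel trivial
    -- In the component of the phantom site, the circuit is started there, and the phantom site is then
    -- removed from the list.
    by_cases hx : s' (some x) none
    · obtain ⟨L, h1, h2, h3, h4⟩ := exists_euler_circuit hα1 hβ1 hα2 hβ2 hr' none
      rw [List.nodup_cons] at h1
      obtain ⟨l, rfl⟩ := hsome L h1.1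
      refine ⟨l, h1.2.of_map, Or.inl ⟨fun p hp => h3 _ (hpair hp), fun p hp => Or.inl ?_⟩,
        fun y => ?_⟩
      · refine hlink _ _ (h2 (some p.1, some p.2) ?_)
        have hp' := hpair' hp
        cases l with
        | nil => simp [oddPairs, evenPairs] at hp
        | cons z l => exact List.mem_cons_of_mem _ hp'
      · rw [← hss]
        have h5 := h4 (some y)
        rw [List.mem_cons] at h5
        constructor
        · exact fun hy => s'.trans' hx (h5.1 (Or.inr (List.mem_map_of_mem hy)))
        · intro hy
          obtain ⟨z, hz, e⟩ := List.mem_map.1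
            ((h5.2 (s'.trans' (s'.symm' hx) hy)).resolve_left (by simp))
          rwa [← Option.some_injective _ e]
    · obtain ⟨L, h1, h2, h3, h4⟩ := exists_euler_circuit hα1 hβ1 hα2 hβ2 hr' (some x)
      have hL : none ∉ some x :: L := fun h => hx ((h4 none).1 h)
      obtain ⟨l, hl⟩ := hsome _ hL
      rw [← hl] at h1 h2 h3 h4
      refine ⟨l, h1.of_map, Or.inr ⟨fun p hp => h3 _ (hpair' hp), fun p hp => Or.inl ?_⟩,
        fun y => ?_⟩
      · exact hlink _ _ (h2 _ (hpair hp))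
      · rw [← hss, ← h4]
        simp
  · push Not at hα0
    have hβ0 : ∀ x, β x ≠ x := fun x hx =>
      hodd hβ hβ' x hx Set.univ trivial (fun _ _ => trivial) (heven hα hα0)
    refine P.le_gap₂_of_goodList fun x => ?_
    obtain ⟨l, h1, h2, h3, h4⟩ := exists_euler_circuit hα hβ hα0 hβ0 hβr x
    exact ⟨x :: l, h1, Or.inr ⟨h3, fun p hp => Or.inl (by rw [h2 p hp]; exact link_rel trivial)⟩,
      h4⟩

end MatchingGap

end

end RandomCircuit

namespace RandomCircuit

noncomputable section

/-! ### Products of layers and blocks -/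

section Layers

variable {ι E : Type*} [NormedAddCommGroup E] [InnerProductSpace ℂ E] [FiniteDimensional ℂ E]

/-- The product `A (s + n - 1) * ⋯ * A (s + 1) * A s` of `n` consecutive layers. -/
def opProd (A : ℕ → E →L[ℂ] E) (s : ℕ) : ℕ → E →L[ℂ] E
  | 0 => 1
  | n + 1 => A (s + n) * opProd A s n

/-- The join of the relations of `n` consecutive layers. -/
def relSup (q : ℕ → Setoid ι) (s : ℕ) : ℕ → Setoid ι
  | 0 => ⊥
  | n + 1 => q (s + n) ⊔ relSup q s n

lemma le_relSup (q : ℕ → Setoid ι) (s : ℕ) : ∀ {n j : ℕ}, j < n → q (s + j) ≤ relSup q s n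
  | 0, _, h => by omega
  | n + 1, j, h => by
    rcases Nat.lt_succ_iff_lt_or_eq.1 h with h | rfl
    · exact (le_relSup q s h).trans le_sup_right
    · exact le_sup_left

omit [FiniteDimensional ℂ E] in
lemma opProd_add (A : ℕ → E →L[ℂ] E) (s m : ℕ) : ∀ n,
    opProd A s (m + n) = opProd A (s + m) n * opProd A s m
  | 0 => (one_mul _).symm
  | n + 1 => by
    change A (s + (m + n)) * opProd A s (m + n) = A (s + m + n) * opProd A (s + m) n * opProd A s m
    rw [opProd_add A s m n, ← add_assoc, mul_assoc]

variable (P : PairSystem ι E) {A : ℕ → E →L[ℂ] E} {q : ℕ → Setoid ι}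

lemma norm_opProd_le (hA : ∀ k, ‖A k‖ ≤ 1) (s : ℕ) : ∀ n, ‖opProd A s n‖ ≤ 1
  | 0 => by
    change ‖(1 : E →L[ℂ] E)‖ ≤ 1
    exact ContinuousLinearMap.norm_id_le
  | n + 1 => (norm_mul_le _ _).trans (mul_le_one₀ (hA _) (norm_nonneg _) (norm_opProd_le hA s n))

lemma PairSystem.opProd_mul_proj (hA : ∀ k, A k * P.proj (q k) = P.proj (q k)) {s : ℕ}
    {r : Setoid ι} : ∀ {n : ℕ}, (∀ j < n, q (s + j) ≤ r) → opProd A s n * P.proj r = P.proj r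
  | 0, _ => one_mul _
  | n + 1, h => by
    change A (s + n) * opProd A s n * P.proj r = P.proj r
    rw [mul_assoc, PairSystem.opProd_mul_proj hA fun j hj => h j (by omega),
      ← P.proj_mul_of_ge (h n (by omega)), ← mul_assoc, hA]

lemma PairSystem.proj_mul_opProd (hA : ∀ k, P.proj (q k) * A k = P.proj (q k)) {s : ℕ}
    {r : Setoid ι} : ∀ {n : ℕ}, (∀ j < n, q (s + j) ≤ r) → P.proj r * opProd A s n = P.proj r
  | 0, _ => mul_one _
  | n + 1, h => by
    change P.proj r * (A (s + n) * opProd A s n) = P.proj r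
    have e : P.proj r * A (s + n) = P.proj r := by
      rw [← P.proj_mul_of_le (h n (by omega)), mul_assoc, hA]
    rw [← mul_assoc, e, PairSystem.proj_mul_opProd hA fun j hj => h j (by omega)]

/-- The gap of a block: every layer costs a factor `Δ` for passing from its gates to Haar random
gates, and, except for the first layer, a factor `F` for merging it with the previous layers. -/
theorem PairSystem.norm_opProd_sub_proj_le (hA : ∀ k, ‖A k‖ ≤ 1)
    (hA₁ : ∀ k, A k * P.proj (q k) = P.proj (q k)) (hA₂ : ∀ k, P.proj (q k) * A k = P.proj (q k))
    {s l : ℕ} {Δ F : ℝ} (hΔ : 0 ≤ Δ) (hF : 0 ≤ F)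
    (h1 : ∀ j < l, ‖A (s + j) - P.proj (q (s + j))‖ ≤ 1 - Δ)
    (h2 : ∀ j < l, 0 < j → F ≤ P.gap₂ (q (s + j)) (relSup q s j)) :
    ∀ n < l, ‖opProd A s (n + 1) - P.proj (relSup q s (n + 1))‖ ≤ 1 - Δ ^ (n + 1) * F ^ n := by
  intro n
  induction n with
  | zero =>
    intro hl
    change ‖A (s + 0) * 1 - P.proj (q (s + 0) ⊔ ⊥)‖ ≤ _
    rw [mul_one, sup_bot_eq]
    simpa using h1 0 hl
  | succ n ih =>
    intro hl
    have hle : ∀ j < n + 1, q (s + j) ≤ relSup q s (n + 1) := fun j hj => le_relSup q s hj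
    have step : ‖P.proj (q (s + (n + 1))) * opProd A s (n + 1)
        - P.proj (relSup q s (n + 2))‖ ≤ 1 - Δ ^ (n + 1) * F ^ n * F :=
      norm_mul_sub_pr_le (K := invSpace P.V (relSup q s (n + 1)))
        (P.inv_anti le_sup_right) (P.opProd_mul_proj hA₁ hle) (P.proj_mul_opProd hA₂ hle)
        (P.norm_proj_le _) (P.proj_mul_of_ge le_sup_left) (by positivity) (ih (by omega))
        (by
          have := h2 (n + 1) hl (by omega)
          rw [gap₂] at this
          change ‖P.proj (q (s + (n + 1))) * P.proj (relSup q s (n + 1))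
            - P.proj (q (s + (n + 1)) ⊔ relSup q s (n + 1))‖ ≤ 1 - F
          linarith)
    have step' := norm_mul_sub_pr_le' (A := A (s + (n + 1))) (T := opProd A s (n + 1))
      (K := invSpace P.V (q (s + (n + 1)))) (W := invSpace P.V (relSup q s (n + 2)))
      (P.inv_anti le_sup_left) (hA₁ _) (hA₂ _) (norm_opProd_le hA s _)
      (P.proj_mul_opProd hA₂ fun j hj => (hle j hj).trans le_sup_right) hΔ (h1 _ hl) step
    refine step'.trans (le_of_eq ?_)
    ring

/-- The distances of consecutive blocks to the global projection multiply, and incomplete blocks do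
no harm. -/
theorem PairSystem.norm_opProd_sub_proj_top_le (hA : ∀ k, ‖A k‖ ≤ 1)
    (hA₁ : ∀ k, A k * P.proj (q k) = P.proj (q k)) (hA₂ : ∀ k, P.proj (q k) * A k = P.proj (q k))
    {l : ℕ} {c : ℕ → ℝ} (h : ∀ i, ‖opProd A (l * i) l - P.proj ⊤‖ ≤ c i) (L : ℕ) :
    ‖opProd A 0 L - P.proj ⊤‖ ≤ ∏ i ∈ Finset.range (L / l), c i := by
  have htop : ∀ s n, opProd A s n * P.proj ⊤ = P.proj ⊤ := fun s n =>
    P.opProd_mul_proj hA₁ fun j _ => le_top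
  have htop' : ∀ s n, P.proj ⊤ * opProd A s n = P.proj ⊤ := fun s n =>
    P.proj_mul_opProd hA₂ fun j _ => le_top
  have hblocks : ∀ K, ‖opProd A 0 (l * K) - P.proj ⊤‖ ≤ ∏ i ∈ Finset.range K, c i := by
    intro K
    induction K with
    | zero =>
      change ‖1 - P.proj ⊤‖ ≤ _
      rw [Finset.range_zero, Finset.prod_empty]
      exact norm_one_sub_pr_le _
    | succ K ih =>
      have e : opProd A 0 (l * (K + 1)) - P.proj ⊤
          = (opProd A (l * K) l - P.proj ⊤) * (opProd A 0 (l * K) - P.proj ⊤) := by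
        rw [mul_add, mul_one, opProd_add, zero_add, mul_sub, sub_mul, sub_mul, htop, htop',
          P.proj_mul_of_ge le_rfl, sub_self, sub_zero]
      rw [e, Finset.prod_range_succ, mul_comm (∏ _ ∈ _, _)]
      exact (norm_mul_le _ _).trans (mul_le_mul (h K) ih (norm_nonneg _)
        ((norm_nonneg _).trans (h K)))
  have e : opProd A 0 L - P.proj ⊤
      = opProd A (l * (L / l)) (L % l) * (opProd A 0 (l * (L / l)) - P.proj ⊤) := by
    conv_lhs => rw [← Nat.div_add_mod L l]
    rw [opProd_add, zero_add, mul_sub, htop]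
  rw [e]
  exact (norm_mul_le _ _).trans ((mul_le_of_le_one_left (norm_nonneg _)
    (norm_opProd_le hA _ _)).trans (hblocks _))

end Layers

/-! ### Numerical estimates -/

section Numerics

/-- A power mean inequality for the averaged gap. -/
lemma mul_pow_le_sum_pow {K l : ℕ} (hl : 1 ≤ l) {Δ : ℕ → ℝ} (hΔ : ∀ i, 0 ≤ Δ i) {D : ℝ}
    (hD : 0 ≤ D) (h : K * D ≤ ∑ i ∈ Finset.range K, Δ i) :
    K * D ^ l ≤ ∑ i ∈ Finset.range K, Δ i ^ l := by
  rcases Nat.eq_zero_or_pos K with rfl | hK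
  · simp
  obtain ⟨m, rfl⟩ := Nat.exists_eq_add_of_le' hl
  have hK' : (0 : ℝ) < K := by exact_mod_cast hK
  have h2 : (∑ i ∈ Finset.range K, Δ i) ^ (m + 1) / (K : ℝ) ^ m
      ≤ ∑ i ∈ Finset.range K, Δ i ^ (m + 1) := by
    have := pow_sum_div_card_le_sum_pow (s := Finset.range K) (f := Δ) (fun i _ => hΔ i) m
    simpa using this
  refine le_trans ?_ h2
  rw [le_div_iff₀ (by positivity)]
  calc (K : ℝ) * D ^ (m + 1) * K ^ m = (K * D) ^ (m + 1) := by ring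
    _ ≤ _ := by gcongr

/-- The product of the distances of the blocks for a depth that is a multiple of the block length. -/
lemma prod_le_exp_neg {K : ℕ} {g : ℕ → ℝ} (hg1 : ∀ i, g i ≤ 1) :
    ∏ i ∈ Finset.range K, (1 - g i) ≤ Real.exp (-∑ i ∈ Finset.range K, g i) := by
  rw [← Finset.sum_neg_distrib, Real.exp_sum]
  refine Finset.prod_le_prod (fun i _ => by linarith [hg1 i]) fun i _ => ?_
  have := Real.add_one_le_exp (-g i)
  linarith

/-- A product of numbers `1 - g i` is at most the power of the mean. -/
lemma prod_le_pow_of_mean {K : ℕ} {g : ℕ → ℝ} (hg1 : ∀ i, g i ≤ 1) {γ : ℝ} (hγ1 : γ ≤ 1)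
    (h : K * γ ≤ ∑ i ∈ Finset.range K, g i) :
    ∏ i ∈ Finset.range K, (1 - g i) ≤ (1 - γ) ^ K := by
  rcases Nat.eq_zero_or_pos K with rfl | hK
  · simp
  rcases hγ1.eq_or_lt with rfl | hγ
  · obtain ⟨i, hi, hi1⟩ : ∃ i ∈ Finset.range K, 1 ≤ g i := by
      refine Finset.exists_le_of_sum_le (by simpa using hK.ne') ?_
      simpa using h
    rw [Finset.prod_eq_zero hi (by linarith [hg1 i]), sub_self, zero_pow hK.ne']
  have hpos : 0 < 1 - γ := by linarith
  -- compare `1 - x` with its tangent exponential at `γ`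
  have h1 : ∀ i ∈ Finset.range K, 1 - g i ≤ (1 - γ) * Real.exp (-(g i - γ) / (1 - γ)) := by
    intro i _
    have h2 := Real.add_one_le_exp (-(g i - γ) / (1 - γ))
    have h3 : (1 - γ) * (-(g i - γ) / (1 - γ) + 1) = 1 - g i := by field_simp; ring
    rw [← h3]
    gcongr
  refine (Finset.prod_le_prod (fun i _ => by linarith [hg1 i]) h1).trans ?_
  rw [Finset.prod_mul_distrib, ← Real.exp_sum, Finset.prod_const, Finset.card_range]
  refine mul_le_of_le_one_right (by positivity) (Real.exp_le_one_iff.2 ?_)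
  rw [← Finset.sum_div, Finset.sum_neg_distrib, Finset.sum_sub_distrib, Finset.sum_const,
    Finset.card_range, nsmul_eq_mul]
  exact div_nonpos_of_nonpos_of_nonneg (by linarith) hpos.le

/-- If `K + 1 ≥ Y / γ` and `Y ≥ 2`, then losing an incomplete block is compensated by the difference
between `-log (1 - γ)` and `γ`. -/
lemma pow_le_exp_neg {K : ℕ} {γ Y : ℝ} (hγ0 : 0 < γ) (hγ1 : γ ≤ 1) (hY : 2 ≤ Y)
    (h : Y ≤ (K + 1) * γ) : (1 - γ) ^ K ≤ Real.exp (-Y) := by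
  have hK : 0 < K := by
    rcases Nat.eq_zero_or_pos K with rfl | hK
    · norm_num at h; linarith
    · exact hK
  rcases hγ1.eq_or_lt with rfl | hγ
  · rw [sub_self, zero_pow hK.ne']; positivity
  have hpos : 0 < 1 - γ := by linarith
  have h1 := Real.le_log_one_add_of_nonneg (x := γ / (1 - γ)) (by positivity)
  have e1 : 1 + γ / (1 - γ) = (1 - γ)⁻¹ := by field_simp; ring
  have e2 : 2 * (γ / (1 - γ)) / (γ / (1 - γ) + 2) = 2 * γ / (2 - γ) := by
    have : γ / (1 - γ) + 2 ≠ 0 := by positivity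
    have : 2 - γ ≠ 0 := by linarith
    field_simp
    ring
  rw [e1, e2, Real.log_inv] at h1
  rw [← Real.exp_log hpos, ← Real.exp_nat_mul]
  apply Real.exp_le_exp.2
  have h2 : Y ≤ K * (2 * γ / (2 - γ)) := by
    rw [← mul_div_assoc, le_div_iff₀ (by linarith)]
    nlinarith
  have h3 : (0 : ℝ) ≤ K := by positivity
  nlinarith

end Numerics

end

end RandomCircuit

namespace RandomCircuit

noncomputable section

/-! ### Tensor powers -/

section Tensor

variable {X : Type*} [Fintype X] [DecidableEq X]

/-- The matrix of `A^{⊗t}`. -/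
def tens (t : ℕ) (A : Matrix X X ℂ) : Matrix (Fin t → X) (Fin t → X) ℂ :=
  Matrix.of fun x y => ∏ a, A (x a) (y a)

omit [Fintype X] in
lemma tens_one (t : ℕ) : tens t (1 : Matrix X X ℂ) = 1 := by
  ext x y
  simp only [tens, Matrix.of_apply, Matrix.one_apply, Finset.prod_ite_zero, Finset.prod_const_one,
    Finset.mem_univ, true_imp_iff, funext_iff]

omit [DecidableEq X] in
lemma tens_mul (t : ℕ) (A B : Matrix X X ℂ) : tens t (A * B) = tens t A * tens t B := by
  ext x y
  simp only [tens, Matrix.of_apply, Matrix.mul_apply, Finset.prod_univ_sum,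
    Fintype.piFinset_univ, Finset.prod_mul_distrib]

omit [Fintype X] [DecidableEq X] in
lemma tens_conjTranspose (t : ℕ) (A : Matrix X X ℂ) : tens t Aᴴ = (tens t A)ᴴ := by
  ext x y
  simp [tens, Matrix.conjTranspose_apply]

omit [Fintype X] [DecidableEq X] in
lemma tens_smul (t : ℕ) (c : ℂ) (A : Matrix X X ℂ) : tens t (c • A) = c ^ t • tens t A := by
  ext x y
  simp [tens, Finset.prod_mul_distrib]

omit [Fintype X] [DecidableEq X] in
lemma tensorPower_eq (t : ℕ) (A : Matrix X X ℂ) :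
    tensorPower t A = tens t A ⊗ₖ (tens t A).map star := by
  ext x y
  simp [tens, tensorPower, Matrix.kroneckerMap_apply]

omit [Fintype X] in
lemma tensorPower_one (t : ℕ) : tensorPower t (1 : Matrix X X ℂ) = 1 := by
  rw [tensorPower_eq, tens_one, Matrix.map_one _ (star_zero _) (star_one _), one_kronecker_one]

omit [DecidableEq X] in
lemma tensorPower_mul (t : ℕ) (A B : Matrix X X ℂ) :
    tensorPower t (A * B) = tensorPower t A * tensorPower t B := by
  rw [tensorPower_eq, tensorPower_eq, tensorPower_eq, tens_mul, ← mul_kronecker_mul]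
  congr 1
  exact Matrix.map_mul (f := starRingEnd ℂ)

omit [Fintype X] [DecidableEq X] in
lemma tensorPower_conjTranspose (t : ℕ) (A : Matrix X X ℂ) :
    tensorPower t Aᴴ = (tensorPower t A)ᴴ := by
  ext x y
  simp [tensorPower, Matrix.conjTranspose_apply]

/-- The representation space of `U^{⊗t} ⊗ (U^*)^{⊗t}`. -/
abbrev RepSpace (t : ℕ) (X : Type*) [Fintype X] : Type _ :=
  EuclideanSpace ℂ ((Fin t → X) × (Fin t → X))

/-- The operator `A^{⊗t} ⊗ (A^*)^{⊗t}`. -/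
def rep (t : ℕ) (A : Matrix X X ℂ) : RepSpace t X →L[ℂ] RepSpace t X :=
  Matrix.toEuclideanCLM (𝕜 := ℂ) (tensorPower t A)

lemma rep_one (t : ℕ) : rep t (1 : Matrix X X ℂ) = 1 := by
  rw [rep, tensorPower_one, map_one]

lemma rep_mul (t : ℕ) (A B : Matrix X X ℂ) : rep t (A * B) = rep t A * rep t B := by
  rw [rep, tensorPower_mul, map_mul]; rfl

lemma star_rep (t : ℕ) (A : Matrix X X ℂ) : star (rep t A) = rep t (star A) := by
  rw [rep, rep, ← map_star, star_eq_conjTranspose, star_eq_conjTranspose,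
    tensorPower_conjTranspose]

lemma norm_rep_apply (t : ℕ) (U : unitaryGroup X ℂ) (v : RepSpace t X) :
    ‖rep t (U : Matrix X X ℂ) v‖ = ‖v‖ := by
  have h : star (rep t (U : Matrix X X ℂ)) * rep t (U : Matrix X X ℂ) = 1 := by
    rw [star_rep, ← rep_mul, Unitary.coe_star_mul_self, rep_one]
  rw [← sq_eq_sq₀ (norm_nonneg _) (norm_nonneg _)]
  have h2 : inner ℂ (rep t (U : Matrix X X ℂ) v) (rep t (U : Matrix X X ℂ) v) = inner ℂ v v := by
    rw [← ContinuousLinearMap.adjoint_inner_right, ← ContinuousLinearMap.star_eq_adjoint]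
    congr 1
    exact DFunLike.congr_fun h v
  rw [inner_self_eq_norm_sq_to_K, inner_self_eq_norm_sq_to_K] at h2
  exact_mod_cast h2

end Tensor

/-! ### Moment operators -/

section Moments

variable {X Y : Type*} [Fintype X] [DecidableEq X] [Fintype Y] [DecidableEq Y]

instance : SecondCountableTopology (unitaryGroup X ℂ) :=
  haveI : SecondCountableTopology (Matrix X X ℂ) :=
    inferInstanceAs (SecondCountableTopology (X → X → ℂ))
  TopologicalSpace.Subtype.secondCountableTopology _

lemma inner_toEuclideanCLM_eq {m : Type*} [Fintype m] [DecidableEq m] (A : Matrix m m ℂ)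
    (w v : EuclideanSpace ℂ m) :
    inner ℂ w (Matrix.toEuclideanCLM (𝕜 := ℂ) A v) = ∑ i, ∑ j, star (w i) * v j * A i j := by
  rw [PiLp.inner_apply]
  refine Finset.sum_congr rfl fun i _ => ?_
  rw [Matrix.ofLp_toEuclideanCLM, Matrix.mulVec, dotProduct, RCLike.inner_apply, Finset.sum_mul]
  refine Finset.sum_congr rfl fun j _ => ?_
  rw [starRingEnd_apply]
  ring

/-- The moment operator as an operator on the representation space. -/
def mop (t : ℕ) (ν : Measure (unitaryGroup X ℂ)) : RepSpace t X →L[ℂ] RepSpace t X :=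
  Matrix.toEuclideanCLM (𝕜 := ℂ) (momentOp t ν)

lemma continuous_tensorPower_apply (t : ℕ) (x y : (Fin t → X) × (Fin t → X)) :
    Continuous fun U : unitaryGroup X ℂ => tensorPower t (U : Matrix X X ℂ) x y := by
  have h : ∀ i j, Continuous fun U : unitaryGroup X ℂ => (U : Matrix X X ℂ) i j := fun i j =>
    (continuous_subtype_val).matrix_elem i j
  simp only [tensorPower, Matrix.of_apply]
  exact (continuous_finsetProd _ fun a _ => h _ _).mul
    (continuous_finsetProd _ fun a _ => (h _ _).star)

lemma continuous_inner_rep (t : ℕ) (w v : RepSpace t X) :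
    Continuous fun U : unitaryGroup X ℂ => inner ℂ w (rep t (U : Matrix X X ℂ) v) := by
  simp only [rep, inner_toEuclideanCLM_eq]
  exact continuous_finsetSum _ fun i _ => continuous_finsetSum _ fun j _ =>
    continuous_const.mul (continuous_tensorPower_apply t i j)

lemma integrable_of_continuous {G F : Type*} [TopologicalSpace G] [CompactSpace G]
    [MeasurableSpace G] [OpensMeasurableSpace G] [NormedAddCommGroup F]
    [SecondCountableTopology F] {f : G → F} (hf : Continuous f) (ν : Measure G)
    [IsFiniteMeasure ν] : Integrable f ν := by
  borelize F
  obtain ⟨C, hC⟩ := (isCompact_range hf).isBounded.exists_norm_le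
  exact Integrable.of_bound hf.aestronglyMeasurable C
    (Filter.Eventually.of_forall fun x => hC _ ⟨x, rfl⟩)

lemma inner_mop (t : ℕ) (ν : Measure (unitaryGroup X ℂ)) [IsFiniteMeasure ν]
    (w v : RepSpace t X) :
    inner ℂ w (mop t ν v) = ∫ U : unitaryGroup X ℂ, inner ℂ w (rep t (U : Matrix X X ℂ) v) ∂ν := by
  simp only [mop, rep, inner_toEuclideanCLM_eq]
  have h := fun i j => integrable_of_continuous (continuous_tensorPower_apply (X := X) t i j) ν
  rw [integral_finsetSum _ fun i _ => integrable_finsetSum _ fun j _ => (h i j).const_mul _]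
  refine Finset.sum_congr rfl fun i _ => ?_
  rw [integral_finsetSum _ fun j _ => (h i j).const_mul _]
  refine Finset.sum_congr rfl fun j _ => ?_
  rw [integral_const_mul]
  rfl

lemma norm_mop_le (t : ℕ) (ν : Measure (unitaryGroup X ℂ)) [IsProbabilityMeasure ν] :
    ‖mop t ν‖ ≤ 1 := by
  refine ContinuousLinearMap.opNorm_le_bound _ zero_le_one fun v => ?_
  rw [one_mul]
  have h : ‖inner ℂ (mop t ν v) (mop t ν v)‖ ≤ ‖mop t ν v‖ * ‖v‖ := by
    rw [inner_mop]
    refine (norm_integral_le_of_norm_le_const (C := ‖mop t ν v‖ * ‖v‖)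
      (Filter.Eventually.of_forall fun U => ?_)).trans (by simp)
    refine (norm_inner_le_norm _ _).trans ?_
    rw [norm_rep_apply]
  rw [inner_self_eq_norm_sq_to_K, norm_pow] at h
  simp only [Complex.coe_algebraMap, Complex.norm_real, norm_norm] at h
  by_contra! hcon
  nlinarith [norm_nonneg v, norm_nonneg (mop t ν v)]

lemma mop_mconv (t : ℕ) (μ ν : Measure (unitaryGroup X ℂ)) [IsProbabilityMeasure μ]
    [IsProbabilityMeasure ν] : mop t (Measure.mconv μ ν) = mop t μ * mop t ν := by
  ext1 v
  refine ext_inner_left ℂ fun w => ?_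
  rw [inner_mop, integral_mconv (integrable_of_continuous (continuous_inner_rep t w v) _)]
  change _ = inner ℂ w (mop t μ (mop t ν v))
  rw [inner_mop]
  congr 1
  ext U
  rw [← ContinuousLinearMap.adjoint_inner_left, inner_mop]
  congr 1
  ext V
  rw [ContinuousLinearMap.adjoint_inner_left]
  change inner ℂ w (rep t ((U : Matrix X X ℂ) * (V : Matrix X X ℂ)) v) = _
  rw [rep_mul]
  rfl

lemma mop_dirac_one (t : ℕ) : mop t (Measure.dirac (1 : unitaryGroup X ℂ)) = 1 := by
  ext1 v
  refine ext_inner_left ℂ fun w => ?_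
  rw [inner_mop, integral_dirac]
  change inner ℂ w (rep t (1 : Matrix X X ℂ) v) = _
  rw [rep_one]

lemma isProbabilityMeasure_convList {l : List (Measure (unitaryGroup X ℂ))}
    (h : ∀ ν ∈ l, IsProbabilityMeasure ν) : IsProbabilityMeasure (convList l) := by
  induction l with
  | nil => exact inferInstanceAs (IsProbabilityMeasure (Measure.dirac _))
  | cons ν l ih =>
    have := h ν (by simp)
    have := ih fun μ hμ => h μ (by simp [hμ])
    exact inferInstanceAs (IsProbabilityMeasure (Measure.mconv ν (convList l)))

lemma mop_convList (t : ℕ) {l : List (Measure (unitaryGroup X ℂ))}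
    (h : ∀ ν ∈ l, IsProbabilityMeasure ν) : mop t (convList l) = (l.map (mop t)).prod := by
  induction l with
  | nil => exact mop_dirac_one t
  | cons ν l ih =>
    have := h ν (by simp)
    have h' : ∀ μ ∈ l, IsProbabilityMeasure μ := fun μ hμ => h μ (by simp [hμ])
    have := isProbabilityMeasure_convList h'
    rw [List.map_cons, List.prod_cons, ← ih h', ← mop_mconv]
    rfl

lemma opNorm_momentOp_sub (t : ℕ) (μ ν : Measure (unitaryGroup X ℂ)) :
    opNorm (momentOp t μ - momentOp t ν) = ‖mop t μ - mop t ν‖ := by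
  rw [opNorm, map_sub]; rfl

/-- The vectors that are invariant under all unitaries in the image of `θ`. -/
def fixSpace (t : ℕ) {Γ : Type*} (θ : Γ → Matrix X X ℂ) : Submodule ℂ (RepSpace t X) where
  carrier := {v | ∀ g, rep t (θ g) v = v}
  zero_mem' := fun g => map_zero _
  add_mem' := fun hv hw g => by rw [map_add, hv g, hw g]
  smul_mem' := fun c v hv g => by rw [map_smul, hv g]

lemma mem_fixSpace {t : ℕ} {Γ : Type*} {θ : Γ → Matrix X X ℂ} {v : RepSpace t X} :
    v ∈ fixSpace t θ ↔ ∀ g, rep t (θ g) v = v := Iff.rfl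

lemma eq_pr_of_mul_self {E : Type*} [NormedAddCommGroup E] [InnerProductSpace ℂ E]
    [FiniteDimensional ℂ E] {T : E →L[ℂ] E} {K : Submodule ℂ E} (hT : star T * T = T)
    (hK : ∀ v, T v = v ↔ v ∈ K) : T = pr K := by
  have hs : star T = T := by
    rw [← hT, star_mul, star_star, hT]
  have hi : T * T = T := by rw [hs] at hT; exact hT
  ext1 v
  refine (Submodule.eq_starProjection_of_mem_of_inner_eq_zero (K := K) ?_ fun w hw => ?_).symm
  · rw [← hK]; exact DFunLike.congr_fun hi v
  · rw [inner_sub_left, ← hs, ContinuousLinearMap.star_eq_adjoint,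
      ContinuousLinearMap.adjoint_inner_left, (hK w).2 hw, sub_self]

/-- The moment operator of the image of the Haar measure under a representation is the projection
onto the invariant vectors. Only left invariance of the Haar measure enters: it gives
`rep (θ V) P = P`, and averaging over the adjoints yields `P^* P = P`. -/
theorem mop_map_haarU (t : ℕ) (θ : unitaryGroup Y ℂ →* unitaryGroup X ℂ) (hθ : Continuous θ) :
    mop t ((haarU Y).map θ) = pr (fixSpace t fun U => (θ U : Matrix X X ℂ)) := by
  have : IsProbabilityMeasure ((haarU Y).map θ) :=
    Measure.isProbabilityMeasure_map hθ.measurable.aemeasurable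
  have hinner : ∀ w v, inner ℂ w (mop t ((haarU Y).map θ) v)
      = ∫ U, inner ℂ w (rep t (θ U : Matrix X X ℂ) v) ∂haarU Y := by
    intro w v
    rw [inner_mop, integral_map hθ.measurable.aemeasurable
      (continuous_inner_rep t w v).aestronglyMeasurable]
  set P := mop t ((haarU Y).map θ) with hP
  have hleft : ∀ (V : unitaryGroup Y ℂ) v, rep t (θ V : Matrix X X ℂ) (P v) = P v := by
    intro V v
    refine ext_inner_left ℂ fun w => ?_
    rw [← ContinuousLinearMap.adjoint_inner_left, hinner, hinner]
    have : Measure.IsMulLeftInvariant (haarU Y) := by unfold haarU; infer_instance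
    rw [← integral_mul_left_eq_self (μ := haarU Y)
      (fun U => inner ℂ w (rep t (θ U : Matrix X X ℂ) v)) V]
    congr 1
    ext U
    rw [ContinuousLinearMap.adjoint_inner_left, map_mul]
    change _ = inner ℂ w (rep t ((θ V : Matrix X X ℂ) * (θ U : Matrix X X ℂ)) v)
    rw [rep_mul]
    rfl
  refine eq_pr_of_mul_self ?_ fun v => ?_
  · ext1 v
    refine ext_inner_left ℂ fun w => ?_
    change inner ℂ w (star P (P v)) = _
    rw [ContinuousLinearMap.star_eq_adjoint, ContinuousLinearMap.adjoint_inner_right,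
      ← inner_conj_symm, hinner]
    have : ∀ U, inner ℂ (P v) (rep t (θ U : Matrix X X ℂ) w) = inner ℂ (P v) w := by
      intro U
      rw [← ContinuousLinearMap.adjoint_inner_left, ← ContinuousLinearMap.star_eq_adjoint,
        star_rep]
      have e : star (θ U : Matrix X X ℂ) = (θ (star U) : Matrix X X ℂ) := by
        have : θ (star U) = star (θ U) := by
          rw [Unitary.star_eq_inv, Unitary.star_eq_inv, map_inv]
        rw [this]; rfl
      rw [e, hleft]
    simp only [this]
    simp [inner_conj_symm]
  · constructor
    · intro h V
      rw [← h]
      exact hleft V v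
    · intro h
      refine ext_inner_left ℂ fun w => ?_
      rw [hinner]
      simp only [mem_fixSpace.1 h]
      simp

lemma mop_haarU (t : ℕ) :
    mop t (haarU X) = pr (fixSpace t fun U : unitaryGroup X ℂ => (U : Matrix X X ℂ)) := by
  have := mop_map_haarU t (MonoidHom.id (unitaryGroup X ℂ)) continuous_id
  rwa [MonoidHom.coe_id, Measure.map_id] at this

lemma commute_pr_of_mapsTo {E : Type*} [NormedAddCommGroup E] [InnerProductSpace ℂ E]
    [FiniteDimensional ℂ E] {T : E →L[ℂ] E} {K : Submodule ℂ E} (h1 : ∀ v ∈ K, T v ∈ K)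
    (h2 : ∀ v ∈ K, star T v ∈ K) : Commute T (pr K) := by
  have h : ∀ {T : E →L[ℂ] E}, (∀ v ∈ K, T v ∈ K) → pr K * T * pr K = T * pr K := by
    intro T hT
    ext1 v
    exact pr_apply_eq_self_iff.2 (hT _ (Submodule.starProjection_apply_mem _ _))
  have h3 := congrArg star (h h2)
  rw [star_mul, star_mul, star_mul, star_star, star_pr, ← mul_assoc] at h3
  exact (h h1).symm.trans h3

/-- The projections onto the invariants of two commuting families of unitaries commute. -/
lemma commute_pr_fixSpace {t : ℕ} {Γ Γ' : Type*} {θ : Γ → Matrix X X ℂ} {θ' : Γ' → Matrix X X ℂ}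
    (h : ∀ g g', Commute (θ g) (θ' g')) (hs : ∀ g, ∃ g₁, star (θ g) = θ g₁) :
    Commute (pr (fixSpace t θ)) (pr (fixSpace t θ')) := by
  have hmaps : ∀ g, ∀ v ∈ fixSpace t θ', rep t (θ g) v ∈ fixSpace t θ' := by
    intro g v hv g'
    have : rep t (θ' g') * rep t (θ g) = rep t (θ g) * rep t (θ' g') := by
      rw [← rep_mul, ← rep_mul, (h g g').eq]
    rw [← mul_apply_eq_comp, this, mul_apply_eq_comp, hv g']
  have hcomm : ∀ g, Commute (rep t (θ g)) (pr (fixSpace t θ')) := by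
    intro g
    refine commute_pr_of_mapsTo (hmaps g) ?_
    rw [star_rep]
    obtain ⟨g₁, h1⟩ := hs g
    rw [h1]
    exact hmaps g₁
  have hK : ∀ v ∈ fixSpace t θ, pr (fixSpace t θ') v ∈ fixSpace t θ := by
    intro v hv g
    rw [← mul_apply_eq_comp, (hcomm g).eq, mul_apply_eq_comp, hv g]
  exact (commute_pr_of_mapsTo hK (by rwa [star_pr])).symm

end Moments

end

end RandomCircuit

namespace RandomCircuit

noncomputable section

/-! ### Operators on a tensor factor -/

section Amplification

variable {X Y Z : Type*} [Fintype X] [DecidableEq X] [Fintype Y] [DecidableEq Y] [Fintype Z]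
  [DecidableEq Z]

/-- The matrix `A ⊗ 1`, where the index set is identified with a product by `e`. -/
def amp (e : X ≃ Y × Z) (A : Matrix Y Y ℂ) : Matrix X X ℂ :=
  (A ⊗ₖ (1 : Matrix Z Z ℂ)).submatrix e e

omit [Fintype X] [DecidableEq X] [Fintype Y] [DecidableEq Y] [Fintype Z] in
lemma amp_apply (e : X ≃ Y × Z) (A : Matrix Y Y ℂ) (x y : X) :
    amp e A x y = A (e x).1 (e y).1 * if (e x).2 = (e y).2 then 1 else 0 := rfl

omit [Fintype X] [Fintype Y] [Fintype Z] in
lemma amp_one (e : X ≃ Y × Z) : amp e (1 : Matrix Y Y ℂ) = 1 := by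
  rw [amp, one_kronecker_one, submatrix_one_equiv]

omit [DecidableEq X] [DecidableEq Y] in
lemma amp_mul (e : X ≃ Y × Z) (A B : Matrix Y Y ℂ) : amp e (A * B) = amp e A * amp e B := by
  rw [amp, amp, amp, submatrix_mul_equiv, ← mul_kronecker_mul, one_mul]

omit [Fintype X] [DecidableEq X] [Fintype Y] [DecidableEq Y] [Fintype Z] in
lemma amp_star (e : X ≃ Y × Z) (A : Matrix Y Y ℂ) : amp e (star A) = star (amp e A) := by
  rw [amp, amp, star_eq_conjTranspose, star_eq_conjTranspose, conjTranspose_submatrix,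
    conjTranspose_kronecker, conjTranspose_one]

/-- `U ↦ U ⊗ 1` as a homomorphism of unitary groups. -/
def ampU (e : X ≃ Y × Z) : unitaryGroup Y ℂ →* unitaryGroup X ℂ where
  toFun U := ⟨amp e U, by
    rw [mem_unitaryGroup_iff, ← amp_star, ← amp_mul, mem_unitaryGroup_iff.1 U.2, amp_one]⟩
  map_one' := Subtype.ext (amp_one e)
  map_mul' U V := Subtype.ext (amp_mul e U V)

lemma continuous_ampU (e : X ≃ Y × Z) : Continuous (ampU e) := by
  refine Continuous.subtype_mk (continuous_matrix fun x y => ?_) _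
  simp only [amp_apply]
  exact ((continuous_subtype_val).matrix_elem _ _).mul continuous_const

/-- `T ↦ T ⊗ 1` on operators. -/
def ampHom (e : X ≃ Y × Z) : (EuclideanSpace ℂ Y →L[ℂ] EuclideanSpace ℂ Y) →⋆ₐ[ℂ]
    (EuclideanSpace ℂ X →L[ℂ] EuclideanSpace ℂ X) :=
  ((Matrix.toEuclideanCLM (n := X) (𝕜 := ℂ) : _ →⋆ₐ[ℂ] _).comp
    { toFun := amp e
      map_one' := amp_one e
      map_mul' := amp_mul e
      map_zero' := by ext x y; simp [amp_apply]
      map_add' := fun A B => by ext x y; simp only [amp_apply, Matrix.add_apply]; ring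
      commutes' := fun c => by
        ext x y
        rw [Algebra.algebraMap_eq_smul_one, Algebra.algebraMap_eq_smul_one, ← amp_one e]
        simp only [amp_apply, Matrix.smul_apply, smul_eq_mul]
        ring
      map_star' := amp_star e }).comp
    ((Matrix.toEuclideanCLM (n := Y) (𝕜 := ℂ)).symm : _ →⋆ₐ[ℂ] _)

lemma ampHom_toEuclideanCLM (e : X ≃ Y × Z) (A : Matrix Y Y ℂ) :
    ampHom e (Matrix.toEuclideanCLM (𝕜 := ℂ) A) = Matrix.toEuclideanCLM (𝕜 := ℂ) (amp e A) := by
  change Matrix.toEuclideanCLM (𝕜 := ℂ) (amp e ((Matrix.toEuclideanCLM (n := Y) (𝕜 := ℂ)).symm _)) = _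
  rw [StarAlgEquiv.symm_apply_apply]

lemma norm_ampHom_le (e : X ≃ Y × Z) (T : EuclideanSpace ℂ Y →L[ℂ] EuclideanSpace ℂ Y) :
    ‖ampHom e T‖ ≤ ‖T‖ :=
  NonUnitalStarAlgHom.norm_apply_le (ampHom e) T

variable (t : ℕ)

/-- The identification of index sets of tensor powers induced by `e`. -/
def tensEquiv (e : X ≃ Y × Z) : (Fin t → X) × (Fin t → X) ≃
    ((Fin t → Y) × (Fin t → Y)) × ((Fin t → Z) × (Fin t → Z)) where
  toFun x := ((fun a => (e (x.1 a)).1, fun a => (e (x.2 a)).1),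
    (fun a => (e (x.1 a)).2, fun a => (e (x.2 a)).2))
  invFun p := (fun a => e.symm (p.1.1 a, p.2.1 a), fun a => e.symm (p.1.2 a, p.2.2 a))
  left_inv x := by simp
  right_inv p := by simp

omit [Fintype X] [DecidableEq X] [Fintype Y] [DecidableEq Y] [Fintype Z] in
lemma tensorPower_amp (e : X ≃ Y × Z) (A : Matrix Y Y ℂ) :
    tensorPower t (amp e A) = amp (tensEquiv t e) (tensorPower t A) := by
  ext x y
  simp only [tensorPower, Matrix.of_apply, amp_apply, tensEquiv, Equiv.coe_fn_mk, Prod.mk.injEq,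
    star_mul', Finset.prod_mul_distrib, apply_ite (star : ℂ → ℂ), star_one, star_zero,
    Finset.prod_ite_zero, Finset.prod_const_one, Finset.mem_univ, true_imp_iff, funext_iff]
  rw [ite_and]
  split_ifs <;> ring

lemma ampHom_mop (e : X ≃ Y × Z) (ν : Measure (unitaryGroup Y ℂ)) :
    ampHom (tensEquiv t e) (mop t ν) = mop t (ν.map (ampU e)) := by
  rw [mop, ampHom_toEuclideanCLM, mop]
  congr 1
  ext x y
  simp only [momentOp, amp_apply, Matrix.of_apply]
  rw [integral_map (continuous_ampU e).measurable.aemeasurable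
    (continuous_tensorPower_apply t x y).aestronglyMeasurable, ← integral_mul_const]
  congr 1
  ext U
  change _ = tensorPower t (amp e (U : Matrix Y Y ℂ)) x y
  rw [tensorPower_amp, amp_apply]

lemma ampHom_pr_fixSpace {W : Type*} [Fintype W] [DecidableEq W] (e : X ≃ Y × Z)
    (θ : unitaryGroup W ℂ →* unitaryGroup Y ℂ) (hθ : Continuous θ) :
    ampHom (tensEquiv t e) (pr (fixSpace t fun U => (θ U : Matrix Y Y ℂ)))
      = pr (fixSpace t fun U => amp e (θ U : Matrix Y Y ℂ)) := by
  rw [← mop_map_haarU t θ hθ, ampHom_mop, Measure.map_map (continuous_ampU e).measurable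
    hθ.measurable]
  exact mop_map_haarU t ((ampU e).comp θ) ((continuous_ampU e).comp hθ)

end Amplification

/-! ### Gates on pairs of sites -/

section PairGates

variable {ι D : Type*} [Fintype ι] [DecidableEq ι] [Fintype D] [DecidableEq D]

/-- The operator that acts as `A` on the sites `i`, `j` and trivially on the other sites. -/
def gate2 (i j : ι) (A : Matrix (D × D) (D × D) ℂ) : Matrix (ι → D) (ι → D) ℂ :=
  Matrix.of fun x y => A (x i, x j) (y i, y j) *
    if ∀ k, k ≠ i → k ≠ j → x k = y k then 1 else 0

/-- Splitting off the two coordinates `i`, `j`. -/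
def pairEquiv {i j : ι} (h : i ≠ j) :
    (ι → D) ≃ (D × D) × ({k : ι // k ≠ i ∧ k ≠ j} → D) where
  toFun x := ((x i, x j), fun k => x k)
  invFun p k := if hi : k = i then p.1.1 else if hj : k = j then p.1.2 else p.2 ⟨k, hi, hj⟩
  left_inv x := by
    ext k
    by_cases hi : k = i
    · simp [hi]
    · by_cases hj : k = j
      · subst hj; simp [hi]
      · simp [hi, hj]
  right_inv p := by
    refine Prod.ext (Prod.ext ?_ ?_) ?_
    · simp
    · simp [h.symm]
    · ext k
      simp [k.2.1, k.2.2]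

omit [Fintype D] in
lemma gate2_eq_amp {i j : ι} (h : i ≠ j) (A : Matrix (D × D) (D × D) ℂ) :
    gate2 i j A = amp (pairEquiv h) A := by
  ext x y
  simp only [gate2, amp_apply, pairEquiv, Matrix.of_apply, Equiv.coe_fn_mk, funext_iff,
    Subtype.forall, and_imp]

omit [Fintype D] in
lemma star_gate2 {i j : ι} (h : i ≠ j) (A : Matrix (D × D) (D × D) ℂ) :
    star (gate2 i j A) = gate2 i j (star A) := by
  simp only [gate2_eq_amp h, amp_star]

omit [Fintype D] in
lemma gate2_comm (i j : ι) (A : Matrix (D × D) (D × D) ℂ) :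
    gate2 i j A = gate2 j i (A.submatrix Prod.swap Prod.swap) := by
  ext x y
  simp only [gate2, Matrix.of_apply, Matrix.submatrix_apply, Prod.swap_prod_mk]
  congr 2
  simp only [eq_iff_iff]
  exact forall_congr' fun k => ⟨fun h a b => h b a, fun h a b => h b a⟩

/-- Gates on disjoint pairs of sites commute. -/
lemma commute_gate2 {p q : ι × ι} (h : PairDisjoint p q) (hp : p.1 ≠ p.2)
    (A B : Matrix (D × D) (D × D) ℂ) : Commute (gate2 p.1 p.2 A) (gate2 q.1 q.2 B) := by
  obtain ⟨h1, h2, h3, h4⟩ := h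
  have e : gate2 q.1 q.2 B = ((1 : Matrix (D × D) (D × D) ℂ) ⊗ₖ
      gate2 (ι := {k : ι // k ≠ p.1 ∧ k ≠ p.2}) ⟨q.1, h1.symm, h3.symm⟩ ⟨q.2, h2.symm, h4.symm⟩
        B).submatrix (pairEquiv hp) (pairEquiv hp) := by
    ext x y
    simp only [gate2, pairEquiv, Matrix.of_apply, Matrix.submatrix_apply, Equiv.coe_fn_mk,
      Matrix.kroneckerMap_apply, Matrix.one_apply, Prod.mk.injEq, Subtype.forall, ne_eq,
      Subtype.mk.injEq]
    by_cases hc : ∀ k, ¬ k = q.1 → ¬ k = q.2 → x k = y k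
    · rw [if_pos hc, if_pos ⟨hc _ h1 h2, hc _ h3 h4⟩, if_pos (fun k _ => hc k), one_mul]
    · rw [if_neg hc, mul_zero]
      by_cases hc' : x p.1 = y p.1 ∧ x p.2 = y p.2
      · rw [if_pos hc', one_mul, if_neg, mul_zero]
        intro hc''
        apply hc
        intro k hk1 hk2
        by_cases e1 : k = p.1
        · rw [e1]; exact hc'.1
        · by_cases e2 : k = p.2
          · rw [e2]; exact hc'.2
          · exact hc'' k ⟨e1, e2⟩ hk1 hk2
      · rw [if_neg hc', zero_mul]
  rw [Commute, SemiconjBy, e, gate2_eq_amp hp, amp, submatrix_mul_equiv, submatrix_mul_equiv,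
    ← mul_kronecker_mul, ← mul_kronecker_mul, one_mul, mul_one, one_mul, mul_one]

/-- The exchange of the two factors. -/
def swapGate (D : Type*) [Fintype D] [DecidableEq D] : unitaryGroup (D × D) ℂ :=
  ⟨(1 : Matrix (D × D) (D × D) ℂ).submatrix Prod.swap id, by
    rw [mem_unitaryGroup_iff, star_eq_conjTranspose, conjTranspose_submatrix, conjTranspose_one]
    ext x y
    simp only [Matrix.mul_apply, Matrix.submatrix_apply, id, Matrix.one_apply, mul_ite, mul_one,
      mul_zero]
    simp [Prod.swap_inj]⟩

lemma gate2_swapGate {j k : ι} (h : j ≠ k) : gate2 j k (swapGate D : Matrix (D × D) (D × D) ℂ)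
    = (1 : Matrix (ι → D) (ι → D) ℂ).submatrix (fun x => x ∘ Equiv.swap j k) id := by
  ext x y
  simp only [gate2, swapGate, Matrix.of_apply, Matrix.submatrix_apply, id, Matrix.one_apply,
    Prod.swap_prod_mk, Prod.mk.injEq]
  rw [ite_zero_mul_ite_zero, mul_one]
  congr 1
  rw [eq_iff_iff, funext_iff]
  constructor
  · rintro ⟨⟨e1, e2⟩, e3⟩ l
    by_cases hj : l = j
    · subst hj; simpa using e1
    · by_cases hk : l = k
      · subst hk; simpa using e2
      · simpa [Equiv.swap_apply_of_ne_of_ne hj hk] using e3 l hj hk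
  · intro e
    refine ⟨⟨by simpa using e j, by simpa using e k⟩, fun l hj hk => ?_⟩
    simpa [Equiv.swap_apply_of_ne_of_ne hj hk] using e l

/-- A gate on `i`, `k` is obtained from one on `i`, `j` by exchanging the sites `j` and `k`. -/
lemma gate2_eq_swap_mul {i j k : ι} (hij : i ≠ j) (hik : i ≠ k) (hjk : j ≠ k)
    (A : Matrix (D × D) (D × D) ℂ) :
    gate2 i k A = gate2 j k (swapGate D : Matrix (D × D) (D × D) ℂ) * gate2 i j A
      * gate2 j k (swapGate D : Matrix (D × D) (D × D) ℂ) := by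
  let τ : (ι → D) ≃ (ι → D) :=
    ⟨fun x => x ∘ Equiv.swap j k, fun x => x ∘ Equiv.swap j k,
      fun x => by ext; simp, fun x => by ext; simp⟩
  have e : gate2 j k (swapGate D : Matrix (D × D) (D × D) ℂ)
      = (1 : Matrix (ι → D) (ι → D) ℂ).submatrix τ (Equiv.refl _) := gate2_swapGate hjk
  have e' : (1 : Matrix (ι → D) (ι → D) ℂ).submatrix τ (Equiv.refl _)
      = (1 : Matrix (ι → D) (ι → D) ℂ).submatrix (Equiv.refl _) τ := by
    ext x y
    simp only [Matrix.submatrix_apply, Matrix.one_apply, Equiv.refl_apply]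
    congr 1
    exact eq_iff_iff.2 ⟨fun h => by rw [← h]; exact (τ.left_inv x).symm,
      fun h => by rw [h]; exact τ.left_inv y⟩
  rw [e, one_submatrix_mul, e', mul_submatrix_one]
  ext x y
  simp only [gate2, τ, Matrix.of_apply, Matrix.submatrix_apply, Equiv.refl_symm, Equiv.coe_refl,
    Function.comp_apply, id, Equiv.coe_fn_mk, Equiv.swap_apply_left,
    Equiv.swap_apply_of_ne_of_ne hij hik]
  congr 2
  rw [eq_iff_iff]
  constructor
  · intro h l hl hl'
    refine h _ (fun e => ?_) fun e => ?_
    · have := congrArg (Equiv.swap j k) e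
      rw [Equiv.swap_apply_self, Equiv.swap_apply_of_ne_of_ne hij hik] at this
      exact hl this
    · have := congrArg (Equiv.swap j k) e
      rw [Equiv.swap_apply_self, Equiv.swap_apply_right] at this
      exact hl' this
  · intro h l hl hl'
    have := h (Equiv.swap j k l) (fun e => ?_) fun e => ?_
    · simpa using this
    · have := congrArg (Equiv.swap j k) e
      rw [Equiv.swap_apply_self, Equiv.swap_apply_of_ne_of_ne hij hik] at this
      exact hl this
    · have := congrArg (Equiv.swap j k) e
      rw [Equiv.swap_apply_self, Equiv.swap_apply_left] at this
      exact hl' this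

end PairGates

end

end RandomCircuit

namespace RandomCircuit

noncomputable section

/-! ### Universality of gates on pairs of sites -/

section Commutators

variable {R : Type*} [Ring R] [Algebra ℂ R]

/-- The commutator of `1 + A` and `1 + B` is `1 + A * B` if all other products vanish. -/
lemma one_add_smul_mul_mem {M : Submonoid R} {A B : R} (hA : ∀ c : ℂ, 1 + c • A ∈ M)
    (hB : ∀ c : ℂ, 1 + c • B ∈ M) (hAA : A * A = 0) (hBB : B * B = 0) (hBA : B * A = 0) (c : ℂ) :
    1 + c • (A * B) ∈ M := by
  have e : 1 + c • (A * B)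
      = (1 + c • A) * (1 + (1 : ℂ) • B) * (1 + (-c) • A) * (1 + (-1 : ℂ) • B) := by
    have h1 : B * (A * B) = 0 := by rw [← mul_assoc, hBA, zero_mul]
    have h2 : A * (A * B) = 0 := by rw [← mul_assoc, hAA, zero_mul]
    have h3 : A * B * B = 0 := by rw [mul_assoc, hBB, mul_zero]
    have h4 : A * B * A = 0 := by rw [mul_assoc, hBA, mul_zero]
    have h5 : A * B * (A * B) = 0 := by rw [← mul_assoc, h4, zero_mul]
    simp only [mul_add, add_mul, mul_one, one_mul, smul_mul_assoc, mul_smul_comm, hAA, hBB, hBA,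
      h3, h4, smul_zero, add_zero]
    module
  rw [e]
  exact mul_mem (mul_mem (mul_mem (hA _) (hB _)) (hA _)) (hB _)

/-- A diagonal matrix of determinant one on a two-dimensional subspace is a product of four
transvections. -/
lemma one_add_mem_of_transvections {M : Submonoid R} {E F : R} (hE : ∀ c : ℂ, 1 + c • E ∈ M)
    (hF : ∀ c : ℂ, 1 + c • F ∈ M) (hEE : E * E = 0) (hFF : F * F = 0) (hEFE : E * F * E = E)
    (hFEF : F * E * F = F) {a : ℂ} (ha : a ≠ 0) :
    1 + (a - 1) • (E * F) + (a⁻¹ - 1) • (F * E) ∈ M := by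
  have e : 1 + (a - 1) • (E * F) + (a⁻¹ - 1) • (F * E)
      = (1 + (-((a - 1) / a)) • F) * (1 + (1 : ℂ) • E) * (1 + (a - 1) • F)
        * (1 + (-(1 / a)) • E) := by
    have h1 : F * E * E = 0 := by rw [mul_assoc, hEE, mul_zero]
    simp only [mul_add, add_mul, mul_one, one_mul, smul_mul_assoc, mul_smul_comm, hEE, hFF, hEFE,
      hFEF, h1, smul_zero, add_zero, smul_add, smul_smul]
    match_scalars <;> field_simp <;> ring
  rw [e]
  exact mul_mem (mul_mem (mul_mem (hF _) (hE _)) (hF _)) (hE _)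

end Commutators

section Units

variable {κ D : Type*} [Fintype κ] [DecidableEq κ] [Fintype D] [DecidableEq D]

/-- The operator that maps a basis state equal to `y` on `S` to the state that is changed to `x` on
`S`, and the other basis states to zero. -/
def siteUnit (S : Finset κ) (x y : κ → D) : Matrix (κ → D) (κ → D) ℂ :=
  Matrix.of fun u v => if (∀ k ∈ S, u k = x k ∧ v k = y k) ∧ ∀ k, k ∉ S → u k = v k then 1 else 0

lemma siteUnit_mul_apply (S : Finset κ) (x z : κ → D) (B : Matrix (κ → D) (κ → D) ℂ)
    (u v : κ → D) : (siteUnit S x z * B) u v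
      = if ∀ k ∈ S, u k = x k then B (S.piecewise z u) v else 0 := by
  rw [Matrix.mul_apply, Finset.sum_eq_single (S.piecewise z u)]
  · simp only [siteUnit, Matrix.of_apply]
    split_ifs with h1 h2 h2
    · exact one_mul _
    · exact absurd (fun k hk => (h1.1 k hk).1) h2
    · refine absurd ⟨fun k hk => ⟨h2 k hk, ?_⟩, fun k hk => ?_⟩ h1
      · exact Finset.piecewise_eq_of_mem _ _ _ hk
      · exact (Finset.piecewise_eq_of_notMem _ _ _ hk).symm
    · exact zero_mul _
  · intro w _ hw
    rw [siteUnit, Matrix.of_apply, if_neg, zero_mul]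
    rintro ⟨h1, h2⟩
    apply hw
    ext k
    by_cases hk : k ∈ S
    · rw [Finset.piecewise_eq_of_mem _ _ _ hk]; exact (h1 k hk).2
    · rw [Finset.piecewise_eq_of_notMem _ _ _ hk]; exact (h2 k hk).symm
  · simp

lemma siteUnit_mul_eq_zero {S T : Finset κ} {x z z' y : κ → D}
    (h : ∃ k ∈ S, k ∈ T ∧ z k ≠ z' k) : siteUnit S x z * siteUnit T z' y = 0 := by
  ext u v
  rw [siteUnit_mul_apply]
  split_ifs with h1
  · rw [siteUnit, Matrix.of_apply, if_neg]
    · rfl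
    · rintro ⟨h2, -⟩
      obtain ⟨k, hkS, hkT, hne⟩ := h
      have := (h2 k hkT).1
      rw [Finset.piecewise_eq_of_mem _ _ _ hkS] at this
      exact hne this
  · rfl

lemma siteUnit_mul_siteUnit (S : Finset κ) (x z y : κ → D) :
    siteUnit S x z * siteUnit S z y = siteUnit S x y := by
  ext u v
  rw [siteUnit_mul_apply]
  simp only [siteUnit, Matrix.of_apply]
  rw [← ite_and]
  congr 1
  rw [eq_iff_iff]
  constructor
  · rintro ⟨h1, h2, h3⟩
    refine ⟨fun k hk => ⟨h1 k hk, (h2 k hk).2⟩, fun k hk => ?_⟩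
    rw [← h3 k hk, Finset.piecewise_eq_of_notMem _ _ _ hk]
  · rintro ⟨h1, h2⟩
    refine ⟨fun k hk => (h1 k hk).1, fun k hk => ⟨?_, (h1 k hk).2⟩, fun k hk => ?_⟩
    · exact Finset.piecewise_eq_of_mem _ _ _ hk
    · rw [Finset.piecewise_eq_of_notMem _ _ _ hk]; exact h2 k hk

/-- An operator on `S` times an operator on a pair of sites that overlaps with `S` in one site is an
operator on the larger set of sites. -/
lemma siteUnit_insert {S : Finset κ} {j k : κ} (hj : j ∈ S) (hk : k ∉ S) (x y : κ → D) :
    siteUnit S x y * siteUnit {j, k} (Function.update y k (x k)) y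
      = siteUnit (insert k S) x y := by
  have hjk : j ≠ k := fun e => hk (e ▸ hj)
  ext u v
  rw [siteUnit_mul_apply]
  simp only [siteUnit, Matrix.of_apply]
  rw [← ite_and]
  congr 1
  rw [eq_iff_iff]
  simp only [Finset.mem_insert, Finset.mem_singleton, forall_eq_or_imp, forall_eq,
    Function.update_self, Function.update_of_ne hjk, not_or,
    Finset.piecewise_eq_of_mem _ _ _ hj, Finset.piecewise_eq_of_notMem _ _ _ hk]
  constructor
  · rintro ⟨h1, ⟨⟨-, h2⟩, h3, h4⟩, h5⟩
    refine ⟨⟨⟨h3, h4⟩, fun l hl => ⟨h1 l hl, ?_⟩⟩, fun l ⟨hlk, hl⟩ => ?_⟩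
    · by_cases hlj : l = j
      · rw [hlj]; exact h2
      · rw [← h5 l ⟨hlj, fun e => hk (e ▸ hl)⟩, Finset.piecewise_eq_of_mem _ _ _ hl]
    · rw [← h5 l ⟨fun e => hl (e ▸ hj), hlk⟩, Finset.piecewise_eq_of_notMem _ _ _ hl]
  · rintro ⟨⟨⟨h3, h4⟩, h1⟩, h5⟩
    refine ⟨fun l hl => (h1 l hl).1, ⟨⟨trivial, (h1 j hj).2⟩, h3, h4⟩, fun l ⟨hlj, hlk⟩ => ?_⟩
    by_cases hl : l ∈ S
    · rw [Finset.piecewise_eq_of_mem _ _ _ hl]; exact (h1 l hl).2.symm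
    · rw [Finset.piecewise_eq_of_notMem _ _ _ hl]; exact h5 l ⟨hlk, hl⟩

omit [Fintype D] in
lemma one_add_smul_siteUnit_pair {i j : κ} (x y : κ → D) (c : ℂ) :
    1 + c • siteUnit {i, j} x y
      = gate2 i j (1 + c • Matrix.single (x i, x j) (y i, y j) (1 : ℂ)) := by
  ext u v
  simp only [siteUnit, gate2, Matrix.of_apply, Matrix.add_apply, Matrix.smul_apply,
    Matrix.one_apply, Matrix.single_apply, Finset.mem_insert, Finset.mem_singleton,
    forall_eq_or_imp, forall_eq, not_or, Prod.mk.injEq, smul_eq_mul, add_mul]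
  congr 1
  · rw [ite_zero_mul_ite_zero, mul_one]
    congr 1
    rw [eq_iff_iff]
    constructor
    · rintro rfl
      exact ⟨⟨rfl, rfl⟩, fun _ _ _ => rfl⟩
    · rintro ⟨⟨h1, h2⟩, h3⟩
      ext k
      by_cases hi : k = i
      · rw [hi, h1]
      · by_cases hj : k = j
        · rw [hj, h2]
        · exact h3 k hi hj
  · rw [mul_assoc, ite_zero_mul_ite_zero, mul_one]
    congr 2
    rw [eq_iff_iff]
    constructor
    · rintro ⟨⟨⟨h1, h2⟩, h3, h4⟩, h5⟩
      exact ⟨⟨⟨h1.symm, h3.symm⟩, h2.symm, h4.symm⟩, fun k h h' => h5 k ⟨h, h'⟩⟩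
    · rintro ⟨⟨⟨h1, h3⟩, h2, h4⟩, h5⟩
      exact ⟨⟨⟨h1.symm, h2.symm⟩, h3.symm, h4.symm⟩, fun k h => h5 k h.1 h.2⟩

/-- Transvections on pairs of sites generate the transvections on all sets of sites. -/
lemma one_add_smul_siteUnit_mem (hD : 2 ≤ Fintype.card D)
    {M : Submonoid (Matrix (κ → D) (κ → D) ℂ)}
    (hM : ∀ i j : κ, i ≠ j → ∀ p q : D × D, p ≠ q → ∀ c : ℂ,
      gate2 i j (1 + c • Matrix.single p q (1 : ℂ)) ∈ M) :
    ∀ (n : ℕ) (S : Finset κ), S.card = n + 2 → ∀ x y : κ → D, (∃ k ∈ S, x k ≠ y k) → ∀ c : ℂ,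
      1 + c • siteUnit S x y ∈ M := by
  intro n
  induction n with
  | zero =>
    rintro S hS x y ⟨k, hk, hxy⟩ c
    obtain ⟨i, j, hij, rfl⟩ := Finset.card_eq_two.1 hS
    rw [one_add_smul_siteUnit_pair]
    refine hM i j hij _ _ (fun e => ?_) c
    rw [Prod.mk.injEq] at e
    rcases Finset.mem_insert.1 hk with rfl | hk
    · exact hxy e.1
    · rw [Finset.mem_singleton.1 hk] at hxy
      exact hxy e.2
  | succ n ih =>
    intro R hR
    -- States that differ at `j` and `k`: a commutator of a transvection on `R \ {k}` and one on
    -- `{j, k}`.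
    have key : ∀ x y : κ → D, (∃ j ∈ R, ∃ k ∈ R, j ≠ k ∧ x j ≠ y j ∧ x k ≠ y k) → ∀ c : ℂ,
        1 + c • siteUnit R x y ∈ M := by
      rintro x y ⟨j, hj, k, hk, hjk, hxj, hxk⟩
      have hjS : j ∈ R.erase k := Finset.mem_erase.2 ⟨hjk, hj⟩
      have hins : insert k (R.erase k) = R := Finset.insert_erase hk
      have hcard : (R.erase k).card = n + 2 := by
        rw [Finset.card_erase_of_mem hk, hR]; rfl
      rw [← hins, ← siteUnit_insert hjS (Finset.notMem_erase k R)]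
      refine one_add_smul_mul_mem (fun c => ih _ hcard x y ⟨j, hjS, hxj⟩ c) (fun c => ?_) ?_ ?_ ?_
      · rw [one_add_smul_siteUnit_pair]
        refine hM j k hjk _ _ (fun e => ?_) c
        rw [Prod.mk.injEq, Function.update_self] at e
        exact hxk e.2
      · exact siteUnit_mul_eq_zero ⟨j, hjS, hjS, hxj.symm⟩
      · refine siteUnit_mul_eq_zero ⟨k, by simp, by simp, ?_⟩
        rw [Function.update_self]; exact hxk.symm
      · exact siteUnit_mul_eq_zero ⟨j, by simp, hjS, hxj.symm⟩
    rintro x y ⟨i, hi, hxy⟩ c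
    by_cases h2 : ∃ j ∈ R, ∃ k ∈ R, j ≠ k ∧ x j ≠ y j ∧ x k ≠ y k
    · exact key x y h2 c
    -- States that differ at `i` only: pass through a state `w` that differs from both of them at two
    -- sites other than `i`.
    have hsame : ∀ k ∈ R, k ≠ i → x k = y k := by
      intro k hk hki
      by_contra hne
      exact h2 ⟨i, hi, k, hk, hki.symm, hxy, hne⟩
    have : Nontrivial D := Fintype.one_lt_card_iff_nontrivial.1 hD
    choose o ho using fun a : D => exists_ne a
    obtain ⟨j, hj, k, hk, hjk⟩ : ∃ j ∈ R.erase i, ∃ k ∈ R.erase i, j ≠ k := by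
      refine Finset.one_lt_card.1 ?_
      rw [Finset.card_erase_of_mem hi, hR]
      omega
    rw [Finset.mem_erase] at hj hk
    let w : κ → D := fun l => o (x l)
    have hw : ∀ l ∈ R, x l ≠ w l := fun l _ => (ho _).symm
    have hw' : ∀ l ∈ R, l ≠ i → w l ≠ y l := fun l hl hli => by
      rw [← hsame l hl hli]; exact ho _
    rw [← siteUnit_mul_siteUnit R x w y]
    refine one_add_smul_mul_mem
      (key x w ⟨j, hj.2, k, hk.2, hjk, hw j hj.2, hw k hk.2⟩)
      (key w y ⟨j, hj.2, k, hk.2, hjk, hw' j hj.2 hj.1, hw' k hk.2 hk.1⟩)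
      (siteUnit_mul_eq_zero ⟨j, hj.2, hj.2, (hw j hj.2).symm⟩)
      (siteUnit_mul_eq_zero ⟨j, hj.2, hj.2, (hw' j hj.2 hj.1).symm⟩)
      (siteUnit_mul_eq_zero ⟨i, hi, hi, hxy.symm⟩) c

end Units

section Generation

variable {X : Type*} [Fintype X] [DecidableEq X]

/-- A submonoid that contains all transvections contains the matrices of determinant one. -/
lemma mem_of_transvections {M : Submonoid (Matrix X X ℂ)}
    (hM : ∀ x y : X, x ≠ y → ∀ c : ℂ, 1 + c • Matrix.single x y (1 : ℂ) ∈ M) {A : Matrix X X ℂ}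
    (hA : A.det = 1) : A ∈ M := by
  refine diagonal_transvection_induction (· ∈ M) A (fun d hd => ?_) (fun t => ?_)
    fun A B => mul_mem
  · rw [hA, det_diagonal] at hd
    have hd0 : ∀ x, d x ≠ 0 := fun x h => by
      rw [Finset.prod_eq_zero (Finset.mem_univ x) h] at hd
      exact zero_ne_one hd
    rcases isEmpty_or_nonempty X with hX | ⟨⟨x₀⟩⟩
    · rw [Subsingleton.elim (diagonal d) 1]; exact one_mem _
    -- The diagonal entries are built up one by one, and compensated at `x₀`.
    have key : ∀ T : Finset X, x₀ ∉ T → diagonal (fun x => if x ∈ T then d x else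
        if x = x₀ then ∏ y ∈ T, (d y)⁻¹ else 1) ∈ M := by
      intro T
      induction T using Finset.induction_on with
      | empty =>
        intro _
        convert one_mem M
        rw [← diagonal_one]
        congr 1
        ext x
        simp
      | insert a T ha ih =>
        intro hx₀
        rw [Finset.mem_insert, not_or] at hx₀
        have hax : a ≠ x₀ := fun e => hx₀.1 e.symm
        have h1 := one_add_mem_of_transvections (hM a x₀ hax) (hM x₀ a hax.symm)
          (by simp [hax.symm]) (by simp [hax]) (by simp) (by simp) (hd0 a)
        have h2 := mul_mem h1 (ih hx₀.2)
        convert h2 using 1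
        have e : (1 : Matrix X X ℂ) + (d a - 1) • (Matrix.single a x₀ 1 * Matrix.single x₀ a 1)
            + ((d a)⁻¹ - 1) • (Matrix.single x₀ a 1 * Matrix.single a x₀ 1)
            = diagonal fun x => if x = a then d a else if x = x₀ then (d a)⁻¹ else 1 := by
          rw [single_mul_single_same, single_mul_single_same, ← diagonal_single,
            ← diagonal_single, ← diagonal_one, ← diagonal_smul, ← diagonal_smul, diagonal_add,
            diagonal_add]
          congr 1
          ext x
          by_cases hxa : x = a
          · subst hxa; simp [hax]
          · by_cases hx : x = x₀
            · subst hx; simp [hxa]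
            · simp [hxa, hx]
        rw [e, diagonal_mul_diagonal]
        congr 1
        ext x
        by_cases hxa : x = a
        · subst hxa; simp [ha, hax]
        · by_cases hx : x = x₀
          · subst hx; simp [hxa, hx₀.2, Finset.prod_insert ha]
          · simp [hxa, hx]
    have e : d = fun x => if x ∈ Finset.univ.erase x₀ then d x else
        if x = x₀ then ∏ y ∈ Finset.univ.erase x₀, (d y)⁻¹ else 1 := by
      ext x
      by_cases hx : x = x₀
      · subst hx
        rw [if_neg (by simp), if_pos rfl, Finset.prod_inv_distrib]
        rw [← Finset.mul_prod_erase _ _ (Finset.mem_univ x)] at hd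
        exact eq_inv_of_mul_eq_one_left hd
      · simp [hx]
    rw [e]
    exact key (Finset.univ.erase x₀) (by simp)
  · have := hM t.i t.j t.hij t.c
    rwa [smul_single, smul_eq_mul, mul_one] at this

end Generation

end

end RandomCircuit

namespace RandomCircuit

noncomputable section

section Continuation

variable {Q : Type*} [Fintype Q] [DecidableEq Q]

open scoped Matrix.Norms.L2Operator in
/-- A holomorphic function of matrices that vanishes on the unitaries vanishes on all exponentials:
on the line `s ↦ exp (K₁ + s K₂)` with `K₁`, `K₂` skew-adjoint it vanishes for real `s`, and every
matrix is of the form `K₁ + i K₂`. -/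
lemma eq_zero_exp_of_unitary {f : Matrix Q Q ℂ → ℂ}
    (hf : ∀ A : ℂ → Matrix Q Q ℂ, (∀ i j, Differentiable ℂ fun s => A s i j) →
      Differentiable ℂ fun s => f (A s))
    (h0 : ∀ U ∈ unitaryGroup Q ℂ, f U = 0) (N : Matrix Q Q ℂ) : f (NormedSpace.exp N) = 0 := by
  let +nondep : NormedAlgebra ℚ (Matrix Q Q ℂ) := .restrictScalars ℚ ℂ _
  set K₁ : Matrix Q Q ℂ := (1 / 2 : ℂ) • (N - star N) with hK₁
  set K₂ : Matrix Q Q ℂ := (-Complex.I / 2) • (N + star N) with hK₂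
  have h1 : star K₁ = -K₁ := by
    rw [hK₁, star_smul, star_sub, star_star, ← smul_neg, neg_sub]
    simp
  have h2 : star K₂ = -K₂ := by
    rw [hK₂, star_smul, star_add, star_star, add_comm, ← neg_smul]
    congr 1
    simp [neg_div]
  have hN : K₁ + Complex.I • K₂ = N := by
    rw [hK₁, hK₂, smul_smul]
    have : Complex.I * (-Complex.I / 2) = 1 / 2 := by
      rw [← mul_div_assoc, mul_neg, Complex.I_mul_I, neg_neg]
    rw [this]
    module
  have hd : Differentiable ℂ fun s : ℂ => f (NormedSpace.exp (K₁ + s • K₂)) := by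
    apply hf
    intro i j
    have h3 : Differentiable ℂ fun s : ℂ => NormedSpace.exp (K₁ + s • K₂) := by
      intro s
      have := (NormedSpace.exp_analytic (𝕂 := ℂ) (K₁ + s • K₂)).differentiableAt
      exact this.comp s (by fun_prop)
    let φ : Matrix Q Q ℂ →ₗ[ℂ] ℂ := Matrix.entryLinearMap ℂ ℂ i j
    exact (LinearMap.toContinuousLinearMap φ).differentiable.comp h3
  have hreal : ∀ r : ℝ, f (NormedSpace.exp (K₁ + (r : ℂ) • K₂)) = 0 := by
    intro r
    apply h0
    apply NormedSpace.exp_mem_unitary_of_mem_skewAdjoint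
    clear_value K₁ K₂
    rw [skewAdjoint.mem_iff, star_add, star_smul, h1, h2]
    simp [add_comm]
  have hzero : (fun s : ℂ => f (NormedSpace.exp (K₁ + s • K₂))) = fun _ => 0 := by
    refine AnalyticOnNhd.eq_of_frequently_eq (z₀ := (0 : ℂ))
      (fun s _ => hd.analyticAt s) (fun s _ => analyticAt_const) ?_
    have h4 : Filter.Tendsto (fun n : ℕ => (((1 / ((n : ℝ) + 1) : ℝ)) : ℂ)) Filter.atTop
        (nhdsWithin 0 {0}ᶜ) := by
      refine tendsto_nhdsWithin_iff.2 ⟨?_, Filter.Eventually.of_forall fun n => ?_⟩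
      · rw [← Complex.ofReal_zero]
        exact (Complex.continuous_ofReal.tendsto 0).comp tendsto_one_div_add_atTop_nhds_zero_nat
      · rw [Set.mem_compl_iff, Set.mem_singleton_iff, Complex.ofReal_eq_zero]
        positivity
    exact h4.frequently (Filter.Frequently.of_forall fun n => hreal _)
  have := congrFun hzero Complex.I
  rwa [hN] at this

open scoped Matrix.Norms.L2Operator in
lemma exp_of_mul_self_eq_zero {N : Matrix Q Q ℂ} (h : N * N = 0) : NormedSpace.exp N = 1 + N := by
  rw [NormedSpace.exp_eq_tsum ℂ]
  change ∑' n : ℕ, ((n.factorial : ℂ)⁻¹ • N ^ n) = 1 + N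
  rw [tsum_eq_sum (s := Finset.range 2)]
  · simp [Finset.sum_range_succ]
  · intro n hn
    obtain ⟨m, rfl⟩ := Nat.exists_eq_add_of_le' (not_lt.1 (by simpa only [Finset.mem_range] using hn))
    rw [pow_add, sq, h, mul_zero, smul_zero]

end Continuation

section Universality

/-- A homogeneous polynomial (more generally, holomorphic) representation of the multiplicative
monoid of matrices. -/
structure PolyRep (X Y : Type*) [Fintype X] [DecidableEq X] [Fintype Y] [DecidableEq Y] where
  hom : Matrix X X ℂ →* Matrix Y Y ℂ
  deg : ℕ
  hom_smul : ∀ (c : ℂ) A, hom (c • A) = c ^ deg • hom A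
  differentiable : ∀ A : ℂ → Matrix X X ℂ, (∀ i j, Differentiable ℂ fun s => A s i j) →
    ∀ x y, Differentiable ℂ fun s => hom (A s) x y

variable {κ D Y : Type*} [Fintype κ] [DecidableEq κ] [Fintype D] [DecidableEq D] [Fintype Y]
  [DecidableEq Y]

/-- Universality of two-site gates: in a polynomial representation, an operator that commutes with
all unitary gates on pairs of sites commutes with all unitaries. By analytic continuation it commutes
with the transvections on pairs of sites, and these generate all matrices of determinant one. -/
theorem PolyRep.commute_of_gates (ρ : PolyRep (κ → D) Y) (hκ : 2 ≤ Fintype.card κ)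
    (hD : 2 ≤ Fintype.card D) {W : Matrix Y Y ℂ}
    (h : ∀ i j : κ, i ≠ j → ∀ g ∈ unitaryGroup (D × D) ℂ, Commute (ρ.hom (gate2 i j g)) W)
    (A : Matrix (κ → D) (κ → D) ℂ) (hA : A.det ≠ 0) : Commute (ρ.hom A) W := by
  have : Nonempty D := Fintype.card_pos_iff.1 (by omega)
  let M : Submonoid (Matrix (κ → D) (κ → D) ℂ) := (Submonoid.centralizer {W}).comap ρ.hom
  have hmem : ∀ {A}, A ∈ M ↔ Commute (ρ.hom A) W := by
    intro A
    rw [Submonoid.mem_comap, Submonoid.mem_centralizer_iff]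
    simp [Commute, SemiconjBy, eq_comm]
  have hpair : ∀ i j : κ, i ≠ j → ∀ p q : D × D, p ≠ q → ∀ c : ℂ,
      gate2 i j (1 + c • Matrix.single p q (1 : ℂ)) ∈ M := by
    intro i j hij p q hpq c
    have hN : (c • Matrix.single p q (1 : ℂ)) * (c • Matrix.single p q (1 : ℂ)) = 0 := by
      rw [smul_mul_assoc, mul_smul_comm, single_mul_single_of_ne _ _ _ _ hpq.symm, smul_zero,
        smul_zero]
    rw [hmem, ← exp_of_mul_self_eq_zero hN, Commute, SemiconjBy, ← sub_eq_zero]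
    ext x y
    refine eq_zero_exp_of_unitary (f := fun B => (ρ.hom (gate2 i j B) * W
      - W * ρ.hom (gate2 i j B)) x y) ?_ ?_ _
    · intro B hB
      have hg : ∀ x y, Differentiable ℂ fun s => ρ.hom (gate2 i j (B s)) x y := by
        apply ρ.differentiable
        intro u v
        simp only [gate2, Matrix.of_apply]
        exact (hB _ _).mul_const _
      simp only [Matrix.sub_apply, Matrix.mul_apply]
      exact (Differentiable.fun_sum fun k _ => (hg _ _).mul_const _).sub
        (Differentiable.fun_sum fun k _ => (hg _ _).const_mul _)
    · intro U hU
      have := (h i j hij U hU).eq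
      simp only [this, sub_self, Matrix.zero_apply]
  have htrans : ∀ x y : κ → D, x ≠ y → ∀ c : ℂ, 1 + c • Matrix.single x y (1 : ℂ) ∈ M := by
    intro x y hxy c
    obtain ⟨k, hk⟩ := Function.ne_iff.1 hxy
    have e : Matrix.single x y (1 : ℂ) = siteUnit Finset.univ x y := by
      ext u v
      simp only [Matrix.single_apply, siteUnit, Matrix.of_apply, Finset.mem_univ, true_imp_iff,
        not_true_eq_false, false_imp_iff, implies_true, and_true, forall_and]
      congr 1
      rw [eq_iff_iff, ← funext_iff, ← funext_iff, eq_comm, eq_comm (a := y)]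
    rw [e]
    exact one_add_smul_siteUnit_mem hD hpair (Fintype.card κ - 2) Finset.univ
      (by rw [Finset.card_univ]; omega) x y ⟨k, Finset.mem_univ k, hk⟩ c
  -- By homogeneity, `A` may be rescaled to determinant one.
  obtain ⟨c, hc⟩ := IsAlgClosed.exists_pow_nat_eq A.det
    (Fintype.card_pos : 0 < Fintype.card (κ → D))
  have hc0 : c ≠ 0 := by
    rintro rfl
    rw [zero_pow Fintype.card_ne_zero] at hc
    exact hA hc.symm
  have h1 : c⁻¹ • A ∈ M := by
    refine mem_of_transvections htrans ?_
    rw [det_smul, ← hc, inv_pow, inv_mul_cancel₀ (pow_ne_zero _ hc0)]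
  have e : A = c • c⁻¹ • A := by rw [smul_smul, mul_inv_cancel₀ hc0, one_smul]
  rw [e, ρ.hom_smul]
  exact (hmem.1 h1).smul_left _

end Universality

section Invariants

variable {X X' Z : Type*} [Fintype X] [DecidableEq X] [Fintype X'] [DecidableEq X'] [Fintype Z]
  [DecidableEq Z] (t : ℕ)

/-- The polynomial representation `A ↦ (A ⊗ 1)^{⊗t}`. -/
def ampRep (e : X' ≃ X × Z) : PolyRep X (Fin t → X') where
  hom :=
    { toFun := fun A => tens t (amp e A)
      map_one' := by rw [amp_one, tens_one]
      map_mul' := fun A B => by rw [amp_mul, tens_mul] }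
  deg := t
  hom_smul c A := by
    have : amp e (c • A) = c • amp e A := by
      ext x y
      simp only [amp_apply, Matrix.smul_apply, smul_eq_mul, mul_assoc]
    change tens t (amp e (c • A)) = c ^ t • tens t (amp e A)
    rw [this, tens_smul]
  differentiable A hA x y := by
    change Differentiable ℂ fun s => ∏ a, amp e (A s) (x a) (y a)
    simp only [amp_apply]
    exact Differentiable.fun_finsetProd fun a _ => (hA _ _).mul_const _

/-- A vector of the representation space, as an operator. -/
def toOp {t : ℕ} (w : RepSpace t X) : Matrix (Fin t → X) (Fin t → X) ℂ :=
  Matrix.of fun x y => w (x, y)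

omit [DecidableEq X] in
lemma toOp_injective : Function.Injective (toOp : RepSpace t X → _) := by
  intro w w' h
  ext x
  exact congrFun (congrFun h x.1) x.2

lemma toOp_rep (A : Matrix X X ℂ) (w : RepSpace t X) :
    toOp (rep t A w) = tens t A * toOp w * (tens t A)ᴴ := by
  ext x y
  have e : toOp (rep t A w) x y = (tensorPower t A *ᵥ w.ofLp) (x, y) := rfl
  rw [e, Matrix.mulVec, dotProduct, Fintype.sum_prod_type, Matrix.mul_apply, Finset.sum_comm]
  refine Finset.sum_congr rfl fun y' _ => ?_
  rw [Matrix.mul_apply, Finset.sum_mul]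
  refine Finset.sum_congr rfl fun x' _ => ?_
  simp only [tensorPower_eq, Matrix.kroneckerMap_apply, Matrix.map_apply,
    Matrix.conjTranspose_apply, toOp, Matrix.of_apply]
  ring

/-- A vector is invariant under a unitary if and only if the corresponding operator commutes with
the tensor power of the unitary. -/
lemma rep_apply_eq_self_iff {U : Matrix X X ℂ} (hU : U ∈ unitaryGroup X ℂ) (w : RepSpace t X) :
    rep t U w = w ↔ Commute (tens t U) (toOp w) := by
  have h1 : tens t U * (tens t U)ᴴ = 1 := by
    rw [← tens_conjTranspose, ← tens_mul, ← star_eq_conjTranspose, mem_unitaryGroup_iff.1 hU,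
      tens_one]
  have h2 : (tens t U)ᴴ * tens t U = 1 := by
    rw [← tens_conjTranspose, ← tens_mul, ← star_eq_conjTranspose, mem_unitaryGroup_iff'.1 hU,
      tens_one]
  rw [← (toOp_injective t).eq_iff, toOp_rep, Commute, SemiconjBy]
  constructor
  · intro h
    conv_rhs => rw [← h]
    rw [mul_assoc _ _ (tens t U), h2, mul_one]
  · intro h
    rw [h, mul_assoc, h1, mul_one]

variable {κ D : Type*} [Fintype κ] [DecidableEq κ] [Fintype D] [DecidableEq D]

/-- A vector that is invariant under all gates on pairs of sites in `κ` is invariant under all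
unitaries on `κ`. -/
theorem rep_amp_apply_eq_self (e : X' ≃ (κ → D) × Z) (hκ : 2 ≤ Fintype.card κ)
    (hD : 2 ≤ Fintype.card D) {w : RepSpace t X'}
    (h : ∀ i j : κ, i ≠ j → ∀ g : unitaryGroup (D × D) ℂ,
      rep t (amp e (gate2 i j (g : Matrix (D × D) (D × D) ℂ))) w = w)
    (U : unitaryGroup (κ → D) ℂ) : rep t (amp e (U : Matrix (κ → D) (κ → D) ℂ)) w = w := by
  refine (rep_apply_eq_self_iff t (ampU e U).2 w).2 ?_
  refine (ampRep t e).commute_of_gates hκ hD (fun i j hij g hg => ?_) _ ?_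
  · have hu : gate2 i j g ∈ unitaryGroup (κ → D) ℂ := by
      rw [gate2_eq_amp hij]
      exact (ampU (pairEquiv hij) ⟨g, hg⟩).2
    exact (rep_apply_eq_self_iff t (ampU e ⟨_, hu⟩).2 w).1 (h i j hij ⟨g, hg⟩)
  · have := congrArg Matrix.det (mem_unitaryGroup_iff.1 U.2)
    rw [det_mul, det_one] at this
    exact left_ne_zero_of_mul_eq_one this

end Invariants

/-! ### The invariants of gates on a pair of sites -/

section PairInvariants

variable {ι D : Type*} [Fintype ι] [DecidableEq ι] [Fintype D] [DecidableEq D] (t : ℕ)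

variable (D) in
/-- The vectors that are invariant under all gates on the sites `i`, `j`; by convention, all vectors
for `i = j`. -/
def pairFix (i j : ι) : Submodule ℂ (RepSpace t (ι → D)) :=
  if i = j then ⊤
  else fixSpace t fun g : unitaryGroup (D × D) ℂ => gate2 i j (g : Matrix (D × D) (D × D) ℂ)

lemma pairFix_self (i : ι) : pairFix D t i i = ⊤ := if_pos rfl

lemma pairFix_of_ne {i j : ι} (h : i ≠ j) : pairFix D t i j
    = fixSpace t fun g : unitaryGroup (D × D) ℂ => gate2 i j (g : Matrix (D × D) (D × D) ℂ) :=
  if_neg h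

lemma pairFix_le_symm (i j : ι) : pairFix D t i j ≤ pairFix D t j i := by
  by_cases h : i = j
  · rw [h]
  · rw [pairFix_of_ne t h, pairFix_of_ne t (Ne.symm h)]
    intro w hw g
    let e : (D × D) ≃ (D × D) × Unit := (Equiv.prodComm D D).trans (Equiv.prodPUnit _).symm
    have hg : gate2 j i (g : Matrix (D × D) (D × D) ℂ)
        = gate2 i j ((ampU e g : unitaryGroup (D × D) ℂ) : Matrix (D × D) (D × D) ℂ) := by
      rw [gate2_comm]
      congr 1
      ext x y
      change _ = amp e (g : Matrix (D × D) (D × D) ℂ) x y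
      simp [amp_apply, e]
    change rep t (gate2 j i (g : Matrix (D × D) (D × D) ℂ)) w = w
    rw [hg]
    exact hw _

lemma pairFix_symm (i j : ι) : pairFix D t i j = pairFix D t j i :=
  le_antisymm (pairFix_le_symm t i j) (pairFix_le_symm t j i)

/-- A gate on `i`, `k` is a gate on `i`, `j`, conjugated with the exchange of `j` and `k`. -/
lemma pairFix_trans (i j k : ι) : pairFix D t i j ⊓ pairFix D t j k ≤ pairFix D t i k := by
  by_cases hij : i = j
  · rw [hij]; exact inf_le_right
  by_cases hjk : j = k
  · rw [hjk]; exact inf_le_left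
  by_cases hik : i = k
  · rw [hik, pairFix_self]; exact le_top
  rw [pairFix_of_ne t hij, pairFix_of_ne t hjk, pairFix_of_ne t hik]
  intro w hw g
  have h1 : ∀ g : unitaryGroup (D × D) ℂ, rep t (gate2 i j (g : Matrix (D × D) (D × D) ℂ)) w = w :=
    hw.1
  have h2 : rep t (gate2 j k (swapGate D : Matrix (D × D) (D × D) ℂ)) w = w := hw.2 (swapGate D)
  change rep t (gate2 i k (g : Matrix (D × D) (D × D) ℂ)) w = w
  rw [gate2_eq_swap_mul hij hik hjk, rep_mul, rep_mul, mul_apply_eq_comp, mul_apply_eq_comp, h2,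
    h1, h2]

lemma commute_pairFix {p q : ι × ι} (h : PairDisjoint p q) :
    Commute (pr (pairFix D t p.1 p.2)) (pr (pairFix D t q.1 q.2)) := by
  by_cases hp : p.1 = p.2
  · rw [hp, pairFix_self, pr_top]; exact Commute.one_left _
  by_cases hq : q.1 = q.2
  · rw [hq, pairFix_self, pr_top]; exact Commute.one_right _
  rw [pairFix_of_ne t hp, pairFix_of_ne t hq]
  exact commute_pr_fixSpace (fun g g' => commute_gate2 h hp _ _)
    fun g => ⟨star g, star_gate2 hp _⟩

end PairInvariants

end

end RandomCircuit

namespace RandomCircuit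

noncomputable section

/-! ### Random gates and layers -/

section RandomUnitaries

variable {X Y : Type*} [Fintype X] [DecidableEq X] [Fintype Y] [DecidableEq Y] {t : ℕ}
  {θ : unitaryGroup Y ℂ →* unitaryGroup X ℂ} (hθ : Continuous θ)
  (ν : Measure (unitaryGroup Y ℂ)) [IsProbabilityMeasure ν]

include hθ in
lemma inner_mop_map (w v : RepSpace t X) : inner ℂ w (mop t (ν.map θ) v)
    = ∫ U, inner ℂ w (rep t (θ U : Matrix X X ℂ) v) ∂ν := by
  have : IsProbabilityMeasure (ν.map θ) :=
    Measure.isProbabilityMeasure_map hθ.measurable.aemeasurable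
  rw [inner_mop, integral_map hθ.measurable.aemeasurable
      (continuous_inner_rep t w v).aestronglyMeasurable]

include hθ in
lemma mop_map_mul_pr : mop t (ν.map θ) * pr (fixSpace t fun U => (θ U : Matrix X X ℂ))
    = pr (fixSpace t fun U => (θ U : Matrix X X ℂ)) := by
  ext1 v
  refine ext_inner_left ℂ fun w => ?_
  rw [mul_apply_eq_comp, inner_mop_map hθ]
  have h := Submodule.starProjection_apply_mem (fixSpace t fun U => (θ U : Matrix X X ℂ)) v
  simp only [mem_fixSpace.1 h]
  simp

include hθ in
lemma commute_mop_map {T : RepSpace t X →L[ℂ] RepSpace t X}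
    (h : ∀ U, Commute T (rep t (θ U : Matrix X X ℂ))) : Commute T (mop t (ν.map θ)) := by
  change T * _ = _ * T
  ext1 v
  refine ext_inner_left ℂ fun w => ?_
  rw [mul_apply_eq_comp, mul_apply_eq_comp, ← ContinuousLinearMap.adjoint_inner_left,
    inner_mop_map hθ, inner_mop_map hθ]
  congr 1
  ext U
  rw [ContinuousLinearMap.adjoint_inner_left, ← mul_apply_eq_comp, (h U).eq, mul_apply_eq_comp]

include hθ in
lemma pr_mul_mop_map : pr (fixSpace t fun U => (θ U : Matrix X X ℂ)) * mop t (ν.map θ)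
    = pr (fixSpace t fun U => (θ U : Matrix X X ℂ)) := by
  have hcomm : Commute (pr (fixSpace t fun U => (θ U : Matrix X X ℂ))) (mop t (ν.map θ)) := by
    refine commute_mop_map hθ ν fun U => ?_
    refine (commute_pr_of_mapsTo (fun v hv => by rwa [hv U]) fun v hv => ?_).symm
    have e : star (θ U : Matrix X X ℂ) = (θ (star U) : Matrix X X ℂ) := by
      have : θ (star U) = star (θ U) := by
        rw [Unitary.star_eq_inv, Unitary.star_eq_inv, map_inv]
      rw [this]; rfl
    rw [star_rep, e, hv (star U)]
    exact hv
  rw [hcomm.eq, mop_map_mul_pr hθ ν]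

end RandomUnitaries

section Gates

variable {N d : ℕ} (t : ℕ)

variable (d) in
/-- `onSites` as a homomorphism. -/
def onSitesHom (S : Finset (Fin N)) :
    unitaryGroup (S → Fin d) ℂ →* unitaryGroup (Fin N → Fin d) ℂ :=
  ampU (Equiv.piEquivPiSubtypeProd (fun k => k ∈ S) fun _ => Fin d)

lemma continuous_onSitesHom (S : Finset (Fin N)) : Continuous (onSitesHom d S) := continuous_ampU _

/-- The index set of a gate on two sites is a product. -/
def pairIndexEquiv {i j : Fin N} (h : i ≠ j) :
    (({i, j} : Finset (Fin N)) → Fin d) ≃ Fin d × Fin d where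
  toFun x := (x ⟨i, by simp⟩, x ⟨j, by simp⟩)
  invFun p k := if k.1 = i then p.1 else p.2
  left_inv x := by
    ext k
    obtain ⟨k, hk⟩ := k
    rcases Finset.mem_insert.1 hk with rfl | hk'
    · simp
    · obtain rfl := Finset.mem_singleton.1 hk'
      simp [h.symm]
  right_inv p := by simp [h.symm]

lemma onSites_eq_gate2 {i j : Fin N} (h : i ≠ j)
    (U : unitaryGroup (({i, j} : Finset (Fin N)) → Fin d) ℂ) :
    ∃ g : unitaryGroup (Fin d × Fin d) ℂ, (g : Matrix (Fin d × Fin d) (Fin d × Fin d) ℂ)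
      = (U.1 : Matrix (({i, j} : Finset (Fin N)) → Fin d) _ ℂ).submatrix
        (pairIndexEquiv h).symm (pairIndexEquiv h).symm ∧
      (onSites {i, j} U : Matrix (Fin N → Fin d) (Fin N → Fin d) ℂ)
        = gate2 i j (g : Matrix (Fin d × Fin d) (Fin d × Fin d) ℂ) := by
  let e : Fin d × Fin d ≃ (({i, j} : Finset (Fin N)) → Fin d) × Unit :=
    (pairIndexEquiv h).symm.trans (Equiv.prodPUnit _).symm
  have he : ((ampU e U : unitaryGroup (Fin d × Fin d) ℂ) : Matrix (Fin d × Fin d) _ ℂ)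
      = U.1.submatrix (pairIndexEquiv h).symm (pairIndexEquiv h).symm := by
    ext x y
    change amp e U.1 x y = _
    simp [amp_apply, e]
  refine ⟨ampU e U, he, ?_⟩
  rw [he]
  ext x y
  change amp _ U.1 x y = _
  simp only [amp_apply, gate2, Matrix.of_apply, Matrix.submatrix_apply]
  have hx : ∀ x : Fin N → Fin d, (pairIndexEquiv h).symm (x i, x j) =
      fun k : ({i, j} : Finset (Fin N)) => x k := by
    intro x
    rw [Equiv.symm_apply_eq]
    rfl
  rw [hx, hx]
  congr 2
  rw [eq_iff_iff, funext_iff]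
  simp [Equiv.piEquivPiSubtypeProd, Subtype.forall, not_or]

lemma fixSpace_onSites {S : Finset (Fin N)} {i j : Fin N} (h : i ≠ j) (hS : S = {i, j}) :
    fixSpace t (fun U : unitaryGroup (S → Fin d) ℂ =>
      (onSitesHom d S U : Matrix (Fin N → Fin d) (Fin N → Fin d) ℂ)) = pairFix (Fin d) t i j := by
  subst hS
  rw [pairFix_of_ne t h]
  apply le_antisymm
  · intro w hw g
    let e : (({i, j} : Finset (Fin N)) → Fin d) ≃ (Fin d × Fin d) × Unit :=
      (pairIndexEquiv h).trans (Equiv.prodPUnit _).symm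
    obtain ⟨g', hg', hU⟩ := onSites_eq_gate2 h (ampU e g)
    have hgg : g' = g := by
      apply Subtype.ext
      rw [hg']
      ext x y
      change amp e g.1 _ _ = _
      simp [amp_apply, e]
    have h1 := hw (ampU e g)
    change rep t (onSites {i, j} (ampU e g)).1 w = w at h1
    rw [hU, hgg] at h1
    exact h1
  · intro w hw U
    obtain ⟨g, -, hU⟩ := onSites_eq_gate2 h U
    change rep t (onSites {i, j} U).1 w = w
    rw [hU]
    exact hw g

/-- The vectors that are invariant under all unitaries on the sites of a gate. -/
def Gate.fix (g : Gate N d) : Submodule ℂ (RepSpace t (Fin N → Fin d)) :=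
  fixSpace t fun U => (onSitesHom d g.sites U : Matrix (Fin N → Fin d) (Fin N → Fin d) ℂ)

instance (g : Gate N d) : IsProbabilityMeasure g.globalLaw :=
  Measure.isProbabilityMeasure_map (continuous_onSitesHom g.sites).measurable.aemeasurable

lemma Gate.norm_mop_sub_le (g : Gate N d) :
    ‖mop t g.globalLaw - pr (g.fix t)‖ ≤ 1 - g.localGap t := by
  have h1 : mop t g.globalLaw - pr (g.fix t)
      = ampHom (tensEquiv t (Equiv.piEquivPiSubtypeProd (fun k => k ∈ g.sites) fun _ => Fin d))
        (mop t (g.law : Measure (unitaryGroup (g.sites → Fin d) ℂ)) - mop t (haarU _)) := by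
    rw [map_sub, ampHom_mop, ampHom_mop]
    congr 1
    exact (mop_map_haarU t (onSitesHom d g.sites) (continuous_onSitesHom _)).symm
  rw [h1, Gate.localGap, gap, sub_sub_cancel, opNorm_momentOp_sub]
  exact norm_ampHom_le _ _

lemma Gate.mop_mul_pr (g : Gate N d) : mop t g.globalLaw * pr (g.fix t) = pr (g.fix t) :=
  mop_map_mul_pr (continuous_onSitesHom g.sites) _

lemma Gate.pr_mul_mop (g : Gate N d) : pr (g.fix t) * mop t g.globalLaw = pr (g.fix t) :=
  pr_mul_mop_map (continuous_onSitesHom g.sites) _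

lemma commute_onSites {S T : Finset (Fin N)} (hS : S.card = 2) (hT : T.card = 2)
    (h : Disjoint S T) (U : unitaryGroup (S → Fin d) ℂ) (V : unitaryGroup (T → Fin d) ℂ) :
    Commute (onSites S U : Matrix (Fin N → Fin d) (Fin N → Fin d) ℂ) (onSites T V) := by
  obtain ⟨i, j, hij, rfl⟩ := Finset.card_eq_two.1 hS
  obtain ⟨k, l, hkl, rfl⟩ := Finset.card_eq_two.1 hT
  obtain ⟨g, -, hg⟩ := onSites_eq_gate2 hij U
  obtain ⟨g', -, hg'⟩ := onSites_eq_gate2 hkl V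
  rw [hg, hg']
  refine commute_gate2 (p := (i, j)) (q := (k, l)) ?_ hij _ _
  simp only [Finset.disjoint_insert_left, Finset.disjoint_singleton_left, Finset.mem_insert,
    Finset.mem_singleton, not_or] at h
  exact ⟨h.1.1, h.1.2, h.2.1, h.2.2⟩

lemma Gate.commute_mop_pr {g h : Gate N d} (hgh : Disjoint g.sites h.sites) :
    Commute (mop t g.globalLaw) (pr (h.fix t)) := by
  rw [Gate.fix, ← mop_map_haarU t (onSitesHom d h.sites) (continuous_onSitesHom _)]
  refine commute_mop_map (continuous_onSitesHom _) _ fun V => ?_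
  refine (commute_mop_map (θ := onSitesHom d g.sites) (continuous_onSitesHom _) _ fun U => ?_).symm
  rw [Commute, SemiconjBy, ← rep_mul, ← rep_mul]
  exact congrArg _ (commute_onSites g.card_sites h.card_sites hgh U V).symm.eq

lemma Gate.commute_pr_pr {g h : Gate N d} (hgh : Disjoint g.sites h.sites) :
    Commute (pr (g.fix t)) (pr (h.fix t)) := by
  rw [Gate.fix, ← mop_map_haarU t (onSitesHom d g.sites) (continuous_onSitesHom _)]
  exact Gate.commute_mop_pr t (g := ⟨g.sites, g.card_sites, ⟨haarU _, inferInstance⟩⟩) hgh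

/-- The vectors that are invariant under all gates of a list. -/
def gatesFix : List (Gate N d) → Submodule ℂ (RepSpace t (Fin N → Fin d))
  | [] => ⊤
  | g :: l => g.fix t ⊓ gatesFix l

lemma mem_gatesFix {w : RepSpace t (Fin N → Fin d)} : ∀ {l : List (Gate N d)},
    w ∈ gatesFix t l ↔ ∀ g ∈ l, w ∈ g.fix t
  | [] => by simp [gatesFix]
  | g :: l => by
    rw [gatesFix, Submodule.mem_inf, mem_gatesFix, List.forall_mem_cons]

lemma commute_pr_gatesFix {T : RepSpace t (Fin N → Fin d) →L[ℂ] RepSpace t (Fin N → Fin d)} :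
    ∀ {l : List (Gate N d)}, (l.Pairwise fun g h => Disjoint g.sites h.sites) →
      (∀ h ∈ l, Commute T (pr (h.fix t))) → Commute T (pr (gatesFix t l))
  | [], _, _ => by rw [gatesFix, pr_top]; exact Commute.one_right _
  | g :: l, hl, h => by
    rw [List.pairwise_cons] at hl
    have h1 : Commute (pr (g.fix t)) (pr (gatesFix t l)) :=
      commute_pr_gatesFix hl.2 fun k hk => Gate.commute_pr_pr t (hl.1 k hk)
    rw [gatesFix, ← pr_mul_pr_of_commute h1]
    exact (h g (by simp)).mul_right (commute_pr_gatesFix hl.2 fun k hk => h k (by simp [hk]))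

/-- The product of independent gates on disjoint pairs of sites is at least as close to the
projection onto the common invariants as the worst of the gates. -/
lemma gates_prod : ∀ {l : List (Gate N d)}, (l.Pairwise fun g h => Disjoint g.sites h.sites) →
    (l.map fun g => mop t g.globalLaw).prod * pr (gatesFix t l) = pr (gatesFix t l) ∧
    pr (gatesFix t l) * (l.map fun g => mop t g.globalLaw).prod = pr (gatesFix t l) ∧
    ∀ c : ℝ, 0 ≤ c → (∀ g ∈ l, 1 - g.localGap t ≤ c) →
      ‖(l.map fun g => mop t g.globalLaw).prod - pr (gatesFix t l)‖ ≤ c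
  | [], _ => by
    simp only [List.map_nil, List.prod_nil, gatesFix, pr_top, mul_one, sub_self, norm_zero,
      true_and]
    exact fun c hc _ => hc
  | g :: l, hl => by
    rw [List.pairwise_cons] at hl
    obtain ⟨h1, h2, h3⟩ := gates_prod hl.2
    have hK : Commute (pr (g.fix t)) (pr (gatesFix t l)) :=
      commute_pr_gatesFix t hl.2 fun k hk => Gate.commute_pr_pr t (hl.1 k hk)
    have hA : Commute (mop t g.globalLaw) (pr (gatesFix t l)) :=
      commute_pr_gatesFix t hl.2 fun k hk => Gate.commute_mop_pr t (hl.1 k hk)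
    rw [List.map_cons, List.prod_cons, gatesFix, ← pr_mul_pr_of_commute hK]
    refine ⟨?_, ?_, fun c hc h => ?_⟩
    · rw [hK.eq, mul_assoc, ← mul_assoc _ (pr (gatesFix t l)), h1, ← hK.eq, ← mul_assoc,
        g.mop_mul_pr]
    · rw [mul_assoc, ← mul_assoc (pr (gatesFix t l)), ← hA.eq, mul_assoc, h2, ← mul_assoc,
        g.pr_mul_mop]
    · exact norm_mul_sub_mul_le (norm_mop_le t _) hA hK h1 h2
        ((g.norm_mop_sub_le t).trans (h g (by simp))) (h3 c hc fun k hk => h k (by simp [hk]))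

lemma isProbabilityMeasure_of_mem_map {l : List (Gate N d)} :
    ∀ ν ∈ l.map Gate.globalLaw, IsProbabilityMeasure ν := by
  intro ν hν
  obtain ⟨g, -, rfl⟩ := List.mem_map.1 hν
  infer_instance

instance (A : Layer N d) : IsProbabilityMeasure A.law :=
  isProbabilityMeasure_convList isProbabilityMeasure_of_mem_map

lemma mop_layer (A : Layer N d) :
    mop t A.law = (A.gates.map fun g => mop t g.globalLaw).prod := by
  rw [Layer.law, mop_convList t isProbabilityMeasure_of_mem_map, List.map_map]
  rfl

lemma isProbabilityMeasure_circuitLaw (C : ℕ → Layer N d) : ∀ L, IsProbabilityMeasure (circuitLaw C L)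
  | 0 => inferInstanceAs (IsProbabilityMeasure (Measure.dirac _))
  | L + 1 =>
    haveI := isProbabilityMeasure_circuitLaw C L
    inferInstanceAs (IsProbabilityMeasure (Measure.mconv (C L).law (circuitLaw C L)))

lemma mop_circuitLaw (C : ℕ → Layer N d) : ∀ L,
    mop t (circuitLaw C L) = opProd (fun k => mop t (C k).law) 0 L
  | 0 => mop_dirac_one t
  | L + 1 => by
    change mop t (Measure.mconv (C L).law (circuitLaw C L)) = mop t (C (0 + L)).law * _
    have := isProbabilityMeasure_circuitLaw C L
    rw [mop_mconv, mop_circuitLaw C L, zero_add]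

end Gates

end

end RandomCircuit

namespace RandomCircuit

noncomputable section

/-! ### The matching of a layer -/

section Partner

variable {N d : ℕ}

open Classical in
/-- The other site of the gate acting on the site `x`, and `x` itself if there is no such gate. -/
def Layer.partner (A : Layer N d) (x : Fin N) : Fin N :=
  if h : ∃ y, y ≠ x ∧ ∃ g ∈ A.gates, x ∈ g.sites ∧ y ∈ g.sites then h.choose else x

lemma Layer.partner_eq (A : Layer N d) {g : Gate N d} (hg : g ∈ A.gates) {x y : Fin N}
    (hx : x ∈ g.sites) (hy : y ∈ g.sites) (hxy : x ≠ y) : A.partner x = y := by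
  have h : ∃ y, y ≠ x ∧ ∃ g ∈ A.gates, x ∈ g.sites ∧ y ∈ g.sites := ⟨y, hxy.symm, g, hg, hx, hy⟩
  rw [Layer.partner, dif_pos h]
  obtain ⟨hne, g', hg', hx', hz⟩ := h.choose_spec
  have e : g = g' := by
    by_contra hne'
    have : Std.Symm (fun g h : Gate N d => Disjoint g.sites h.sites) := ⟨fun _ _ h => h.symm⟩
    have hdisj := A.disjoint.forall hg hg' hne'
    exact (Finset.disjoint_left.1 hdisj hx) hx'
  subst e
  by_contra hyz
  have h3 : ({x, y, h.choose} : Finset (Fin N)).card = 3 :=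
    Finset.card_eq_three.2 ⟨x, y, h.choose, hxy, hne.symm, fun e => hyz e.symm, rfl⟩
  have h4 : ({x, y, h.choose} : Finset (Fin N)) ⊆ g.sites := by
    intro z hz'
    simp only [Finset.mem_insert, Finset.mem_singleton] at hz'
    rcases hz' with rfl | rfl | rfl
    · exact hx
    · exact hy
    · exact hz
  have := Finset.card_le_card h4
  rw [h3, g.card_sites] at this
  omega

lemma Layer.exists_gate (A : Layer N d) {x : Fin N} (h : A.partner x ≠ x) :
    ∃ g ∈ A.gates, x ∈ g.sites ∧ A.partner x ∈ g.sites := by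
  by_cases hx : ∃ y, y ≠ x ∧ ∃ g ∈ A.gates, x ∈ g.sites ∧ y ∈ g.sites
  · rw [Layer.partner, dif_pos hx]
    exact hx.choose_spec.2
  · rw [Layer.partner, dif_neg hx] at h
    exact absurd rfl h

lemma Layer.partner_involutive (A : Layer N d) : Function.Involutive A.partner := by
  intro x
  by_cases h : A.partner x = x
  · rw [h, h]
  · obtain ⟨g, hg, h1, h2⟩ := A.exists_gate h
    exact A.partner_eq hg h2 h1 h

lemma Gate.sites_eq (g : Gate N d) {x y : Fin N} (hx : x ∈ g.sites) (hy : y ∈ g.sites)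
    (hxy : x ≠ y) : g.sites = {x, y} := by
  refine (Finset.eq_of_subset_of_card_le ?_ ?_).symm
  · simp [Finset.insert_subset_iff, hx, hy]
  · rw [g.card_sites, Finset.card_pair hxy]

/-- The relation that joins the sites of every gate of a layer. -/
def Layer.rel (A : Layer N d) : Setoid (Fin N) := link A.partner Set.univ

lemma Layer.rel_of_mem (A : Layer N d) {g : Gate N d} (hg : g ∈ A.gates) {x y : Fin N}
    (hx : x ∈ g.sites) (hy : y ∈ g.sites) : A.rel x y := by
  by_cases hxy : x = y
  · rw [hxy]
  · rw [← A.partner_eq hg hx hy hxy]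
    exact link_rel trivial

lemma exists_support : ∀ {l : List (Gate N d)}, (l.Pairwise fun g h => Disjoint g.sites h.sites) →
    ∃ U : Finset (Fin N), U.card = 2 * l.length ∧ ∀ x ∈ U, ∃ g ∈ l, x ∈ g.sites
  | [], _ => ⟨∅, by simp⟩
  | g :: l, h => by
    rw [List.pairwise_cons] at h
    obtain ⟨U, hU, hU'⟩ := exists_support h.2
    refine ⟨g.sites ∪ U, ?_, fun x hx => ?_⟩
    · rw [Finset.card_union_of_disjoint, hU, g.card_sites, List.length_cons]
      · ring
      · rw [Finset.disjoint_left]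
        intro x hx hxU
        obtain ⟨k, hk, hxk⟩ := hU' x hxU
        exact Finset.disjoint_left.1 (h.1 k hk) hx hxk
    · rcases Finset.mem_union.1 hx with hx | hx
      · exact ⟨g, by simp, hx⟩
      · obtain ⟨k, hk, hxk⟩ := hU' x hx
        exact ⟨k, by simp [hk], hxk⟩

/-- A layer with `⌊N/2⌋` gates leaves out at most one site. -/
lemma Layer.eq_of_partner_eq_self (A : Layer N d) (h : A.gates.length = N / 2) (x y : Fin N)
    (hx : A.partner x = x) (hy : A.partner y = y) : x = y := by
  by_contra hxy
  obtain ⟨U, hU, hU'⟩ := exists_support A.disjoint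
  have hnot : ∀ z, A.partner z = z → z ∉ U := by
    intro z hz hzU
    obtain ⟨g, hg, hzg⟩ := hU' z hzU
    obtain ⟨z', hz', hne⟩ := Finset.exists_mem_ne (by rw [g.card_sites]; norm_num) z
    exact hne ((A.partner_eq hg hzg hz' hne.symm).symm.trans hz)
  have h1 : ({x, y} ∪ U).card = 2 + 2 * (N / 2) := by
    rw [Finset.card_union_of_disjoint, Finset.card_pair hxy, hU, h]
    simp [Finset.disjoint_insert_left, hnot x hx, hnot y hy]
  have h2 := Finset.card_le_univ ({x, y} ∪ U)
  rw [h1, Fintype.card_fin] at h2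
  omega

end Partner

/-! ### Brickwork circuits along a list of sites -/

section Bricks

lemma length_evenPairs {ι : Type*} : ∀ l : List ι, (evenPairs l).length = l.length / 2
  | [] => by simp [evenPairs]
  | [_] => by simp [evenPairs]
  | _ :: _ :: l => by
    rw [evenPairs, List.length_cons, length_evenPairs l, List.length_cons, List.length_cons]
    omega

lemma getElem_evenPairs {ι : Type*} : ∀ (l : List ι) (k : ℕ) (h : k < (evenPairs l).length)
    (h' : 2 * k + 1 < l.length), (evenPairs l)[k] = (l[2 * k], l[2 * k + 1])
  | [], k, h, _ => by simp [evenPairs] at h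
  | [_], k, h, _ => by simp [evenPairs] at h
  | x :: y :: l, 0, _, _ => rfl
  | x :: y :: l, k + 1, h, h' => by
    have := getElem_evenPairs l k (by simpa [evenPairs] using h)
      (by simp only [List.length_cons] at h'; omega)
    simpa [evenPairs, mul_add] using this

lemma evenPairs_eq_ofFn {ι : Type*} (l : List ι) : evenPairs l = List.ofFn
    fun k : Fin (l.length / 2) => (l[2 * (k : ℕ)], l[2 * (k : ℕ) + 1]) := by
  refine List.ext_getElem (by simp [length_evenPairs]) fun k h1 h2 => ?_
  rw [length_evenPairs] at h1
  rw [getElem_evenPairs l k _ (by omega), List.getElem_ofFn]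

lemma oddPairs_eq_ofFn {ι : Type*} (l : List ι) : oddPairs l = List.ofFn
    fun k : Fin ((l.length - 1) / 2) => (l[2 * (k : ℕ) + 1], l[2 * (k : ℕ) + 2]) := by
  refine List.ext_getElem (by simp [oddPairs, length_evenPairs]) fun k h1 h2 => ?_
  have h1' := h1
  rw [oddPairs, length_evenPairs, List.length_tail] at h1'
  simp only [oddPairs]
  rw [getElem_evenPairs l.tail k _ (by rw [List.length_tail]; omega), List.getElem_ofFn]
  simp [List.getElem_tail]

variable {κ ι D : Type*} [Fintype κ] [DecidableEq κ] [Fintype ι] [DecidableEq ι] [Fintype D]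
  [DecidableEq D]

open Classical in
/-- The splitting of the sites into the range of an embedding and the rest. -/
def embEquiv (σ : κ ↪ ι) : (ι → D) ≃ (κ → D) × ({k // k ∉ Set.range σ} → D) :=
  (Equiv.piEquivPiSubtypeProd (fun k => k ∈ Set.range σ) fun _ => D).trans
    (Equiv.prodCongr (Equiv.arrowCongr (Equiv.ofInjective σ σ.injective).symm (Equiv.refl D))
      (Equiv.refl _))

omit [Fintype D] in
lemma amp_gate2 (σ : κ ↪ ι) (a b : κ) (A : Matrix (D × D) (D × D) ℂ) :
    amp (embEquiv σ) (gate2 a b A) = gate2 (σ a) (σ b) A := by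
  ext x y
  have e1 : ∀ x : ι → D, (embEquiv σ x).1 = fun k => x (σ k) := fun x => rfl
  have e2 : ∀ x : ι → D, (embEquiv σ x).2 =
      fun k : {k // k ∉ Set.range σ} => x k := fun x => rfl
  rw [amp_apply, e1, e1, e2, e2]
  simp only [gate2, Matrix.of_apply]
  rw [mul_assoc, ite_zero_mul_ite_zero, mul_one]
  congr 2
  rw [eq_iff_iff, funext_iff]
  constructor
  · rintro ⟨h1, h2⟩ k hk hk'
    by_cases hr : k ∈ Set.range σ
    · obtain ⟨c, rfl⟩ := hr
      exact h1 c (fun e => hk (by rw [e])) fun e => hk' (by rw [e])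
    · exact h2 ⟨k, hr⟩
  · intro h
    refine ⟨fun k hk hk' => h _ (fun e => hk (σ.injective e)) fun e => hk' (σ.injective e), ?_⟩
    rintro ⟨k, hk⟩
    exact h k (fun e => hk ⟨a, e.symm⟩) fun e => hk ⟨b, e.symm⟩

variable (t : ℕ)

lemma ampHom_pr_pairFix (σ : κ ↪ ι) {a b : κ} (h : a ≠ b) :
    ampHom (tensEquiv t (embEquiv σ)) (pr (pairFix D t a b)) = pr (pairFix D t (σ a) (σ b)) := by
  rw [pairFix_of_ne t h, pairFix_of_ne t (σ.injective.ne h)]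
  have h1 := ampHom_pr_fixSpace t (embEquiv (D := D) σ) (ampU (pairEquiv (D := D) h))
    (continuous_ampU _)
  have h2 : ∀ g : unitaryGroup (D × D) ℂ, ((ampU (pairEquiv h) g : unitaryGroup (κ → D) ℂ) :
      Matrix (κ → D) (κ → D) ℂ) = gate2 a b (g : Matrix (D × D) (D × D) ℂ) := fun g =>
    (gate2_eq_amp h _).symm
  simp only [h2, amp_gate2] at h1
  exact h1

/-- The invariants of all unitaries on the range of an embedding are the invariants of all pairs of
sites in the range. -/
lemma fixSpace_amp_eq (σ : κ ↪ ι) (hκ : 2 ≤ Fintype.card κ) (hD : 2 ≤ Fintype.card D) :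
    fixSpace t (fun U : unitaryGroup (κ → D) ℂ =>
      amp (embEquiv (D := D) σ) (U : Matrix (κ → D) (κ → D) ℂ))
      = invSpace (pairFix D t) (restr ⊤ (Set.range σ)) := by
  apply le_antisymm
  · intro w hw
    rw [mem_invSpace]
    rintro i j (rfl | ⟨-, ⟨a, rfl⟩, ⟨b, rfl⟩⟩)
    · rw [pairFix_self]; trivial
    · by_cases hab : a = b
      · rw [hab, pairFix_self]; trivial
      rw [pairFix_of_ne t (σ.injective.ne hab)]
      intro g
      have h1 := hw (ampU (pairEquiv hab) g)
      change rep t (amp (embEquiv σ) (amp (pairEquiv hab) (g : Matrix (D × D) (D × D) ℂ))) w = w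
        at h1
      rw [← gate2_eq_amp, amp_gate2] at h1
      exact h1
  · intro w hw U
    refine rep_amp_apply_eq_self t (embEquiv σ) hκ hD (fun a b hab g => ?_) U
    rw [amp_gate2]
    have h1 := mem_invSpace.1 hw (σ a) (σ b) (Or.inr ⟨trivial, ⟨a, rfl⟩, ⟨b, rfl⟩⟩)
    rw [pairFix_of_ne t (σ.injective.ne hab)] at h1
    exact h1 g

variable {N d : ℕ}

lemma mop_haarGate {i j : Fin N} (h : i ≠ j) :
    mop t (haarGate (d := d) i j h).globalLaw = pr (pairFix (Fin d) t i j) := by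
  rw [← fixSpace_onSites t h rfl]
  exact mop_map_haarU t (onSitesHom d {i, j}) (continuous_onSitesHom _)

lemma fix_haarGate {i j : Fin N} (h : i ≠ j) :
    (haarGate (d := d) i j h).fix t = pairFix (Fin d) t i j :=
  fixSpace_onSites t h rfl

/-- The brickwork circuit on `m` qudits, transported to a list of `m` sites. -/
lemma ampHom_brick {l : List (Fin N)} (hl : l.Nodup) :
    ampHom (tensEquiv t (embEquiv (D := Fin d) ⟨l.get, List.nodup_iff_injective_get.1 hl⟩))
      (mop t (Measure.mconv (brickLayerOdd l.length d).law (brickLayerEven l.length d).law))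
      = pairProd (pairFix (Fin d) t) (oddPairs l) * pairProd (pairFix (Fin d) t) (evenPairs l) := by
  rw [mop_mconv, map_mul, mop_layer, mop_layer, map_list_prod, map_list_prod, evenPairs_eq_ofFn,
    oddPairs_eq_ofFn, pairProd, pairProd, brickLayerOdd, brickLayerEven]
  simp only [List.map_ofFn, Function.comp_def, mop_haarGate]
  congr 3
  · ext1 k
    exact ampHom_pr_pairFix t _ (by simp [Fin.ext_iff])
  · ext1 k
    exact ampHom_pr_pairFix t _ (by simp [Fin.ext_iff])

lemma gap_haar_le_one (X : Type*) [Fintype X] [DecidableEq X] (ν : Measure (unitaryGroup X ℂ)) :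
    gap t ν ≤ 1 := by
  rw [gap, opNorm]
  linarith [norm_nonneg (Matrix.toEuclideanCLM (𝕜 := ℂ) (momentOp t ν - momentOp t (haarU X)))]

lemma Gate.localGap_haarGate {i j : Fin N} (h : i ≠ j) :
    (haarGate (d := d) i j h).localGap t = 1 := by
  change 1 - opNorm (momentOp t (haarU _) - momentOp t (haarU _)) = 1
  rw [sub_self, opNorm, map_zero, norm_zero, sub_zero]

/-- Universality: the invariants of all pairs of qudits are invariant under all unitaries. -/
lemma mem_fixSpace_of_pairFix {m : ℕ} (hm : 2 ≤ m) (hd : 2 ≤ d) {w : RepSpace t (Fin m → Fin d)}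
    (h : ∀ i j : Fin m, w ∈ pairFix (Fin d) t i j) :
    w ∈ fixSpace t (fun U : unitaryGroup (Fin m → Fin d) ℂ =>
      (U : Matrix (Fin m → Fin d) (Fin m → Fin d) ℂ)) := by
  have hid : ∀ A : Matrix (Fin m → Fin d) (Fin m → Fin d) ℂ,
      amp (Equiv.prodPUnit.{0} _).symm A = A := by
    intro A
    ext x y
    simp [amp_apply]
  intro U
  have := rep_amp_apply_eq_self t (κ := Fin m) (D := Fin d) (w := w)
    (Equiv.prodPUnit.{0} _).symm (by simpa using hm) (by simpa using hd) (fun i j hij g => by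
      rw [hid]
      have h4 := h i j
      rw [pairFix_of_ne t hij] at h4
      exact h4 g) U
  rwa [hid] at this

/-- The brickwork gap is positive: the two layers are projections, and by universality their common
range consists of the vectors that are invariant under all unitaries. -/
lemma brickGap_pos {m : ℕ} (hm : 2 ≤ m) (hd : 2 ≤ d) : 0 < brickGap t m d := by
  have hlayer : ∀ A : Layer m d, (∀ g ∈ A.gates, g.localGap t = 1) →
      mop t A.law = pr (gatesFix t A.gates) := by
    intro A hA
    have := (gates_prod t A.disjoint).2.2 0 le_rfl fun g hg => by rw [hA g hg, sub_self]
    rw [mop_layer]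
    exact sub_eq_zero.1 (norm_le_zero_iff.1 this)
  have h1 := hlayer (brickLayerEven m d) fun g hg => by
    obtain ⟨k, rfl⟩ := List.mem_ofFn.1 hg
    exact Gate.localGap_haarGate t _
  have h2 := hlayer (brickLayerOdd m d) fun g hg => by
    obtain ⟨k, rfl⟩ := List.mem_ofFn.1 hg
    exact Gate.localGap_haarGate t _
  have h3 : fixSpace t (fun U : unitaryGroup (Fin m → Fin d) ℂ =>
      (U : Matrix (Fin m → Fin d) (Fin m → Fin d) ℂ))
      = gatesFix t (brickLayerOdd m d).gates ⊓ gatesFix t (brickLayerEven m d).gates := by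
    apply le_antisymm
    · intro w hw
      have hg : ∀ g : Gate m d, w ∈ g.fix t := fun g U => hw (onSitesHom d g.sites U)
      exact ⟨(mem_gatesFix t).2 fun g _ => hg g, (mem_gatesFix t).2 fun g _ => hg g⟩
    · rintro w ⟨hw1, hw2⟩ U
      have hstep : ∀ n (h : n + 1 < m), w ∈ pairFix (Fin d) t (⟨n, by omega⟩ : Fin m) ⟨n + 1, h⟩ := by
        intro n h
        rcases Nat.even_or_odd' n with ⟨k, rfl | rfl⟩
        · rw [← fix_haarGate t (by simp)]
          exact (mem_gatesFix t).1 hw2 _ (List.mem_ofFn.2 ⟨⟨k, by omega⟩, rfl⟩)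
        · rw [← fix_haarGate t (by simp)]
          exact (mem_gatesFix t).1 hw1 _ (List.mem_ofFn.2 ⟨⟨k, by omega⟩, rfl⟩)
      have hall : ∀ (n k : ℕ) (h : n + k < m),
          w ∈ pairFix (Fin d) t (⟨n, by omega⟩ : Fin m) ⟨n + k, h⟩ := by
        intro n k
        induction k with
        | zero => intro h; rw [show (⟨n + 0, h⟩ : Fin m) = ⟨n, by omega⟩ from rfl, pairFix_self]; trivial
        | succ k ih => exact fun h => pairFix_trans t _ _ _ ⟨ih (by omega), hstep (n + k) h⟩
      have hpair : ∀ i j : Fin m, w ∈ pairFix (Fin d) t i j := by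
        intro i j
        rcases le_total i.1 j.1 with h | h
        · obtain ⟨k, hk⟩ := Nat.exists_eq_add_of_le h
          have := hall i.1 k (by omega)
          rwa [show (⟨i.1 + k, by omega⟩ : Fin m) = j from Fin.ext hk.symm] at this
        · obtain ⟨k, hk⟩ := Nat.exists_eq_add_of_le h
          have := hall j.1 k (by omega)
          rw [show (⟨j.1 + k, by omega⟩ : Fin m) = i from Fin.ext hk.symm] at this
          rw [pairFix_symm]
          exact this
      exact mem_fixSpace_of_pairFix t hm hd hpair U
  have h4 := norm_pr_mul_pr_sub_lt_one (gatesFix t (brickLayerOdd m d).gates)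
    (gatesFix t (brickLayerEven m d).gates)
  rw [brickGap, gap, opNorm_momentOp_sub, mop_mconv, h1, h2, mop_haarU, h3]
  linarith

variable (N d) in
lemma fComplete_le {m : ℕ} (hm : 2 ≤ m) (hmN : m ≤ N) : fComplete N t d ≤ brickGap t m d :=
  csInf_le (((Set.finite_Icc 2 N).image _).bddBelow) ⟨m, ⟨hm, hmN⟩, rfl⟩

lemma fComplete_pos (hN : 2 ≤ N) (hd : 2 ≤ d) : 0 < fComplete N t d := by
  have hne : ((fun m => brickGap t m d) '' Set.Icc 2 N).Nonempty :=
    ⟨_, 2, ⟨le_rfl, hN⟩, rfl⟩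
  obtain ⟨m, hm, he⟩ := hne.csInf_mem ((Set.finite_Icc 2 N).image _)
  rw [fComplete, ← he]
  exact brickGap_pos t hm.1 hd

lemma fComplete_le_one (hN : 2 ≤ N) : fComplete N t d ≤ 1 :=
  (fComplete_le t N d le_rfl hN).trans (gap_haar_le_one t _ _)

variable (N d) in
/-- The system of projections onto the invariants of the gates on pairs of qudits. -/
def pairSystem (hN : 2 ≤ N) (hd : 2 ≤ d) : PairSystem (Fin N) (RepSpace t (Fin N → Fin d)) where
  V := pairFix (Fin d) t
  f := fComplete N t d
  f_nonneg := (fComplete_pos t hN hd).le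
  f_le_one := fComplete_le_one t hN
  refl := pairFix_self t
  symm := pairFix_symm t
  trans := pairFix_trans t
  comm := fun p q h => commute_pairFix t h
  brick := by
    intro l hl
    rcases le_or_gt 2 l.length with h2 | h2
    · have hlN : l.length ≤ N := by simpa using hl.length_le_card
      have hr : {x | x ∈ l} = Set.range (⟨l.get, List.nodup_iff_injective_get.1 hl⟩ :
          Fin l.length ↪ Fin N) := by
        ext x
        exact List.mem_iff_get
      have h1 := ampHom_pr_fixSpace t (embEquiv (D := Fin d)
        (⟨l.get, List.nodup_iff_injective_get.1 hl⟩ : Fin l.length ↪ Fin N))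
        (MonoidHom.id (unitaryGroup (Fin l.length → Fin d) ℂ)) continuous_id
      simp only [MonoidHom.id_apply] at h1
      rw [fixSpace_amp_eq t _ (by simpa using h2) (by simpa using hd), ← mop_haarU] at h1
      rw [hr, ← ampHom_brick t hl, ← h1, ← map_sub]
      refine (norm_ampHom_le _ _).trans ?_
      have h3 := fComplete_le t N d h2 hlN
      rw [brickGap, gap, opNorm_momentOp_sub] at h3
      linarith
    · have h0 : ∀ p ∈ evenPairs l, False := by
        intro p hp
        have := length_evenPairs l
        rw [show l.length / 2 = 0 by omega, List.length_eq_zero_iff] at this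
        simp [this] at hp
      have e1 : evenPairs l = [] := List.eq_nil_iff_forall_not_mem.2 h0
      have e2 : oddPairs l = [] := by
        rw [← List.length_eq_zero_iff, oddPairs, length_evenPairs, List.length_tail]
        omega
      have e3 : invSpace (pairFix (Fin d) t) (restr ⊤ {x | x ∈ l}) = ⊤ := by
        rw [eq_top_iff]
        intro w _
        rw [mem_invSpace]
        intro i j hij
        have : i = j := by
          rcases hij with h | ⟨-, h, h'⟩
          · exact h
          · obtain ⟨a, ha⟩ | ha : (∃ a, l = [a]) ∨ l = [] := by
              rcases l with _ | ⟨a, _ | ⟨b, l⟩⟩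
              · exact Or.inr rfl
              · exact Or.inl ⟨a, rfl⟩
              · simp at h2
            · rw [ha] at h h'
              have h3 : i = a := by simpa using h
              have h4 : j = a := by simpa using h'
              rw [h3, h4]
            · rw [ha] at h; simp at h
        rw [this, pairFix_self]
        trivial
      rw [e1, e2, e3, pr_top]
      simpa [pairProd] using fComplete_le_one (d := d) t hN

/-- The invariants of the gates of a layer in terms of the relation of the layer. -/
lemma gatesFix_eq (hN : 2 ≤ N) (hd : 2 ≤ d) (A : Layer N d) :
    pr (gatesFix t A.gates) = (pairSystem t N d hN hd).proj A.rel := by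
  rw [PairSystem.proj]
  congr 1
  ext w
  rw [(pairSystem t N d hN hd).mem_inv_iff_le, mem_gatesFix, Layer.rel, link_le_iff]
  constructor
  · intro h x _
    change w ∈ pairFix (Fin d) t x (A.partner x)
    by_cases hx : A.partner x = x
    · rw [hx, pairFix_self]; trivial
    · obtain ⟨g, hg, h1, h2⟩ := A.exists_gate hx
      rw [← fixSpace_onSites t (Ne.symm hx) (g.sites_eq h1 h2 (Ne.symm hx))]
      exact h g hg
  · intro h g hg
    obtain ⟨i, j, hij, hs⟩ := Finset.card_eq_two.1 g.card_sites
    rw [Gate.fix, fixSpace_onSites t hij hs]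
    have h1 := h i trivial
    rw [A.partner_eq hg (by simp [hs]) (by simp [hs]) hij] at h1
    exact h1

end Bricks

end

end RandomCircuit

namespace RandomCircuit

noncomputable section

/-! ### Blocks of a circuit -/

section Circuit

lemma gap_nonneg (t : ℕ) {X : Type*} [Fintype X] [DecidableEq X] (ν : Measure (unitaryGroup X ℂ))
    [IsProbabilityMeasure ν] : 0 ≤ gap t ν := by
  have h1 := mop_map_mul_pr (t := t) (θ := MonoidHom.id (unitaryGroup X ℂ)) continuous_id ν
  rw [MonoidHom.coe_id, Measure.map_id] at h1
  have h2 : mop t ν - mop t (haarU X) = mop t ν * (1 - mop t (haarU X)) := by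
    rw [mop_haarU, mul_sub, mul_one]
    exact congrArg _ h1.symm
  rw [gap, opNorm_momentOp_sub, h2, mop_haarU, sub_nonneg]
  exact (norm_mul_le _ _).trans
    (mul_le_one₀ (norm_mop_le t ν) (norm_nonneg _) (norm_one_sub_pr_le _))

variable {N d : ℕ} (t : ℕ) (C : ℕ → Layer N d) (l : ℕ)

lemma Gate.localGap_nonneg (g : Gate N d) : 0 ≤ g.localGap t := gap_nonneg t _

lemma Gate.localGap_le_one (g : Gate N d) : g.localGap t ≤ 1 := gap_haar_le_one t _ _

lemma blockLocalGap_nonneg (i : ℕ) : 0 ≤ blockLocalGap t C l i := by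
  refine Real.sInf_nonneg ?_
  rintro x ⟨j, -, g, -, rfl⟩
  exact g.localGap_nonneg t

variable {C l} in
lemma blockLocalGap_le {i j : ℕ} (hj : j < l) {g : Gate N d} (hg : g ∈ (C (l * i + j)).gates) :
    blockLocalGap t C l i ≤ g.localGap t := by
  refine csInf_le ⟨0, ?_⟩ ⟨j, hj, g, hg, rfl⟩
  rintro x ⟨j, -, g, -, rfl⟩
  exact g.localGap_nonneg t

variable {C l} in
/-- A block that connects at least two sites contains a gate. -/
lemma exists_gate_of_connected (hN : 2 ≤ N) {i : ℕ} (h : (blockGraph C l i).Connected) :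
    ∃ j < l, ∃ g, g ∈ (C (l * i + j)).gates := by
  have : Nontrivial (Fin N) := Fin.nontrivial_iff_two_le.2 hN
  obtain ⟨y, hy⟩ := h.preconnected.exists_adj_of_nontrivial (⟨0, by omega⟩ : Fin N)
  rw [blockGraph, SimpleGraph.fromRel_adj] at hy
  rcases hy.2 with ⟨j, hj, g, hg, -⟩ | ⟨j, hj, g, hg, -⟩
  · exact ⟨j, hj, g, hg⟩
  · exact ⟨j, hj, g, hg⟩

variable {C l} in
lemma blockLocalGap_le_one (hN : 2 ≤ N) {i : ℕ} (h : (blockGraph C l i).Connected) :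
    blockLocalGap t C l i ≤ 1 := by
  obtain ⟨j, hj, g, hg⟩ := exists_gate_of_connected hN h
  exact (blockLocalGap_le t hj hg).trans (g.localGap_le_one t)

variable {C l} in
/-- The layers of a connected block join all sites. -/
lemma relSup_eq_top {i : ℕ} (h : (blockGraph C l i).Connected) :
    relSup (fun k => (C k).rel) (l * i) l = ⊤ := by
  rw [eq_top_iff]
  intro x y _
  obtain ⟨w⟩ := h.preconnected x y
  induction w with
  | nil => exact Setoid.refl' _ _
  | cons hadj _ ih =>
    refine Setoid.trans' _ ?_ (ih trivial)
    rw [blockGraph, SimpleGraph.fromRel_adj] at hadj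
    rcases hadj.2 with ⟨j, hj, g, hg, ha, hb⟩ | ⟨j, hj, g, hg, hb, ha⟩
    all_goals
      exact le_relSup (fun k => (C k).rel) (l * i) hj
        ((C (l * i + j)).rel_of_mem hg ha hb)

lemma mul_avgLocalGap_le (K : ℕ) :
    K * avgLocalGap t C l ≤ ∑ i ∈ Finset.range K, blockLocalGap t C l i := by
  rcases Nat.eq_zero_or_pos K with rfl | hK
  · simp
  have hK' : (0 : ℝ) < K := by exact_mod_cast hK
  have h1 : avgLocalGap t C l ≤ 1 / (K : ℝ) * ∑ i ∈ Finset.range K, blockLocalGap t C l i := by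
    refine ciInf_le (f := fun K : {K : ℕ // 1 ≤ K} =>
      1 / (K : ℝ) * ∑ i ∈ Finset.range (K : ℕ), blockLocalGap t C l i) ⟨0, ?_⟩ ⟨K, hK⟩
    rintro _ ⟨K, rfl⟩
    exact mul_nonneg (by positivity) (Finset.sum_nonneg fun i _ => blockLocalGap_nonneg t C l i)
  rw [one_div, le_inv_mul_iff₀ hK'] at h1
  exact h1

lemma archF_pos (hN : 2 ≤ N) (hd : 2 ≤ d) : 0 < archF t C := by
  rw [archF]
  split_ifs
  · exact fComplete_pos t hN hd
  · exact pow_pos (fComplete_pos t hN hd) _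

lemma archF_le_one (hN : 2 ≤ N) (hd : 2 ≤ d) : archF t C ≤ 1 := by
  rw [archF]
  split_ifs
  · exact fComplete_le_one t hN
  · exact pow_le_one₀ (fComplete_pos t hN hd).le (fComplete_le_one t hN)

/-- Merging a layer with the preceding layers of its block costs a factor `archF t C`. -/
lemma archF_le_gap₂ (hN : 2 ≤ N) (hd : 2 ≤ d) (s : ℕ) {j : ℕ} (hj : 0 < j) :
    archF t C ≤ (pairSystem t N d hN hd).gap₂ (C (s + j)).rel
      (relSup (fun k => (C k).rel) s j) := by
  rw [archF]
  split_ifs with h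
  · refine PairSystem.f_le_gap₂_matching (pairSystem t N d hN hd) (β := (C (s + 0)).partner)
      (C _).partner_involutive (C _).partner_involutive ((C _).eq_of_partner_eq_self (h _))
      ((C _).eq_of_partner_eq_self (h _)) fun x => ?_
    exact le_relSup (fun k => (C k).rel) s hj (link_rel (a := (C (s + 0)).partner) trivial)
  · have := PairSystem.pow_le_gap₂_matching (pairSystem t N d hN hd) (by simpa using hN)
      (relSup (fun k => (C k).rel) s j) (C (s + j)).partner_involutive
    rw [Nat.card_eq_fintype_card, Fintype.card_fin] at this
    exact this

/-- On the whole system, Haar averaging is the projection onto the common invariants of all pairs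
of qudits. -/
lemma mop_haarU_eq_proj (hN : 2 ≤ N) (hd : 2 ≤ d) :
    mop t (haarU (Fin N → Fin d)) = (pairSystem t N d hN hd).proj ⊤ := by
  rw [mop_haarU, PairSystem.proj]
  congr 1
  apply le_antisymm
  · intro w hw
    rw [mem_invSpace]
    intro i j _
    change w ∈ pairFix (Fin d) t i j
    by_cases hij : i = j
    · rw [hij, pairFix_self]; trivial
    · rw [← fixSpace_onSites t hij rfl]
      exact fun U => hw (onSitesHom d {i, j} U)
  · intro w hw
    exact mem_fixSpace_of_pairFix t hN hd fun i j => mem_invSpace.1 hw i j trivial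

/-- The distance of a circuit from the Haar measure is bounded by the product of the bounds for its
complete blocks. -/
theorem opNorm_momentOp_circuitLaw_sub_le (hN : 2 ≤ N) (hd : 2 ≤ d)
    (hC : ∀ i, (blockGraph C l i).Connected) (L : ℕ) :
    opNorm (momentOp t (circuitLaw C L) - momentOp t (haarU (Fin N → Fin d)))
      ≤ ∏ i ∈ Finset.range (L / l),
        (1 - archF t C ^ (l - 1) * blockLocalGap t C l i ^ l) := by
  have hA₁ : ∀ k, mop t (C k).law * (pairSystem t N d hN hd).proj (C k).rel
      = (pairSystem t N d hN hd).proj (C k).rel := fun k => by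
    rw [← gatesFix_eq, mop_layer]
    exact (gates_prod t (C k).disjoint).1
  have hA₂ : ∀ k, (pairSystem t N d hN hd).proj (C k).rel * mop t (C k).law
      = (pairSystem t N d hN hd).proj (C k).rel := fun k => by
    rw [← gatesFix_eq, mop_layer]
    exact (gates_prod t (C k).disjoint).2.1
  rw [opNorm_momentOp_sub, mop_circuitLaw, mop_haarU_eq_proj t hN hd]
  refine PairSystem.norm_opProd_sub_proj_top_le (pairSystem t N d hN hd)
    (q := fun k => (C k).rel) (fun k => norm_mop_le t _) hA₁ hA₂ (fun i => ?_) L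
  obtain ⟨n, rfl⟩ : ∃ n, l = n + 1 := by
    obtain ⟨j, hj, -⟩ := exists_gate_of_connected hN (hC 0)
    exact ⟨l - 1, by omega⟩
  have h1 := PairSystem.norm_opProd_sub_proj_le (pairSystem t N d hN hd)
    (q := fun k => (C k).rel) (fun k => norm_mop_le t _) hA₁ hA₂ (s := (n + 1) * i) (l := n + 1)
    (blockLocalGap_nonneg t C (n + 1) i) (archF_pos t C hN hd).le (fun j hj => ?_)
    (fun j _ hj0 => archF_le_gap₂ t C hN hd _ hj0) n (Nat.lt_succ_self n)
  · rw [relSup_eq_top (hC i)] at h1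
    rw [Nat.add_sub_cancel, mul_comm (archF t C ^ n)]
    exact h1
  · rw [← gatesFix_eq, mop_layer]
    refine (gates_prod t (C _).disjoint).2.2 _ ?_ fun g hg => ?_
    · linarith [blockLocalGap_le_one t hN (hC i)]
    · linarith [blockLocalGap_le t hj hg]

end Circuit

end

end RandomCircuit

namespace RandomCircuit

/-! ### From the gap of the blocks to approximate designs -/

section Design

variable {N d : ℕ} (t : ℕ) (C : ℕ → Layer N d) {l : ℕ}

lemma avgLocalGap_le_one (hN : 2 ≤ N) (hC : ∀ i, (blockGraph C l i).Connected) :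
    avgLocalGap t C l ≤ 1 := by
  have h1 := mul_avgLocalGap_le t C l 1
  have h2 := blockLocalGap_le_one t hN (hC 0)
  rw [Nat.cast_one, one_mul, Finset.sum_range_one] at h1
  exact h1.trans h2

lemma opNorm_momentOp_zero_sub {X : Type*} [Fintype X] [DecidableEq X]
    (μ ν : Measure (unitaryGroup X ℂ)) [IsProbabilityMeasure μ] [IsProbabilityMeasure ν] :
    opNorm (momentOp 0 μ - momentOp 0 ν) = 0 := by
  have h : momentOp 0 μ = momentOp 0 ν := by
    ext x y
    simp [momentOp, tensorPower]
  rw [h, sub_self, opNorm, map_zero, norm_zero]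

/-- The accuracy of a design in exponential form. -/
lemma exp_neg_eq_div (hd : 0 < d) {ε : ℝ} (hε : 0 < ε) :
    Real.exp (-(2 * N * t * Real.log d - Real.log ε))
      = ε / (Fintype.card (Fin N → Fin d) : ℝ) ^ (2 * t) := by
  have hd' : (0 : ℝ) < d := by exact_mod_cast hd
  rw [neg_sub, Real.exp_sub, Real.exp_log hε, Fintype.card_fun, Fintype.card_fin,
    Fintype.card_fin, Nat.cast_pow, ← pow_mul]
  congr 1
  rw [show (2 * N * t * Real.log d : ℝ) = ((N * (2 * t) : ℕ) : ℝ) * Real.log d by push_cast; ring,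
    Real.exp_nat_mul, Real.exp_log hd']

variable {C} in
/-- The depth condition, solved for the number of blocks. -/
lemma mul_le_of_haarDepth_le (hl : 1 ≤ l) (hF : 0 < archF t C) (hgap : 0 < avgLocalGap t C l)
    {L : ℕ} {ε : ℝ} (hL : avgLocalGap t C l ^ (-(l : ℤ)) * haarDepth t C l ε ≤ L) :
    l * (2 * N * t * Real.log d - Real.log ε)
      ≤ L * (archF t C ^ (l - 1) * avgLocalGap t C l ^ l) := by
  obtain ⟨n, rfl⟩ := Nat.exists_eq_add_of_le' hl
  rw [haarDepth, _root_.zpow_neg, zpow_natCast,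
    show (-((n + 1 : ℕ) : ℤ) + 1) = -(n : ℤ) by push_cast; ring, _root_.zpow_neg, zpow_natCast,
    inv_mul_le_iff₀ (by positivity), inv_mul_le_iff₀ (by positivity)] at hL
  rw [Nat.add_sub_cancel]
  linarith

end Design

end RandomCircuit

open RandomCircuit in
theorem theorem2 (N d t l : ℕ) (hN : 2 ≤ N) (hd : 2 ≤ d) (ε : ℝ) (hε : 0 < ε)
    (C : ℕ → RandomCircuit.Layer N d)
    (hC : ∀ i, (RandomCircuit.blockGraph C l i).Connected)
    (hgap : 0 < RandomCircuit.avgLocalGap t C l)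
    (L : ℕ) (hLε : l ∣ L ∨ ε ≤ 1)
    (hL : RandomCircuit.avgLocalGap t C l ^ (-(l : ℤ)) * RandomCircuit.haarDepth t C l ε
      ≤ (L : ℝ)) :
    RandomCircuit.IsApproxDesign t ε (RandomCircuit.circuitLaw C L) := by
  have hl : 1 ≤ l := by
    obtain ⟨j, hj, -⟩ := exists_gate_of_connected hN (hC 0)
    omega
  have hl' : (0 : ℝ) < l := by exact_mod_cast hl
  have hF := archF_pos t C hN hd
  have hF1 : archF t C ^ (l - 1) ≤ 1 := pow_le_one₀ hF.le (archF_le_one t C hN hd)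
  have hFpos : 0 < archF t C ^ (l - 1) := pow_pos hF _
  have hY := mul_le_of_haarDepth_le t hl hF hgap hL
  have hprod := opNorm_momentOp_circuitLaw_sub_le t C l hN hd hC L
  have hmean : ((L / l : ℕ) : ℝ) * (archF t C ^ (l - 1) * avgLocalGap t C l ^ l)
      ≤ ∑ i ∈ Finset.range (L / l), archF t C ^ (l - 1) * blockLocalGap t C l i ^ l := by
    rw [← Finset.mul_sum, mul_left_comm]
    exact mul_le_mul_of_nonneg_left (mul_pow_le_sum_pow hl (blockLocalGap_nonneg t C l) hgap.le
      (mul_avgLocalGap_le t C l _)) hFpos.le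
  have hg1 : ∀ i, archF t C ^ (l - 1) * blockLocalGap t C l i ^ l ≤ 1 := fun i =>
    mul_le_one₀ hF1 (pow_nonneg (blockLocalGap_nonneg t C l i) _)
      (pow_le_one₀ (blockLocalGap_nonneg t C l i) (blockLocalGap_le_one t hN (hC i)))
  have hγ0 : 0 < archF t C ^ (l - 1) * avgLocalGap t C l ^ l := mul_pos hFpos (pow_pos hgap _)
  rw [IsApproxDesign]
  rcases hLε with ⟨K, rfl⟩ | hε1
  -- complete blocks only: `1 - x ≤ exp (-x)` suffices
  · rw [← exp_neg_eq_div t (by omega) hε]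
    rw [Nat.mul_div_cancel_left K hl] at hprod hmean
    refine hprod.trans ((prod_le_exp_neg hg1).trans (Real.exp_le_exp.2 (neg_le_neg ?_)))
    refine le_trans ?_ hmean
    rw [Nat.cast_mul] at hY
    exact le_of_mul_le_mul_left (hY.trans_eq (mul_assoc _ _ _)) hl'
  rcases Nat.eq_zero_or_pos t with rfl | ht
  · have := isProbabilityMeasure_circuitLaw C L
    rw [opNorm_momentOp_zero_sub]
    positivity
  -- an incomplete block is compensated by the second-order term of the logarithm
  · have hY2 : 2 ≤ 2 * N * t * Real.log d - Real.log ε := by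
      have h1 : Real.log ε ≤ 0 := Real.log_nonpos hε.le hε1
      have h2 : Real.log 2 ≤ Real.log d := Real.log_le_log (by norm_num) (by exact_mod_cast hd)
      have h3 := Real.log_two_gt_d9
      have h4 : (2 : ℝ) ≤ N := by exact_mod_cast hN
      have h5 : (1 : ℝ) ≤ t := by exact_mod_cast ht
      have h6 : (2 : ℝ) ≤ N * t := by nlinarith
      nlinarith
    have hγ1 : archF t C ^ (l - 1) * avgLocalGap t C l ^ l ≤ 1 :=
      mul_le_one₀ hF1 (pow_nonneg hgap.le _)
        (pow_le_one₀ hgap.le (avgLocalGap_le_one t C hN hC))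
    rw [← exp_neg_eq_div t (by omega) hε]
    refine hprod.trans ((prod_le_pow_of_mean hg1 hγ1 hmean).trans (pow_le_exp_neg hγ0 hγ1 hY2 ?_))
    have h1 : (L : ℝ) ≤ l * (((L / l : ℕ) : ℝ) + 1) := by
      exact_mod_cast (Nat.lt_mul_div_succ L hl).le
    have h2 := hY.trans (mul_le_mul_of_nonneg_right h1 hγ0.le)
    exact le_of_mul_le_mul_left (h2.trans_eq (mul_assoc _ _ _)) hl'
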